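/- Let $m,n,t$ be integers with $m,n,t\le -1$, not all equal to $-1$, and let $a,b,c$ be non-zero complex numbers with $$1+a+\tfrac1b=m,\qquad 1+b+\tfrac1c=n,\qquad 1+c+\tfrac1a=t .$$ (There are two solutions; both are real, one with $-1<a,b,c<0$ and one with $a,b,c<-1$.) Let $Q^{\pm}(m,n,t)=\mathfrak g(A)$ be the contragredient Lie superalgebra with Cartan matrix $$A=(a_{ij})=\begin{pmatrix}0&1&a\\ b&0&1\\ 1&c&0\end{pmatrix}$$ and all three simple roots odd. That is, let $\mathfrak h$ be a complex vector space of dimension $6-\operatorname{rank}A$ with linearly independent $h_1,h_2,h_3\in\mathfrak h$ and linearly independent $\alpha_1,\alpha_2,\alpha_3\in\mathfrak h^*$ such that $\alpha_j(h_i)=a_{ij}$; then $\mathfrak g(A)$ is the quotient of the Lie superalgebra generated by the even abelian subalgebra $\mathfrak h$ and odd elements $X_i,Y_i$, with relations $[h,X_i]=\alpha_i(h)X_i$, $[h,Y_i]=-\alpha_i(h)Y_i$, $[X_i,Y_j]=\delta_{ij}h_i$, by its largest ideal intersecting $\mathfrak h$ trivially. A root is real if it, or its half, is simple in some base obtained from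 $\{\alpha_1,\alpha_2,\alpha_3\}$ by a sequence of even reflections and odd reflections (at regular isotropic simple roots). A module $V$ is integrable if for every real root $\alpha$ every element of $\mathfrak g(A)_\alpha$ acts locally nilpotently on $V$. A weight $\lambda\in\mathfrak h^*$ is typical if $(\lambda+\rho)(h_\alpha)\ne 0$ for every real isotropic root $\alpha$, where $h_\alpha$ spans $[\mathfrak g(A)_\alpha,\mathfrak g(A)_{-\alpha}]$ and $\rho(h_i)=\tfrac12a_{ii}$ for all $i$ (here $\rho=0$). Modules are $\mathbb Z/2$-graded and highest weight vectors are homogeneous. Write $\lambda_i=\lambda(h_i)$. For every $\lambda\in\mathfrak h^*$ there is an irreducible highest weight module $L(\lambda)$ with highest weight $\lambda$, unique up to isomorphism and change of parity. The module $L(\lambda)$ is integrable and non-trivial if and only if $$\begin{pmatrix}\lambda_1\\ \lambda_2\\ \lambda_3\end{pmatrix}=\frac{abc}{1+abc}\begin{pmatrix}1&-\frac1b&\frac1{bc}\\ \frac1{ac}&1&-\frac1c\\ -\frac1a&\frac1{ba}&1\end{pmatrix}\begin{pmatrix}x\\ y\\ z\end{pmatrix}\qquad\text{for some } x,y,z\in\mathbb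 Z_{>0}.$$ All these weights are typical. If $L(\lambda)$ is integrable and $\lambda$ is not typical, then $\lambda=0$. -/

import Mathlib

open scoped Matrix

universe u v w

namespace SuperKM

/-! ### Superalgebras and Lie superalgebras over the complex numbers -/

/-- The sign `(-1)^(i j)` attached to two parities. -/
noncomputable def superSign (i j : ZMod 2) : ℂ := if i = 1 ∧ j = 1 then -1 else 1

/-- A (not necessarily associative) complex superalgebra: a vector space `L = L₀ ⊕ L₁` with a
bilinear product `bracket` that is compatible with the parities. -/
class Superalgebra (L : Type u) [AddCommGroup L] [Module ℂ L] where
  part : ZMod 2 → Submodule ℂ L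
  isCompl_part : IsCompl (part 0) (part 1)
  bracket : L →ₗ[ℂ] L →ₗ[ℂ] L
  bracket_mem : ∀ {i j : ZMod 2} {x y : L}, x ∈ part i → y ∈ part j → bracket x y ∈ part (i + j)

open Superalgebra (part bracket)

/-- A superalgebra is a Lie superalgebra if its product is super skew-symmetric and satisfies the
super Jacobi identity. -/
class IsLieSuperalgebra (L : Type u) [AddCommGroup L] [Module ℂ L] [Superalgebra L] : Prop where
  skew : ∀ {i j : ZMod 2} {x y : L}, x ∈ part i → y ∈ part j →
    bracket x y + superSign i j • bracket y x = 0
  jacobi : ∀ {i j : ZMod 2} {x y : L} (z : L), x ∈ part i → y ∈ part j →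
    bracket x (bracket y z) - bracket (bracket x y) z
      - superSign i j • bracket y (bracket x z) = 0

/-- A two-sided graded ideal of a superalgebra. -/
structure SuperIdeal (L : Type u) [AddCommGroup L] [Module ℂ L] [Superalgebra L]
    extends Submodule ℂ L where
  bracket_left : ∀ (x : L) {y : L}, y ∈ toSubmodule → bracket x y ∈ toSubmodule
  bracket_right : ∀ {x : L} (y : L), x ∈ toSubmodule → bracket x y ∈ toSubmodule
  graded : toSubmodule ≤ (toSubmodule ⊓ part 0) ⊔ (toSubmodule ⊓ part 1)

section Ideals

variable {L : Type u} [AddCommGroup L] [Module ℂ L] [Superalgebra L]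

/-- Homogeneous components of elements of a graded subspace stay in the subspace. -/
theorem mem_of_add_mem {I : Submodule ℂ L} (hI : I ≤ (I ⊓ part 0) ⊔ (I ⊓ part 1)) {a b : L}
    (ha : a ∈ part (L := L) 0) (hb : b ∈ part (L := L) 1) (h : a + b ∈ I) : a ∈ I ∧ b ∈ I := by
  obtain ⟨c, hc, d, hd, hcd⟩ := Submodule.mem_sup.1 (hI h)
  have h1 : a - c ∈ part (L := L) 0 := Submodule.sub_mem _ ha hc.2
  have h2 : a - c ∈ part (L := L) 1 := by
    have : a - c = d - b := by
      rw [sub_eq_sub_iff_add_eq_add, ← hcd, add_comm]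
    rw [this]; exact Submodule.sub_mem _ hd.2 hb
  have h3 : a - c = 0 :=
    Submodule.disjoint_def.1 (Superalgebra.isCompl_part (L := L)).disjoint _ h1 h2
  have hac : a = c := sub_eq_zero.1 h3
  have hbd : b = d := by
    rw [hac] at hcd; exact (add_left_cancel hcd).symm
  exact ⟨hac ▸ hc.1, hbd ▸ hd.1⟩

/-- Every element is the sum of an even and an odd one. -/
theorem exists_add_eq (x : L) :
    ∃ a ∈ part (L := L) 0, ∃ b ∈ part (L := L) 1, a + b = x := by
  have : x ∈ part (L := L) 0 ⊔ part 1 := by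
    rw [(Superalgebra.isCompl_part (L := L)).sup_eq_top]; trivial
  exact Submodule.mem_sup.1 this

/-- The smallest graded ideal containing a set. -/
def SuperIdeal.span (S : Set L) : SuperIdeal L where
  toSubmodule := sInf {N | ∃ I : SuperIdeal L, S ⊆ I.toSubmodule ∧ N = I.toSubmodule}
  bracket_left x y hy := by
    rw [Submodule.mem_sInf] at hy ⊢
    rintro _ ⟨I, hI, rfl⟩
    exact I.bracket_left x (hy _ ⟨I, hI, rfl⟩)
  bracket_right y hx := by
    rw [Submodule.mem_sInf] at hx ⊢
    rintro _ ⟨I, hI, rfl⟩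
    exact I.bracket_right y (hx _ ⟨I, hI, rfl⟩)
  graded x hx := by
    obtain ⟨a, ha, b, hb, rfl⟩ := exists_add_eq x
    rw [Submodule.mem_sInf] at hx
    refine Submodule.add_mem_sup ⟨?_, ha⟩ ⟨?_, hb⟩ <;>
    · refine Submodule.mem_sInf.2 ?_
      rintro _ ⟨I, hI, rfl⟩
      have := mem_of_add_mem I.graded ha hb (hx _ ⟨I, hI, rfl⟩)
      first | exact this.1 | exact this.2

theorem SuperIdeal.subset_span (S : Set L) : S ⊆ (SuperIdeal.span S).toSubmodule := by
  intro x hx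
  refine Submodule.mem_sInf.2 ?_
  rintro _ ⟨I, hI, rfl⟩
  exact hI hx

/-- The sum of a set of graded ideals. -/
def SuperIdeal.sum (S : Set (SuperIdeal L)) : SuperIdeal L where
  toSubmodule := ⨆ I ∈ S, I.toSubmodule
  bracket_left x y hy := by
    have : (⨆ I ∈ S, I.toSubmodule) ≤ (⨆ I ∈ S, I.toSubmodule).comap (bracket x) :=
      iSup₂_le fun I hI z hz =>
        (le_iSup₂_of_le I hI le_rfl : I.toSubmodule ≤ _) (I.bracket_left x hz)
    exact this hy
  bracket_right y hx := by
    have : (⨆ I ∈ S, I.toSubmodule) ≤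
        (⨆ I ∈ S, I.toSubmodule).comap ((bracket (L := L)).flip y) :=
      iSup₂_le fun I hI z hz =>
        (le_iSup₂_of_le I hI le_rfl : I.toSubmodule ≤ _) (I.bracket_right y hz)
    exact this hx
  graded := iSup₂_le fun I hI => I.graded.trans <|
    sup_le_sup (inf_le_inf_right _ (le_iSup₂_of_le I hI le_rfl))
      (inf_le_inf_right _ (le_iSup₂_of_le I hI le_rfl))

/-- The quotient of a superalgebra by a graded ideal, with
`bracket (mk x) (mk y) = mk (bracket x y)`. -/
noncomputable instance SuperIdeal.quotientSuperalgebra (I : SuperIdeal L) :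
    Superalgebra (L ⧸ I.toSubmodule) where
  part i := (part (L := L) i).map I.toSubmodule.mkQ
  isCompl_part := by
    constructor
    · rw [Submodule.disjoint_def]
      rintro _ ⟨a, ha, rfl⟩ ⟨b, hb, hab⟩
      have h : a + (-b) ∈ I.toSubmodule := by
        have := (Submodule.Quotient.eq I.toSubmodule).1 hab.symm
        rwa [← sub_eq_add_neg]
      have := (mem_of_add_mem I.graded ha (Submodule.neg_mem _ hb) h).1
      exact (Submodule.Quotient.mk_eq_zero _).2 this
    · rw [codisjoint_iff, ← Submodule.map_sup,
        (Superalgebra.isCompl_part (L := L)).sup_eq_top, Submodule.map_top, Submodule.range_mkQ]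
  bracket := I.toSubmodule.liftQ
    ((Submodule.mapQLinear I.toSubmodule I.toSubmodule).comp
      ((bracket (L := L)).codRestrict (Submodule.compatibleMaps I.toSubmodule I.toSubmodule)
        fun x _ hy => I.bracket_left x hy))
    (by
      intro x hx
      rw [LinearMap.mem_ker]
      refine LinearMap.ext fun y => ?_
      induction y using Submodule.Quotient.induction_on with
      | _ y => exact (Submodule.Quotient.mk_eq_zero _).2 (I.bracket_right y hx))
  bracket_mem := by
    rintro i j _ _ ⟨x, hx, rfl⟩ ⟨y, hy, rfl⟩
    exact ⟨bracket x y, Superalgebra.bracket_mem hx hy, rfl⟩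

theorem SuperIdeal.bracket_mk (I : SuperIdeal L) (x y : L) :
    bracket (I.toSubmodule.mkQ x) (I.toSubmodule.mkQ y) = I.toSubmodule.mkQ (bracket x y) := rfl

/-- A quotient of a Lie superalgebra by a graded ideal is a Lie superalgebra. -/
instance SuperIdeal.quotientIsLie [IsLieSuperalgebra L] (I : SuperIdeal L) :
    IsLieSuperalgebra (L ⧸ I.toSubmodule) where
  skew := by
    rintro i j _ _ ⟨x, hx, rfl⟩ ⟨y, hy, rfl⟩
    have := congrArg I.toSubmodule.mkQ (IsLieSuperalgebra.skew hx hy)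
    simpa only [map_add, map_smul, map_zero, SuperIdeal.bracket_mk] using this
  jacobi := by
    rintro i j _ _ z ⟨x, hx, rfl⟩ ⟨y, hy, rfl⟩
    obtain ⟨z, rfl⟩ := I.toSubmodule.mkQ_surjective z
    have := congrArg I.toSubmodule.mkQ (IsLieSuperalgebra.jacobi z hx hy)
    simpa only [map_sub, map_smul, map_zero, SuperIdeal.bracket_mk] using this

end Ideals

/-! ### The free superalgebra -/

section Free

/-- The parity of a nonassociative word: the sum of the parities of its letters. -/
def wordParity {G : Type u} (p : G → ZMod 2) : FreeMagma G → ZMod 2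
  | FreeMagma.of x => p x
  | FreeMagma.mul x y => wordParity p x + wordParity p y

/-- The span of the words of parity `i`. -/
noncomputable def wordPart {G : Type u} (p : G → ZMod 2) (i : ZMod 2) :
    Submodule ℂ (FreeNonUnitalNonAssocAlgebra ℂ G) :=
  MonoidAlgebra.supported ℂ ℂ {w : FreeMagma G | wordParity p w = i}

theorem single_mem_wordPart {G : Type u} (p : G → ZMod 2) (w : FreeMagma G) :
    (MonoidAlgebra.single w 1 : FreeNonUnitalNonAssocAlgebra ℂ G) ∈
      wordPart p (wordParity p w) := by
  rw [wordPart, MonoidAlgebra.supported_eq_span_single]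
  exact Submodule.subset_span ⟨w, rfl, rfl⟩

theorem isCompl_wordPart {G : Type u} (p : G → ZMod 2) :
    IsCompl (wordPart p 0) (wordPart p 1) := by
  constructor
  · rw [Submodule.disjoint_def]
    intro x h0 h1
    refine MonoidAlgebra.ext (Finsupp.ext fun w => ?_)
    by_cases hw : wordParity p w = 0
    · exact MonoidAlgebra.mem_supported'.1 h1 w (by simp [hw])
    · exact MonoidAlgebra.mem_supported'.1 h0 w hw
  · rw [codisjoint_iff, eq_top_iff]
    rintro x -
    have hx : x ∈ Submodule.span ℂ ((fun w : FreeMagma G =>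
        (MonoidAlgebra.single w 1 : MonoidAlgebra ℂ _)) '' Set.univ) := by
      rw [← MonoidAlgebra.supported_eq_span_single]
      exact Set.subset_univ _
    refine Submodule.span_le.2 ?_ hx
    rintro _ ⟨w, -, rfl⟩
    have h2 : ∀ i : ZMod 2, i = 0 ∨ i = 1 := by decide
    have hs := single_mem_wordPart p w
    rcases h2 (wordParity p w) with h | h
    · exact Submodule.mem_sup_left (h ▸ hs)
    · exact Submodule.mem_sup_right (h ▸ hs)

theorem mul_mem_wordPart {G : Type u} (p : G → ZMod 2) {i j : ZMod 2}
    {x y : FreeNonUnitalNonAssocAlgebra ℂ G} (hx : x ∈ wordPart p i) (hy : y ∈ wordPart p j) :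
    x * y ∈ wordPart p (i + j) := by
  classical
  intro w hw
  obtain ⟨u, hu, v, hv, rfl⟩ := Finset.mem_mul.1 (MonoidAlgebra.support_coeff_mul_subset x y hw)
  have h1 : wordParity p u = i := hx hu
  have h2 : wordParity p v = j := hy hv
  change wordParity p u + wordParity p v = i + j
  rw [h1, h2]

/-- The free nonassociative superalgebra on a set `G` of generators with parities `p`. -/
def FreeSuperalgebra {G : Type u} (_p : G → ZMod 2) : Type u :=
  FreeNonUnitalNonAssocAlgebra ℂ G

variable {G : Type u} (p : G → ZMod 2)

noncomputable instance : NonUnitalNonAssocRing (FreeSuperalgebra p) :=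
  inferInstanceAs (NonUnitalNonAssocRing (FreeNonUnitalNonAssocAlgebra ℂ G))

noncomputable instance : Module ℂ (FreeSuperalgebra p) :=
  inferInstanceAs (Module ℂ (FreeNonUnitalNonAssocAlgebra ℂ G))

instance : IsScalarTower ℂ (FreeSuperalgebra p) (FreeSuperalgebra p) :=
  inferInstanceAs (IsScalarTower ℂ (FreeNonUnitalNonAssocAlgebra ℂ G) (FreeNonUnitalNonAssocAlgebra ℂ G))

instance : SMulCommClass ℂ (FreeSuperalgebra p) (FreeSuperalgebra p) :=
  inferInstanceAs (SMulCommClass ℂ (FreeNonUnitalNonAssocAlgebra ℂ G) (FreeNonUnitalNonAssocAlgebra ℂ G))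

/-- A generator, as an element of the free superalgebra. -/
noncomputable def FreeSuperalgebra.of (x : G) : FreeSuperalgebra p :=
  FreeNonUnitalNonAssocAlgebra.of ℂ x

noncomputable instance : Superalgebra (FreeSuperalgebra p) where
  part i := wordPart p i
  isCompl_part := isCompl_wordPart p
  bracket := LinearMap.mul ℂ (FreeSuperalgebra p)
  bracket_mem hx hy := mul_mem_wordPart p hx hy

end Free

/-! ### Contragredient Lie superalgebras -/

section Contragredient

variable {ι : Type} [Fintype ι] [DecidableEq ι] {𝔥 : Type u} [AddCommGroup 𝔥] [Module ℂ 𝔥]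

/-- A realization of a square matrix `A`: a vector space `𝔥` of dimension `2n - rank A` with
linearly independent elements `h_i ∈ 𝔥` and `α_j ∈ 𝔥*` such that `α_j(h_i) = a_{ij}`. -/
structure Realization (A : Matrix ι ι ℂ) (𝔥 : Type u) [AddCommGroup 𝔥] [Module ℂ 𝔥] where
  root : ι → Module.Dual ℂ 𝔥
  coroot : ι → 𝔥
  finiteDimensional : FiniteDimensional ℂ 𝔥
  finrank_add_rank : Module.finrank ℂ 𝔥 + A.rank = 2 * Fintype.card ι
  linearIndependent_root : LinearIndependent ℂ root
  linearIndependent_coroot : LinearIndependent ℂ coroot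
  root_coroot : ∀ i j, root j (coroot i) = A i j

/-- The generators `X_i`, `Y_i` and `h ∈ 𝔥`. -/
inductive Gen (ι : Type) (𝔥 : Type u) : Type u
  | X (i : ι) : Gen ι 𝔥
  | Y (i : ι) : Gen ι 𝔥
  | H (h : 𝔥) : Gen ι 𝔥

/-- `X_i` and `Y_i` have the prescribed parity `p i`, and `𝔥` is even. -/
def genParity (p : ι → ZMod 2) : Gen ι 𝔥 → ZMod 2
  | Gen.X i => p i
  | Gen.Y i => p i
  | Gen.H _ => 0

variable {A : Matrix ι ι ℂ}

open FreeSuperalgebra in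
/-- The elements of the free superalgebra which are set to zero: those that make the quotient a
Lie superalgebra, those that make `𝔥` an abelian subalgebra on which the linear structure is the
given one, and the relations
`[h, X_i] = α_i(h) X_i`, `[h, Y_i] = -α_i(h) Y_i`, `[X_i, Y_j] = δ_{ij} h_i`. -/
inductive Rel (R : Realization A 𝔥) (p : ι → ZMod 2) :
    FreeSuperalgebra (genParity (𝔥 := 𝔥) p) → Prop
  | skew (i j : ZMod 2) (x y : FreeSuperalgebra (genParity (𝔥 := 𝔥) p))
      (hx : x ∈ part i) (hy : y ∈ part j) :
      Rel R p (bracket x y + superSign i j • bracket y x)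
  | jacobi (i j : ZMod 2) (x y z : FreeSuperalgebra (genParity (𝔥 := 𝔥) p))
      (hx : x ∈ part i) (hy : y ∈ part j) :
      Rel R p (bracket x (bracket y z) - bracket (bracket x y) z
        - superSign i j • bracket y (bracket x z))
  | linear (c : ℂ) (h h' : 𝔥) :
      Rel R p (of _ (Gen.H (c • h + h')) - c • of _ (Gen.H h) - of _ (Gen.H h'))
  | HH (h h' : 𝔥) : Rel R p (bracket (of _ (Gen.H h)) (of _ (Gen.H h')))
  | HX (h : 𝔥) (i : ι) :
      Rel R p (bracket (of _ (Gen.H h)) (of _ (Gen.X i)) - R.root i h • of _ (Gen.X i))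
  | HY (h : 𝔥) (i : ι) :
      Rel R p (bracket (of _ (Gen.H h)) (of _ (Gen.Y i)) + R.root i h • of _ (Gen.Y i))
  | XY_same (i : ι) :
      Rel R p (bracket (of _ (Gen.X i)) (of _ (Gen.Y i)) - of _ (Gen.H (R.coroot i)))
  | XY_ne (i j : ι) (hij : i ≠ j) :
      Rel R p (bracket (of _ (Gen.X i)) (of _ (Gen.Y j)))

/-- The Lie superalgebra with generators `X_i`, `Y_i`, `𝔥` and the relations above. -/
abbrev PreContragredient (R : Realization A 𝔥) (p : ι → ZMod 2) : Type u :=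
  FreeSuperalgebra (genParity (𝔥 := 𝔥) p) ⧸ (SuperIdeal.span {x | Rel R p x}).toSubmodule

instance (R : Realization A 𝔥) (p : ι → ZMod 2) : IsLieSuperalgebra (PreContragredient R p) where
  skew := by
    rintro i j _ _ ⟨x, hx, rfl⟩ ⟨y, hy, rfl⟩
    exact (Submodule.Quotient.mk_eq_zero _).2
      (SuperIdeal.subset_span _ (Rel.skew i j x y hx hy))
  jacobi := by
    rintro i j _ _ z ⟨x, hx, rfl⟩ ⟨y, hy, rfl⟩
    obtain ⟨z, rfl⟩ := Submodule.mkQ_surjective _ z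
    exact (Submodule.Quotient.mk_eq_zero _).2
      (SuperIdeal.subset_span _ (Rel.jacobi i j x y z hx hy))

/-- The image of a generator in `PreContragredient R p`. -/
noncomputable def preGen (R : Realization A 𝔥) (p : ι → ZMod 2) (g : Gen ι 𝔥) :
    PreContragredient R p :=
  Submodule.mkQ _ (FreeSuperalgebra.of _ g)

/-- The largest graded ideal intersecting `𝔥` trivially: the sum of all such ideals. -/
noncomputable def maxIdeal (R : Realization A 𝔥) (p : ι → ZMod 2) : SuperIdeal (PreContragredient R p) :=
  SuperIdeal.sum {I | ∀ h : 𝔥, preGen R p (Gen.H h) ∈ I.toSubmodule → preGen R p (Gen.H h) = 0}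

/-- The contragredient Lie superalgebra `𝔤(A)` with parity function `p`. -/
abbrev Contragredient (R : Realization A 𝔥) (p : ι → ZMod 2) : Type u :=
  PreContragredient R p ⧸ (maxIdeal R p).toSubmodule

/-- The image of a generator in `𝔤(A)`. -/
noncomputable def gen (R : Realization A 𝔥) (p : ι → ZMod 2) (g : Gen ι 𝔥) :
    Contragredient R p :=
  (maxIdeal R p).toSubmodule.mkQ (preGen R p g)

/-- The space `𝔤(A)_α` of vectors of weight `α`. -/
def rootSpace (R : Realization A 𝔥) (p : ι → ZMod 2) (α : Module.Dual ℂ 𝔥) :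
    Set (Contragredient R p) :=
  {x | ∀ h : 𝔥, bracket (gen R p (Gen.H h)) x = α h • x}

/-- A root is a non-zero weight of the adjoint representation. -/
def IsRoot (R : Realization A 𝔥) (p : ι → ZMod 2) (α : Module.Dual ℂ 𝔥) : Prop :=
  α ≠ 0 ∧ ∃ x ∈ rootSpace R p α, x ≠ 0

/-! ### Bases, reflections, real roots -/

/-- A base: simple roots `α_i`, the elements `h_i = [X_i, Y_i]` (each of them matters only up to a
non-zero scalar) and the parities of the `α_i`. -/
structure Base (ι : Type) (𝔥 : Type u) [AddCommGroup 𝔥] [Module ℂ 𝔥] where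
  root : ι → Module.Dual ℂ 𝔥
  coroot : ι → 𝔥
  parity : ι → ZMod 2

namespace Base

/-- The Cartan matrix `a_{ij} = α_j(h_i)` of a base. -/
def cartan (B : Base ι 𝔥) (i j : ι) : ℂ := B.root j (B.coroot i)

/-- A simple root is isotropic if it is odd and `a_{ii} = 0`. -/
def IsIsotropic (B : Base ι 𝔥) (i : ι) : Prop := B.cartan i i = 0 ∧ B.parity i = 1

/-- A simple root `α_i` is regular if `a_{ij} = 0` implies `a_{ji} = 0` for all `j`. -/
def IsRegular (B : Base ι 𝔥) (i : ι) : Prop := ∀ j, j ≠ i → B.cartan i j = 0 → B.cartan j i = 0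

/-- The even reflection at `α_k`, where `a_{kk} ≠ 0`; the factor `2 / a_{kk}` is `1` when `h_k` is
scaled so that `a_{kk} = 2`. -/
noncomputable def evenReflection (B : Base ι 𝔥) (k : ι) : Base ι 𝔥 where
  root i := B.root i - (2 / B.cartan k k * B.cartan k i) • B.root k
  coroot i := B.coroot i - (2 / B.cartan k k * B.cartan i k) • B.coroot k
  parity := B.parity

open Classical in
/-- The odd reflection at a regular isotropic simple root `α_k`. -/
noncomputable def oddReflection (B : Base ι 𝔥) (k : ι) : Base ι 𝔥 where
  root i :=
    if i = k then -B.root k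
    else if B.cartan i k = 0 ∧ B.cartan k i = 0 then B.root i
    else B.root i + B.root k
  coroot i :=
    if i = k then B.coroot k
    else if B.cartan i k = 0 ∧ B.cartan k i = 0 then B.coroot i
    else (if B.parity i = 1 then (-1 : ℂ) else 1) •
      (B.cartan i k • B.coroot k + B.cartan k i • B.coroot i)
  parity i :=
    if i = k then B.parity k
    else if B.cartan i k = 0 ∧ B.cartan k i = 0 then B.parity i
    else B.parity i + B.parity k

end Base

/-- The standard base of `𝔤(A)`. -/
def Realization.base (R : Realization A 𝔥) (p : ι → ZMod 2) : Base ι 𝔥 where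
  root := R.root
  coroot := R.coroot
  parity := p

/-- The bases obtained from a given one by sequences of even and odd reflections. -/
inductive Reachable (B₀ : Base ι 𝔥) : Base ι 𝔥 → Prop
  | refl : Reachable B₀ B₀
  | even {B : Base ι 𝔥} (k : ι) (hB : Reachable B₀ B) (hk : B.cartan k k ≠ 0) :
      Reachable B₀ (B.evenReflection k)
  | odd {B : Base ι 𝔥} (k : ι) (hB : Reachable B₀ B) (hk : B.IsIsotropic k)
      (hreg : B.IsRegular k) : Reachable B₀ (B.oddReflection k)

/-- A root `α` is real if `α` or `α / 2` is simple in some base obtained by reflections. -/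
def IsRealRoot (R : Realization A 𝔥) (p : ι → ZMod 2) (α : Module.Dual ℂ 𝔥) : Prop :=
  IsRoot R p α ∧
    ∃ B, Reachable (R.base p) B ∧ ∃ i, α = B.root i ∨ α = (2 : ℂ) • B.root i

/-- A Weyl vector: `ρ(h_i) = a_{ii} / 2` for all `i`. -/
def IsWeylVector (R : Realization A 𝔥) (ρ : Module.Dual ℂ 𝔥) : Prop :=
  ∀ i, ρ (R.coroot i) = A i i / 2

/-- A weight `lam` is typical if `(lam + ρ)(h_α) ≠ 0` for every real isotropic root `α`; such an `α`
is an isotropic simple root `α_i` of some base obtained by reflections, and then `h_α = h_i`. -/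
def IsTypical (R : Realization A 𝔥) (p : ι → ZMod 2) (lam : Module.Dual ℂ 𝔥) : Prop :=
  ∀ ρ, IsWeylVector R ρ → ∀ B, Reachable (R.base p) B → ∀ i, B.IsIsotropic i →
    (lam + ρ) (B.coroot i) ≠ 0

end Contragredient

/-! ### Modules -/

/-- A module over a Lie superalgebra `L`: a superspace `V = V₀ ⊕ V₁` with a bilinear action of `L`
that is compatible with the parities and satisfies `[x, y] v = x (y v) - (-1)^(|x||y|) y (x v)`. -/
structure SuperModule (L : Type u) [AddCommGroup L] [Module ℂ L] [Superalgebra L]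
    (V : Type v) [AddCommGroup V] [Module ℂ V] where
  vpart : ZMod 2 → Submodule ℂ V
  isCompl_vpart : IsCompl (vpart 0) (vpart 1)
  act : L →ₗ[ℂ] V →ₗ[ℂ] V
  act_mem : ∀ {i j : ZMod 2} {x : L} {m : V}, x ∈ part i → m ∈ vpart j → act x m ∈ vpart (i + j)
  act_bracket : ∀ {i j : ZMod 2} {x y : L} (m : V), x ∈ part i → y ∈ part j →
    act (bracket x y) m = act x (act y m) - superSign i j • act y (act x m)

namespace SuperModule

section General

variable {L : Type u} [AddCommGroup L] [Module ℂ L] [Superalgebra L]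
  {V : Type v} [AddCommGroup V] [Module ℂ V] {W : Type w} [AddCommGroup W] [Module ℂ W]

/-- A graded subspace stable under the action. -/
def IsSubmodule (M : SuperModule L V) (N : Submodule ℂ V) : Prop :=
  (∀ x : L, ∀ m ∈ N, M.act x m ∈ N) ∧ N ≤ (N ⊓ M.vpart 0) ⊔ (N ⊓ M.vpart 1)

/-- A module is irreducible if it is non-zero and has no proper non-zero submodules. -/
def IsIrreducible (M : SuperModule L V) : Prop :=
  Nontrivial V ∧ ∀ N, M.IsSubmodule N → N = ⊥ ∨ N = ⊤

/-- A module is trivial if the Lie superalgebra acts by zero. -/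
def IsTrivial (M : SuperModule L V) : Prop := ∀ x m, M.act x m = 0

/-- Isomorphism of modules up to a change of parity: a linear bijection which commutes with the
action and either preserves or reverses all parities. -/
def IsIsomorphic (M : SuperModule L V) (M' : SuperModule L W) : Prop :=
  ∃ e : V ≃ₗ[ℂ] W, (∀ x m, e (M.act x m) = M'.act x (e m)) ∧
    ∃ d : ZMod 2, ∀ i, ∀ m ∈ M.vpart i, e m ∈ M'.vpart (i + d)

end General

section Weights

variable {ι : Type} [Fintype ι] [DecidableEq ι] {𝔥 : Type u} [AddCommGroup 𝔥] [Module ℂ 𝔥]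
  {A : Matrix ι ι ℂ} {R : Realization A 𝔥} {p : ι → ZMod 2}
  {V : Type v} [AddCommGroup V] [Module ℂ V]

/-- A highest weight module over `𝔤(A)` with highest weight `lam`: it is generated by a non-zero
homogeneous vector `m` with `X_i m = 0` for all `i` and `h m = lam(h) m` for all `h ∈ 𝔥`. -/
def IsHighestWeight (M : SuperModule (Contragredient R p) V) (lam : Module.Dual ℂ 𝔥) : Prop :=
  ∃ m : V, m ≠ 0 ∧ (∃ i, m ∈ M.vpart i) ∧
    (∀ i, M.act (gen R p (Gen.X i)) m = 0) ∧
    (∀ h, M.act (gen R p (Gen.H h)) m = lam h • m) ∧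
    ∀ N, M.IsSubmodule N → m ∈ N → N = ⊤

/-- A module is integrable if every root vector of every real root acts locally nilpotently. -/
def IsIntegrable (M : SuperModule (Contragredient R p) V) : Prop :=
  ∀ α, IsRealRoot R p α → ∀ x ∈ rootSpace R p α, ∀ m : V, ∃ k : ℕ, ((M.act x) ^ k) m = 0

end Weights

end SuperModule

/-! ### The algebras `Q^±(m,n,t)` -/

/-- The Cartan matrix of `Q^±(m,n,t)`. -/
noncomputable def cartanQ (a b c : ℂ) : Matrix (Fin 3) (Fin 3) ℂ :=
  !![0, 1, a;
     b, 0, 1;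
     1, c, 0]

/-- All simple roots of `Q^±(m,n,t)` are odd. -/
def parityQ : Fin 3 → ZMod 2 := fun _ => 1

/-- The non-zero numbers `a, b, c` are parameters of `Q^+(m,n,t)` or of `Q^-(m,n,t)`, where
`m, n, t` are negative integers which are not all equal to `-1`. -/
structure IsQParameters (m n t : ℤ) (a b c : ℂ) : Prop where
  m_le : m ≤ -1
  n_le : n ≤ -1
  t_le : t ≤ -1
  not_all : ¬(m = -1 ∧ n = -1 ∧ t = -1)
  a_ne : a ≠ 0
  b_ne : b ≠ 0
  c_ne : c ≠ 0
  eq_m : 1 + a + 1 / b = m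
  eq_n : 1 + b + 1 / c = n
  eq_t : 1 + c + 1 / a = t

end SuperKM

open SuperKM

set_option linter.unusedSectionVars false

namespace SuperKM

open SuperKM.Superalgebra (part bracket)

/-! ### Signs -/

/-! The simple roots are odd and isotropic and no two are orthogonal, so for `i ≠ j` the elements
`[X_i, X_j]` and a multiple of `[Y_i, Y_j]` span, with h_ij = h_i / a_ij + h_j / a_ji
(`pairCoroot`), an even `sl₂`. Here α_i and α_j take the value 1 on h_ij, and the third simple root
takes one of the values m - 1, n - 1, t - 1, all at most -2. Inverting a 3 × 3 matrix turns the
displayed family of weights into the condition that λ(h_ij) is a positive integer for each pair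
(`isPositive_iff`).

Necessity. Let v be a highest weight vector. If λ(h_i) ≠ 0, then `Y_i v` is non-zero, is killed by
`[X_i, X_j]` and has h_ij-weight λ(h_ij) - 1; local nilpotency of the negative root vector makes
this a natural number (`exists_nat_of_locallyNilpotent`). If two of the λ(h_i) vanish and the third
does not, the ratio of two Cartan entries would be rational. That is impossible: a, b, c are roots
of integral quadratics whose discriminant k² - 4, with k ≥ 3, is not a square
(`eq_zero_of_add_mul_eq_zero`).

Sufficiency. An integral weight vanishing on h_i is an integral multiple of α_i (`eq_smul_root`), so
positivity forces every λ(h_i) ≠ 0. The vector f^(x+1) `Y_i v`, where f is the negative root vector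
and λ(h_ij) = x + 1, turns out to be singular of degree below the top, hence zero
(`pow_pairY_eq_zero`). The same lemma in the adjoint representation gives local nilpotency of ad f.
The operators exp(e) exp(-f) exp(e) then exist and realize the Weyl group of the three even
reflections on modules. Every base obtained by reflections is, up to scaling coroots, a Weyl
translate of the standard one or of one odd reflection of it (`exists_isTwist_of_reachable`), so
each simple root of such a base is a translate of α_j or α_j + α_k, and these have positive degree,
where nilpotency is automatic.

Typicality. If λ(σ h_i) = 0 for σ in the Weyl group, then λ ∘ σ is a weight equal to xα_i. Three
reflections carry α_i to -α_i, so -λ would also be a weight of the module, which positivity excludes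
(`apply_weylGroup_coroot_ne_zero`).

Existence and uniqueness come from the Verma module and its largest proper submodule
(`irreducibleModule`, `isIsomorphic_irreducibleModule`). -/

theorem parity_cases : ∀ i : ZMod 2, i = 0 ∨ i = 1 := by decide

theorem superSign_zero_left (j : ZMod 2) : superSign 0 j = 1 := by simp [superSign]

theorem superSign_one_one : superSign 1 1 = -1 := by simp [superSign]

theorem superSign_mul_self (i j : ZMod 2) : superSign i j * superSign i j = 1 := by
  unfold superSign; split_ifs <;> norm_num

theorem superSign_comm (i j : ZMod 2) : superSign i j = superSign j i := by
  simp only [superSign, and_comm]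

/-! ### Eigenvectors and stable subspaces -/

section Eigen

variable {V : Type v} [AddCommGroup V] [Module ℂ V]

/-- In the quotient by the stable subspace the class of `a` is minus that of `e`, and eigenspaces
for different eigenvalues are independent there. Passing to the quotient avoids writing projections
as polynomials in `D`. -/
theorem mem_of_add_mem_of_eigenspace (D : Module.End ℂ V) (N : Submodule ℂ V)
    (hN : ∀ v ∈ N, D v ∈ N) {μ : ℂ} {a e : V} (ha : D a = μ • a)
    (he : e ∈ ⨆ ν, ⨆ (_ : ν ≠ μ), D.eigenspace ν) (h : a + e ∈ N) : a ∈ N := by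
  let D' : Module.End ℂ (V ⧸ N) := N.mapQ N D hN
  have h1 : N.mkQ a ∈ D'.eigenspace μ := by
    rw [Module.End.mem_eigenspace_iff, ← map_smul, ← ha]; rfl
  have h2 : N.mkQ e ∈ ⨆ ν, ⨆ (_ : ν ≠ μ), D'.eigenspace ν := by
    have : (⨆ ν, ⨆ (_ : ν ≠ μ), D.eigenspace ν) ≤
        (⨆ ν, ⨆ (_ : ν ≠ μ), D'.eigenspace ν).comap N.mkQ := by
      refine iSup₂_le fun ν hν v hv => ?_
      refine Submodule.mem_iSup_of_mem ν (Submodule.mem_iSup_of_mem hν ?_)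
      rw [Module.End.mem_eigenspace_iff] at hv ⊢
      rw [← map_smul, ← hv]; rfl
    exact this he
  have h3 : N.mkQ a = -N.mkQ e := by
    rw [eq_neg_iff_add_eq_zero, ← map_add]
    exact (Submodule.Quotient.mk_eq_zero _).2 h
  have h4 := Submodule.disjoint_def.1 (D'.eigenspaces_iSupIndep μ) _ h1
    (h3 ▸ Submodule.neg_mem _ h2)
  exact (Submodule.Quotient.mk_eq_zero _).1 h4

theorem eq_zero_of_mem_iSup_eigenspace (D : Module.End ℂ V) {μ : ℂ} {a : V} (ha : D a = μ • a)
    (h : a ∈ ⨆ ν, ⨆ (_ : ν ≠ μ), D.eigenspace ν) : a = 0 :=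
  Submodule.disjoint_def.1 (D.eigenspaces_iSupIndep μ) _ (Module.End.mem_eigenspace_iff.2 ha) h

theorem eigenvalue_mem_of_mem_iSup (D : Module.End ℂ V) (S : Set ℂ) {μ : ℂ} {a : V} (h0 : a ≠ 0)
    (ha : D a = μ • a) (h : a ∈ ⨆ ν ∈ S, D.eigenspace ν) : μ ∈ S := by
  by_contra hμ
  refine h0 (eq_zero_of_mem_iSup_eigenspace D ha ?_)
  refine (iSup₂_le fun ν hν => ?_ : (⨆ ν ∈ S, D.eigenspace ν) ≤ _) h
  exact le_iSup₂_of_le ν (fun e => hμ (e ▸ hν)) le_rfl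

end Eigen

/-! ### Lie superalgebras -/

section Lie

variable {L : Type u} [AddCommGroup L] [Module ℂ L] [Superalgebra L]

theorem homogeneous_induction {P : L → Prop} (hadd : ∀ x y, P x → P y → P (x + y))
    (hhom : ∀ i, ∀ x ∈ part (L := L) i, P x) (x : L) : P x := by
  obtain ⟨a, ha, b, hb, rfl⟩ := exists_add_eq x
  exact hadd _ _ (hhom 0 a ha) (hhom 1 b hb)

namespace SuperModule

variable {V : Type v} [AddCommGroup V] [Module ℂ V] {W : Type w} [AddCommGroup W] [Module ℂ W]

theorem exists_add_eq (M : SuperModule L V) (m : V) :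
    ∃ a ∈ M.vpart 0, ∃ b ∈ M.vpart 1, a + b = m := by
  have : m ∈ M.vpart 0 ⊔ M.vpart 1 := by
    rw [M.isCompl_vpart.sup_eq_top]; trivial
  exact Submodule.mem_sup.1 this

theorem eq_zero_of_mem_of_mem (M : SuperModule L V) {i j : ZMod 2} (hij : i ≠ j) {m : V}
    (h0 : m ∈ M.vpart i) (h1 : m ∈ M.vpart j) : m = 0 := by
  have := Submodule.disjoint_def.1 M.isCompl_vpart.disjoint m
  rcases parity_cases i with rfl | rfl <;> rcases parity_cases j with rfl | rfl <;> simp_all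

theorem mem_of_add_mem {M : SuperModule L V} {N : Submodule ℂ V}
    (hN : N ≤ (N ⊓ M.vpart 0) ⊔ (N ⊓ M.vpart 1)) {a b : V}
    (ha : a ∈ M.vpart 0) (hb : b ∈ M.vpart 1) (h : a + b ∈ N) : a ∈ N ∧ b ∈ N := by
  obtain ⟨c, hc, d, hd, hcd⟩ := Submodule.mem_sup.1 (hN h)
  have e : a - c = d - b := by rw [sub_eq_sub_iff_add_eq_add, ← hcd, add_comm]
  have h3 : a - c = 0 := M.eq_zero_of_mem_of_mem zero_ne_one (Submodule.sub_mem _ ha hc.2)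
    (e ▸ Submodule.sub_mem _ hd.2 hb)
  exact ⟨sub_eq_zero.1 h3 ▸ hc.1, sub_eq_zero.1 (e ▸ h3) ▸ hd.1⟩

theorem act_even (M : SuperModule L V) {x : L} (hx : x ∈ part (L := L) 0) (y : L) (m : V) :
    M.act x (M.act y m) = M.act (bracket x y) m + M.act y (M.act x m) := by
  refine homogeneous_induction (P := fun y => M.act x (M.act y m) =
    M.act (bracket x y) m + M.act y (M.act x m)) (fun a b ha hb => ?_) (fun j y hy => ?_) y
  · simp only [map_add, LinearMap.add_apply, ha, hb]; abel
  · rw [M.act_bracket m hx hy, superSign_zero_left, one_smul]; abel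

theorem act_odd (M : SuperModule L V) {x y : L} (hx : x ∈ part (L := L) 1)
    (hy : y ∈ part (L := L) 1) (m : V) :
    M.act x (M.act y m) = M.act (bracket x y) m - M.act y (M.act x m) := by
  rw [M.act_bracket m hx hy, superSign_one_one, neg_one_smul]; abel

/-- A homogeneous spanning set gives a graded span. -/
theorem span_le_graded (M : SuperModule L V) (S : Set V) (hS : ∀ m ∈ S, ∃ i, m ∈ M.vpart i) :
    Submodule.span ℂ S ≤ (Submodule.span ℂ S ⊓ M.vpart 0) ⊔ (Submodule.span ℂ S ⊓ M.vpart 1) := by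
  refine Submodule.span_le.2 fun m hm => ?_
  obtain ⟨i, hi⟩ := hS m hm
  rcases parity_cases i with rfl | rfl
  · exact Submodule.mem_sup_left ⟨Submodule.subset_span hm, hi⟩
  · exact Submodule.mem_sup_right ⟨Submodule.subset_span hm, hi⟩

/-- The adjoint module. -/
def adjoint (L : Type u) [AddCommGroup L] [Module ℂ L] [Superalgebra L] [IsLieSuperalgebra L] :
    SuperModule L L where
  vpart := part
  isCompl_vpart := Superalgebra.isCompl_part
  act := bracket
  act_mem := Superalgebra.bracket_mem
  act_bracket := by
    intro i j x y m hx hy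
    have := IsLieSuperalgebra.jacobi m hx hy
    rw [sub_sub, sub_eq_zero] at this
    rw [this, add_sub_cancel_right]

/-- The pull-back of a module along the quotient map by an ideal. -/
def inflate (I : SuperIdeal L) (M : SuperModule (L ⧸ I.toSubmodule) V) : SuperModule L V where
  vpart := M.vpart
  isCompl_vpart := M.isCompl_vpart
  act := M.act.comp I.toSubmodule.mkQ
  act_mem hx hm := M.act_mem (Submodule.mem_map_of_mem hx) hm
  act_bracket m hx hy :=
    M.act_bracket m (Submodule.mem_map_of_mem hx) (Submodule.mem_map_of_mem hy)

/-- A module killed by an ideal is a module over the quotient. -/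
def ofIdeal (I : SuperIdeal L) (M : SuperModule L V) (h : ∀ x ∈ I.toSubmodule, M.act x = 0) :
    SuperModule (L ⧸ I.toSubmodule) V where
  vpart := M.vpart
  isCompl_vpart := M.isCompl_vpart
  act := I.toSubmodule.liftQ M.act h
  act_mem := by
    rintro i j _ m ⟨x, hx, rfl⟩ hm
    exact M.act_mem hx hm
  act_bracket := by
    rintro i j _ _ m ⟨x, hx, rfl⟩ ⟨y, hy, rfl⟩
    exact M.act_bracket m hx hy

theorem isCompl_map_mkQ (M : SuperModule L V) (N : Submodule ℂ V) (hN : M.IsSubmodule N) :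
    IsCompl ((M.vpart 0).map N.mkQ) ((M.vpart 1).map N.mkQ) := by
  constructor
  · rw [Submodule.disjoint_def]
    rintro _ ⟨a, ha, rfl⟩ ⟨b, hb, hab⟩
    have h : a + (-b) ∈ N := by
      have := (Submodule.Quotient.eq N).1 hab.symm
      rwa [← sub_eq_add_neg]
    exact (Submodule.Quotient.mk_eq_zero _).2
      (mem_of_add_mem hN.2 ha (Submodule.neg_mem _ hb) h).1
  · rw [codisjoint_iff, ← Submodule.map_sup, M.isCompl_vpart.sup_eq_top, Submodule.map_top,
      Submodule.range_mkQ]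

/-- The quotient of a module by a graded submodule. -/
noncomputable def quotient (M : SuperModule L V) (N : Submodule ℂ V) (hN : M.IsSubmodule N) :
    SuperModule L (V ⧸ N) where
  vpart i := (M.vpart i).map N.mkQ
  isCompl_vpart := M.isCompl_map_mkQ N hN
  act := (Submodule.mapQLinear N N).comp
    (M.act.codRestrict (Submodule.compatibleMaps N N) fun x m hm => hN.1 x m hm)
  act_mem := by
    rintro i j x _ hx ⟨m, hm, rfl⟩
    exact ⟨M.act x m, M.act_mem hx hm, rfl⟩
  act_bracket := by
    intro i j x y m hx hy
    obtain ⟨m, rfl⟩ := N.mkQ_surjective m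
    have := congrArg N.mkQ (M.act_bracket m hx hy)
    rw [map_sub, map_smul] at this
    exact this

theorem isSubmodule_iSup (M : SuperModule L V) (S : Set (Submodule ℂ V))
    (hS : ∀ N ∈ S, M.IsSubmodule N) : M.IsSubmodule (⨆ N ∈ S, N) := by
  refine ⟨fun x => ?_, iSup₂_le fun N hN => (hS N hN).2.trans
    (sup_le_sup (inf_le_inf_right _ (le_iSup₂_of_le N hN le_rfl))
      (inf_le_inf_right _ (le_iSup₂_of_le N hN le_rfl)))⟩
  have : (⨆ N ∈ S, N) ≤ (⨆ N ∈ S, N).comap (M.act x) :=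
    iSup₂_le fun N hN m hm => (le_iSup₂_of_le N hN le_rfl : N ≤ _) ((hS N hN).1 x m hm)
  exact this

end SuperModule

variable [IsLieSuperalgebra L]

theorem bracket_skew_even {x : L} (hx : x ∈ part (L := L) 0) (y : L) :
    bracket x y = -bracket y x := by
  refine homogeneous_induction (P := fun y => bracket x y = -bracket y x)
    (fun a b ha hb => ?_) (fun j y hy => ?_) y
  · rw [map_add, ha, hb, map_add, LinearMap.add_apply]; abel
  · have := IsLieSuperalgebra.skew hx hy
    rwa [superSign_zero_left, one_smul, ← eq_neg_iff_add_eq_zero] at this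

theorem bracket_comm_odd {x y : L} (hx : x ∈ part (L := L) 1) (hy : y ∈ part (L := L) 1) :
    bracket x y = bracket y x := by
  have := IsLieSuperalgebra.skew hx hy
  rwa [superSign_one_one, neg_one_smul, ← sub_eq_add_neg, sub_eq_zero] at this

theorem bracket_self_even {x : L} (hx : x ∈ part (L := L) 0) : bracket x x = 0 := by
  have := bracket_skew_even hx x
  rwa [eq_neg_iff_add_eq_zero, ← two_smul ℂ, smul_eq_zero_iff_right two_ne_zero] at this

theorem bracket_even_left {x : L} (hx : x ∈ part (L := L) 0) (y z : L) :
    bracket x (bracket y z) = bracket (bracket x y) z + bracket y (bracket x z) :=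
  (SuperModule.adjoint L).act_even hx y z

theorem bracket_odd_odd {x y : L} (hx : x ∈ part (L := L) 1) (hy : y ∈ part (L := L) 1) (z : L) :
    bracket x (bracket y z) = bracket (bracket x y) z - bracket y (bracket x z) :=
  (SuperModule.adjoint L).act_odd hx hy z

/-- A submodule of the adjoint module is an ideal. -/
def SuperIdeal.ofSubmodule (N : Submodule ℂ L) (hN : (SuperModule.adjoint L).IsSubmodule N) :
    SuperIdeal L where
  toSubmodule := N
  bracket_left x y hy := hN.1 x y hy
  bracket_right := by
    intro x y hx
    obtain ⟨a, ha, b, hb, rfl⟩ := exists_add_eq x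
    obtain ⟨ha', hb'⟩ := mem_of_add_mem hN.2 ha hb hx
    refine homogeneous_induction (P := fun y => bracket (a + b) y ∈ N)
      (fun y z hy hz => by rw [map_add]; exact N.add_mem hy hz) (fun j y hy => ?_) y
    have key : ∀ i, ∀ c ∈ part (L := L) i, c ∈ N → bracket c y ∈ N := fun i c hc hcN => by
      have := IsLieSuperalgebra.skew hc hy
      rw [eq_neg_of_add_eq_zero_left this]
      exact N.neg_mem (N.smul_mem _ (hN.1 y c hcN))
    rw [map_add, LinearMap.add_apply]
    exact N.add_mem (key 0 a ha ha') (key 1 b hb hb')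
  graded := hN.2

end Lie

/-! ### Representations of the free superalgebra -/

section FreeRep

variable {G : Type u} (p : G → ZMod 2) {V : Type v} [AddCommGroup V] [Module ℂ V]

/-- The operator of a word: letters act by given operators, products by supercommutators. -/
noncomputable def wordOp (op : G → Module.End ℂ V) : FreeMagma G → Module.End ℂ V
  | FreeMagma.of x => op x
  | FreeMagma.mul x y => wordOp op x * wordOp op y -
      superSign (wordParity p x) (wordParity p y) • (wordOp op y * wordOp op x)

/-- The linear extension of `wordOp`. -/
noncomputable def freeOp (op : G → Module.End ℂ V) : FreeSuperalgebra p →ₗ[ℂ] Module.End ℂ V :=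
  (Finsupp.linearCombination ℂ (wordOp p op)).comp
    (MonoidAlgebra.coeffLinearEquiv (S := ℂ) (M := FreeMagma G) ℂ).toLinearMap

/-- A word as an element of the free superalgebra. -/
noncomputable def freeWord (w : FreeMagma G) : FreeSuperalgebra p :=
  (MonoidAlgebra.single w 1 : FreeNonUnitalNonAssocAlgebra ℂ G)

theorem freeOp_word (op : G → Module.End ℂ V) (w : FreeMagma G) :
    freeOp p op (freeWord p w) = wordOp p op w := by
  have : freeOp p op (freeWord p w) =
    Finsupp.linearCombination ℂ (wordOp p op) (Finsupp.single w 1) := rfl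
  rw [this, Finsupp.linearCombination_single, one_smul]

theorem freeOp_of (op : G → Module.End ℂ V) (x : G) :
    freeOp p op (FreeSuperalgebra.of p x) = op x := freeOp_word p op (FreeMagma.of x)

theorem bracket_freeWord (w w' : FreeMagma G) :
    bracket (freeWord p w) (freeWord p w') = freeWord p (w * w') := by
  have : bracket (freeWord p w) (freeWord p w') =
    (MonoidAlgebra.single w 1 * MonoidAlgebra.single w' 1 :
      FreeNonUnitalNonAssocAlgebra ℂ G) := rfl
  rw [this, MonoidAlgebra.single_mul_single, one_mul]; rfl

theorem part_eq_span (i : ZMod 2) : part (L := FreeSuperalgebra p) i =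
    Submodule.span ℂ (freeWord p '' {w | wordParity p w = i}) :=
  MonoidAlgebra.supported_eq_span_single ..

theorem freeWord_mem (w : FreeMagma G) :
    freeWord p w ∈ part (L := FreeSuperalgebra p) (wordParity p w) := single_mem_wordPart p w

/-- On words this is the definition of `wordOp`; both sides are bilinear and the homogeneous parts
are spanned by words. -/
theorem freeOp_bracket (op : G → Module.End ℂ V) {i j : ZMod 2} {x y : FreeSuperalgebra p}
    (hx : x ∈ part i) (hy : y ∈ part j) :
    freeOp p op (bracket x y) =
      freeOp p op x * freeOp p op y - superSign i j • (freeOp p op y * freeOp p op x) := by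
  rw [part_eq_span] at hx hy
  induction hx using Submodule.span_induction with
  | mem x hx =>
    obtain ⟨w, rfl, rfl⟩ := hx
    induction hy using Submodule.span_induction with
    | mem y hy =>
      obtain ⟨w', rfl, rfl⟩ := hy
      rw [bracket_freeWord, freeOp_word, freeOp_word, freeOp_word]; rfl
    | zero => simp
    | add y z _ _ h1 h2 => simp only [map_add, h1, h2, mul_add, add_mul, smul_add]; abel
    | smul c y _ h =>
      simp only [map_smul, h, mul_smul_comm, smul_mul_assoc, smul_sub, smul_comm c]
  | zero => simp
  | add y z _ _ h1 h2 =>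
    simp only [map_add, LinearMap.add_apply, h1, h2, mul_add, add_mul, smul_add]; abel
  | smul c y _ h =>
    simp only [map_smul, LinearMap.smul_apply, h, mul_smul_comm, smul_mul_assoc, smul_sub,
      smul_comm c]

theorem superSign_add_left (i j k : ZMod 2) :
    superSign (i + j) k = superSign i k * superSign j k := by
  rcases parity_cases i with rfl | rfl <;> rcases parity_cases j with rfl | rfl <;>
    rcases parity_cases k with rfl | rfl <;>
    simp [superSign, show (1 + 1 : ZMod 2) = 0 from rfl]

/-- Supercommutators of operators satisfy the super Jacobi identity because the sign is
bimultiplicative and squares to 1. No relation between the letters is needed. -/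
theorem freeOp_jacobi (op : G → Module.End ℂ V) {i j : ZMod 2} {x y : FreeSuperalgebra p}
    (hx : x ∈ part i) (hy : y ∈ part j) (z : FreeSuperalgebra p) :
    freeOp p op (bracket x (bracket y z) - bracket (bracket x y) z
      - superSign i j • bracket y (bracket x z)) = 0 := by
  refine homogeneous_induction (P := fun z => freeOp p op (bracket x (bracket y z) -
    bracket (bracket x y) z - superSign i j • bracket y (bracket x z)) = 0)
    (fun z z' h1 h2 => ?_) (fun k z hz => ?_) z
  · have := congrArg₂ (· + ·) h1 h2
    simp only [← map_add, add_zero] at this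
    rw [← this]
    congr 1
    simp only [map_add, smul_add]
    abel
  · have b := @Superalgebra.bracket_mem (FreeSuperalgebra p) _ _ _
    rw [map_sub, map_sub, map_smul, freeOp_bracket _ _ hx (b hy hz),
      freeOp_bracket _ _ hy hz, freeOp_bracket _ _ (b hx hy) hz, freeOp_bracket _ _ hx hy,
      freeOp_bracket _ _ hy (b hx hz), freeOp_bracket _ _ hx hz, superSign_add_left,
      superSign_comm i (j + k), superSign_comm j (i + k), superSign_add_left, superSign_add_left,
      superSign_comm k i, superSign_comm k j, superSign_comm j i]
    have h1 := superSign_mul_self i j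
    simp only [mul_sub, sub_mul, smul_sub, mul_smul_comm, smul_mul_assoc, smul_smul, ← mul_assoc,
      h1, one_mul]
    generalize superSign i j = s at *
    generalize superSign i k = s' at *
    generalize superSign j k = s'' at *
    match_scalars <;> ring

/-- If the letters act homogeneously, so do all elements. -/
theorem freeOp_mem (op : G → Module.End ℂ V) (vp : ZMod 2 → Submodule ℂ V)
    (hop : ∀ g i, ∀ m ∈ vp i, op g m ∈ vp (p g + i)) {i j : ZMod 2} {x : FreeSuperalgebra p}
    {m : V} (hx : x ∈ part i) (hm : m ∈ vp j) : freeOp p op x m ∈ vp (i + j) := by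
  have key : ∀ w j, ∀ m ∈ vp j, wordOp p op w m ∈ vp (wordParity p w + j) := by
    intro w
    induction w using FreeMagma.rec with
    | of x => exact hop x
    | mul a b ha hb =>
      intro j m hm
      refine Submodule.sub_mem _ ?_ (Submodule.smul_mem _ _ ?_)
      · have := ha _ _ (hb _ _ hm)
        rw [← add_assoc] at this; exact this
      · have := hb _ _ (ha _ _ hm)
        rw [← add_assoc, add_comm (wordParity p b)] at this; exact this
  rw [part_eq_span] at hx
  induction hx using Submodule.span_induction with
  | mem x hx =>
    obtain ⟨w, rfl, rfl⟩ := hx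
    rw [freeOp_word]; exact key w j m hm
  | zero => simp
  | add y z _ _ h1 h2 => rw [map_add]; exact Submodule.add_mem _ h1 h2
  | smul c y _ h => rw [map_smul]; exact Submodule.smul_mem _ _ h

/-- Words span, and they are homogeneous. The product step may therefore assume homogeneous factors,
which is what the signed module axiom requires. -/
theorem free_induction {P : FreeSuperalgebra p → Prop} (hof : ∀ g, P (FreeSuperalgebra.of p g))
    (hbr : ∀ i j, ∀ x ∈ part i, ∀ y ∈ part j, P x → P y → P (bracket x y))
    (hzero : P 0) (hadd : ∀ x y, P x → P y → P (x + y)) (hsmul : ∀ (c : ℂ) x, P x → P (c • x)) :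
    ∀ x, P x := by
  refine homogeneous_induction hadd fun i x hx => ?_
  rw [part_eq_span] at hx
  induction hx using Submodule.span_induction with
  | mem x hx =>
    obtain ⟨w, -, rfl⟩ := hx
    induction w using FreeMagma.rec with
    | of x => exact hof x
    | mul a b ha hb =>
      have := hbr _ _ _ (freeWord_mem p a) _ (freeWord_mem p b) ha hb
      rwa [bracket_freeWord] at this
  | zero => exact hzero
  | add y z _ _ h1 h2 => exact hadd _ _ h1 h2
  | smul c y _ h => exact hsmul _ _ h

end FreeRep

/-! ### The algebra `PreContragredient R p` and its modules -/

section Pre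

variable {ι : Type} [Fintype ι] [DecidableEq ι] {𝔥 : Type u} [AddCommGroup 𝔥] [Module ℂ 𝔥]
  {A : Matrix ι ι ℂ} {R : Realization A 𝔥} {p : ι → ZMod 2}

theorem preGen_mem (g : Gen ι 𝔥) : preGen R p g ∈ part (genParity p g) :=
  ⟨_, freeWord_mem (genParity p) (FreeMagma.of g), rfl⟩

theorem gen_mem (g : Gen ι 𝔥) : gen R p g ∈ part (genParity p g) :=
  ⟨_, preGen_mem g, rfl⟩

theorem pre_induction {P : PreContragredient R p → Prop} (hof : ∀ g, P (preGen R p g))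
    (hbr : ∀ i j, ∀ x ∈ part i, ∀ y ∈ part j, P x → P y → P (bracket x y))
    (hzero : P 0) (hadd : ∀ x y, P x → P y → P (x + y)) (hsmul : ∀ (c : ℂ) x, P x → P (c • x)) :
    ∀ x, P x := by
  intro x
  obtain ⟨x, rfl⟩ := Submodule.mkQ_surjective _ x
  refine free_induction (P := fun x => P (Submodule.mkQ _ x)) _ hof (fun i j x hx y hy h1 h2 => ?_)
    (by rwa [map_zero]) (fun x y h1 h2 => by rw [map_add]; exact hadd _ _ h1 h2)
    (fun c x h => by rw [map_smul]; exact hsmul _ _ h) x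
  exact hbr i j _ ⟨x, hx, rfl⟩ _ ⟨y, hy, rfl⟩ h1 h2

theorem contragredient_induction {P : Contragredient R p → Prop} (hof : ∀ g, P (gen R p g))
    (hbr : ∀ i j, ∀ x ∈ part i, ∀ y ∈ part j, P x → P y → P (bracket x y))
    (hzero : P 0) (hadd : ∀ x y, P x → P y → P (x + y)) (hsmul : ∀ (c : ℂ) x, P x → P (c • x)) :
    ∀ x, P x := by
  intro x
  obtain ⟨x, rfl⟩ := Submodule.mkQ_surjective _ x
  refine pre_induction (P := fun x => P (Submodule.mkQ _ x)) hof (fun i j x hx y hy h1 h2 => ?_)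
    (by rwa [map_zero]) (fun x y h1 h2 => by rw [map_add]; exact hadd _ _ h1 h2)
    (fun c x h => by rw [map_smul]; exact hsmul _ _ h) x
  exact hbr i j _ ⟨x, hx, rfl⟩ _ ⟨y, hy, rfl⟩ h1 h2

theorem preGen_rel {x : FreeSuperalgebra (genParity (𝔥 := 𝔥) p)} (h : Rel R p x) :
    (SuperIdeal.span {x | Rel R p x}).toSubmodule.mkQ x = 0 :=
  (Submodule.Quotient.mk_eq_zero _).2 (SuperIdeal.subset_span _ h)

theorem preGen_linear (c : ℂ) (h h' : 𝔥) : preGen R p (Gen.H (c • h + h')) =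
    c • preGen R p (Gen.H h) + preGen R p (Gen.H h') := by
  have := preGen_rel (Rel.linear (R := R) (p := p) c h h')
  rw [map_sub, map_sub, map_smul, sub_sub, sub_eq_zero] at this
  exact this

variable (R p) in
/-- The linear map from the Cartan subalgebra to `PreContragredient R p`. -/
noncomputable def preH : 𝔥 →ₗ[ℂ] PreContragredient R p where
  toFun h := preGen R p (Gen.H h)
  map_add' h h' := by simpa using preGen_linear (R := R) (p := p) 1 h h'
  map_smul' c h := by
    have h0 : preGen R p (Gen.H 0) = 0 := by simpa using preGen_linear (R := R) (p := p) (-1) 0 0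
    simpa [h0] using preGen_linear (R := R) (p := p) c h 0

theorem preH_apply (h : 𝔥) : preH R p h = preGen R p (Gen.H h) := rfl

theorem pre_HH (h h' : 𝔥) : bracket (preH R p h) (preH R p h') = 0 :=
  preGen_rel (Rel.HH (R := R) (p := p) h h')

theorem pre_HX (h : 𝔥) (i : ι) :
    bracket (preH R p h) (preGen R p (Gen.X i)) = R.root i h • preGen R p (Gen.X i) := by
  have := preGen_rel (Rel.HX (R := R) (p := p) h i)
  rw [map_sub, map_smul, sub_eq_zero] at this
  exact this

theorem pre_HY (h : 𝔥) (i : ι) :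
    bracket (preH R p h) (preGen R p (Gen.Y i)) = -(R.root i h • preGen R p (Gen.Y i)) := by
  have := preGen_rel (Rel.HY (R := R) (p := p) h i)
  rw [map_add, map_smul] at this
  exact eq_neg_of_add_eq_zero_left this

theorem pre_XY (i j : ι) : bracket (preGen R p (Gen.X i)) (preGen R p (Gen.Y j)) =
    if i = j then preH R p (R.coroot i) else 0 := by
  split_ifs with h
  · subst h
    have := preGen_rel (Rel.XY_same (R := R) (p := p) i)
    rw [map_sub, sub_eq_zero] at this
    exact this
  · exact preGen_rel (Rel.XY_ne (R := R) (p := p) i j h)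

namespace SuperModule

variable {V : Type v} [AddCommGroup V] [Module ℂ V] {W : Type w} [AddCommGroup W] [Module ℂ W]

theorem act_mem_of_pre (M : SuperModule (PreContragredient R p) V) (N : Submodule ℂ V)
    (hN : ∀ g, ∀ m ∈ N, M.act (preGen R p g) m ∈ N) (x : PreContragredient R p) :
    ∀ m ∈ N, M.act x m ∈ N := by
  refine pre_induction (P := fun x => ∀ m ∈ N, M.act x m ∈ N) hN (fun i j x hx y hy h1 h2 m hm => ?_)
    (by simp) (fun x y h1 h2 m hm => ?_) (fun c x h m hm => ?_) x
  · rw [M.act_bracket m hx hy]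
    exact N.sub_mem (h1 _ (h2 _ hm)) (N.smul_mem _ (h2 _ (h1 _ hm)))
  · rw [map_add]; exact N.add_mem (h1 _ hm) (h2 _ hm)
  · rw [map_smul]; exact N.smul_mem _ (h _ hm)

theorem map_act_of_pre (M : SuperModule (PreContragredient R p) V)
    (M' : SuperModule (PreContragredient R p) W) (φ : V →ₗ[ℂ] W)
    (hφ : ∀ g m, φ (M.act (preGen R p g) m) = M'.act (preGen R p g) (φ m))
    (x : PreContragredient R p) : ∀ m, φ (M.act x m) = M'.act x (φ m) := by
  refine pre_induction (P := fun x => ∀ m, φ (M.act x m) = M'.act x (φ m)) hφ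
    (fun i j x hx y hy h1 h2 m => ?_)
    (by simp) (fun x y h1 h2 m => ?_) (fun c x h m => ?_) x
  · rw [M.act_bracket m hx hy, M'.act_bracket _ hx hy, map_sub, map_smul, h1, h2, h2, h1]
  · simp only [map_add, LinearMap.add_apply, h1, h2]
  · simp only [map_smul, LinearMap.smul_apply, h]

end SuperModule

/-! ### Modules defined by operators that satisfy the defining relations. -/

section OfOperators

variable {V : Type v} [AddCommGroup V] [Module ℂ V] (vp : ZMod 2 → Submodule ℂ V)
  (hvp : IsCompl (vp 0) (vp 1)) (op : Gen ι 𝔥 → Module.End ℂ V)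
  (hop : ∀ g i, ∀ m ∈ vp i, op g m ∈ vp (genParity p g + i))

include hvp hop in
-- On a homogeneous vector the even and the odd element take values in complementary parts, so a
-- vanishing sum vanishes termwise.
theorem freeOp_kernel_graded {x y : FreeSuperalgebra (genParity (𝔥 := 𝔥) p)}
    (hx : x ∈ part 0) (hy : y ∈ part 1)
    (h : freeOp (genParity p) op (x + y) = 0) :
    freeOp (genParity p) op x = 0 ∧ freeOp (genParity p) op y = 0 := by
  have key : ∀ m, freeOp (genParity p) op x m = 0 := by
    intro m
    have hm : m ∈ vp 0 ⊔ vp 1 := by rw [hvp.sup_eq_top]; trivial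
    have h2 : ∀ m, freeOp (genParity p) op x m = -freeOp (genParity p) op y m := fun m =>
      eq_neg_of_add_eq_zero_left (by rw [← LinearMap.add_apply, ← map_add, h]; rfl)
    have h3 := Submodule.disjoint_def.1 hvp.disjoint
    obtain ⟨a, ha, b, hb, rfl⟩ := Submodule.mem_sup.1 hm
    have ha1 := freeOp_mem _ op vp hop hx ha
    have ha2 := freeOp_mem _ op vp hop hy ha
    have hb1 := freeOp_mem _ op vp hop hx hb
    have hb2 := freeOp_mem _ op vp hop hy hb
    rw [map_add, h3 _ ha1 (h2 a ▸ Submodule.neg_mem _ ha2),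
      h3 _ (h2 b ▸ Submodule.neg_mem _ hb2) hb1, add_zero]
  have h1 : freeOp (genParity p) op x = 0 := LinearMap.ext key
  exact ⟨h1, by rwa [map_add, h1, zero_add] at h⟩

/-- The kernel of the representation of the free superalgebra by homogeneous operators. -/
noncomputable def freeOpKer : SuperIdeal (FreeSuperalgebra (genParity (𝔥 := 𝔥) p)) where
  toSubmodule := LinearMap.ker (freeOp (genParity p) op)
  bracket_left x y hy := by
    obtain ⟨c, hc, d, hd, rfl⟩ := exists_add_eq y
    obtain ⟨h1, h2⟩ := freeOp_kernel_graded vp hvp op hop hc hd hy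
    refine homogeneous_induction (P := fun x => bracket x (c + d) ∈ LinearMap.ker _)
      (fun x y h1 h2 => ?_) (fun i x hx => ?_) x
    · rw [map_add bracket, LinearMap.add_apply]; exact Submodule.add_mem _ h1 h2
    · rw [LinearMap.mem_ker, map_add, map_add, freeOp_bracket _ _ hx hc, freeOp_bracket _ _ hx hd,
        h1, h2]
      simp
  bracket_right := by
    intro y x hy
    obtain ⟨c, hc, d, hd, rfl⟩ := exists_add_eq y
    obtain ⟨h1, h2⟩ := freeOp_kernel_graded vp hvp op hop hc hd hy
    refine homogeneous_induction (P := fun x => bracket (c + d) x ∈ LinearMap.ker _)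
      (fun x y h1 h2 => ?_) (fun i x hx => ?_) x
    · rw [map_add]; exact Submodule.add_mem _ h1 h2
    · rw [LinearMap.mem_ker, map_add, LinearMap.add_apply, map_add, freeOp_bracket _ _ hc hx,
        freeOp_bracket _ _ hd hx, h1, h2]
      simp
  graded := by
    intro y hy
    obtain ⟨c, hc, d, hd, rfl⟩ := exists_add_eq y
    obtain ⟨h1, h2⟩ := freeOp_kernel_graded vp hvp op hop hc hd hy
    exact Submodule.add_mem_sup ⟨h1, hc⟩ ⟨h2, hd⟩

/-- Homogeneous operators satisfying the defining relations give a module. -/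
noncomputable def preModule (opH : 𝔥 →ₗ[ℂ] Module.End ℂ V) (hH : ∀ h, op (Gen.H h) = opH h)
    (hHH : ∀ h h' m, opH h (opH h' m) = opH h' (opH h m))
    (hHX : ∀ h i m, opH h (op (Gen.X i) m) = op (Gen.X i) (opH h m) + R.root i h • op (Gen.X i) m)
    (hHY : ∀ h i m, opH h (op (Gen.Y i) m) = op (Gen.Y i) (opH h m) - R.root i h • op (Gen.Y i) m)
    (hXY : ∀ i j m, op (Gen.X i) (op (Gen.Y j) m) =
      (if i = j then opH (R.coroot i) m else 0) +
        superSign (p i) (p j) • op (Gen.Y j) (op (Gen.X i) m)) :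
    SuperModule (PreContragredient R p) V where
  vpart := vp
  isCompl_vpart := hvp
  act := Submodule.liftQ _ (freeOp (genParity p) op) (by
    -- The kernel is a graded ideal, so it suffices that it contains the relators: the two Lie
    -- axioms hold for supercommutators, the other families are the hypotheses.
    have hK : ({x | Rel R p x} : Set _) ⊆ (freeOpKer vp hvp op hop).toSubmodule := by
      have hof := freeOp_of (genParity (𝔥 := 𝔥) p) op
      have hm : ∀ g, FreeSuperalgebra.of (genParity (𝔥 := 𝔥) p) g ∈
        part (L := FreeSuperalgebra (genParity (𝔥 := 𝔥) p)) (genParity p g) :=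
        fun g => freeWord_mem _ (FreeMagma.of g)
      rintro _ (⟨i, j, x, y, hx, hy⟩ | ⟨i, j, x, y, z, hx, hy⟩ | ⟨c, h, h'⟩ | ⟨h, h'⟩ | ⟨h, i⟩ |
        ⟨h, i⟩ | ⟨i⟩ | ⟨i, j, hij⟩) <;>
        change freeOp _ _ _ = 0
      · rw [map_add, map_smul, freeOp_bracket _ _ hx hy, freeOp_bracket _ _ hy hx, smul_sub,
          smul_smul, superSign_comm j i, superSign_mul_self, one_smul]
        abel
      · exact freeOp_jacobi _ op hx hy z
      · rw [map_sub, map_sub, map_smul, hof, hof, hof, hH, hH, hH, map_add, map_smul]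
        abel
      · rw [freeOp_bracket _ _ (hm _) (hm _), hof, hof, hH, hH]
        ext m
        simp [genParity, superSign_zero_left, hHH h h' m]
      · rw [map_sub, map_smul, freeOp_bracket _ _ (hm _) (hm _), hof, hof, hH]
        ext m
        simp [genParity, superSign_zero_left, hHX h i m]
      · rw [map_add, map_smul, freeOp_bracket _ _ (hm _) (hm _), hof, hof, hH]
        ext m
        simp [genParity, superSign_zero_left, hHY h i m]
      · rw [map_sub, freeOp_bracket _ _ (hm _) (hm _), hof, hof, hof, hH]
        ext m
        simp [genParity, hXY i i m]
      · rw [freeOp_bracket _ _ (hm _) (hm _), hof, hof]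
        ext m
        simp [genParity, hXY i j m, hij]
    intro x hx
    exact Submodule.mem_sInf.1 hx _ ⟨_, hK, rfl⟩)
  act_mem := by
    rintro i j _ m ⟨x, hx, rfl⟩ hm
    exact freeOp_mem _ op vp hop hx hm
  act_bracket := by
    rintro i j _ _ m ⟨x, hx, rfl⟩ ⟨y, hy, rfl⟩
    exact congrArg (fun f : Module.End ℂ V => f m) (freeOp_bracket _ op hx hy)

end OfOperators

end Pre

/-! ### Triangular decomposition -/

section Words

variable {L : Type u} [AddCommGroup L] [Module ℂ L] [Superalgebra L] [IsLieSuperalgebra L]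
  {ι : Type} {𝔥 : Type v} [AddCommGroup 𝔥] [Module ℂ 𝔥]

/-- The left-normed bracket `[y_{j_1}, [y_{j_2}, … , [y_{j_k}, y_i]]]`. -/
def bracketWord (y : ι → L) (i : ι) : List ι → L
  | [] => y i
  | j :: l => bracket (y j) (bracketWord y i l)

/-- The span of the left-normed brackets. -/
def bracketSpan (y : ι → L) : Submodule ℂ L :=
  Submodule.span ℂ {x | ∃ i l, x = bracketWord y i l}

theorem subset_bracketSpan (y : ι → L) (i : ι) : y i ∈ bracketSpan y :=
  Submodule.subset_span ⟨i, [], rfl⟩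

theorem bracket_mem_bracketSpan (y : ι → L) (i : ι) {x : L} (hx : x ∈ bracketSpan y) :
    bracket (y i) x ∈ bracketSpan y := by
  have : bracketSpan y ≤ (bracketSpan y).comap (bracket (y i)) := by
    refine Submodule.span_le.2 ?_
    rintro _ ⟨j, l, rfl⟩
    exact Submodule.subset_span ⟨j, i :: l, rfl⟩
  exact this hx

variable (H : 𝔥 →ₗ[ℂ] L) (hH : ∀ h, H h ∈ part (L := L) 0) (y : ι → L)
  (r : ι → Module.Dual ℂ 𝔥) (hr : ∀ h i, bracket (H h) (y i) = r i h • y i)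

include hH hr

theorem bracket_cartan_bracketWord (h : 𝔥) (i : ι) (l : List ι) :
    bracket (H h) (bracketWord y i l) = (r i h + (l.map fun j => r j h).sum) • bracketWord y i l := by
  induction l with
  | nil => simp [bracketWord, hr]
  | cons j l ih =>
    rw [bracketWord, bracket_even_left (hH h), ih, hr, map_smul, map_smul, LinearMap.smul_apply,
      ← add_smul, List.map_cons, List.sum_cons]
    congr 1; ring

theorem bracket_cartan_mem_bracketSpan (h : 𝔥) {x : L} (hx : x ∈ bracketSpan y) :
    bracket (H h) x ∈ bracketSpan y := by
  have : bracketSpan y ≤ (bracketSpan y).comap (bracket (H h)) := by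
    refine Submodule.span_le.2 ?_
    rintro _ ⟨j, l, rfl⟩
    change bracket (H h) _ ∈ bracketSpan y
    rw [bracket_cartan_bracketWord H hH y r hr]
    exact Submodule.smul_mem _ _ (Submodule.subset_span ⟨j, l, rfl⟩)
  exact this hx

/-- A word in k ≥ 1 letters has eigenvalue s·k, which is not 0. -/
theorem bracketSpan_le_iSup_eigenspace {h : 𝔥} {s : ℂ} (hs : s ≠ 0) (h1 : ∀ i, r i h = s) :
    bracketSpan y ≤ ⨆ ν, ⨆ (_ : ν ≠ 0), Module.End.eigenspace (bracket (H h)) ν := by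
  refine Submodule.span_le.2 ?_
  rintro _ ⟨j, l, rfl⟩
  refine Submodule.mem_iSup_of_mem (s * (l.length + 1)) (Submodule.mem_iSup_of_mem ?_ ?_)
  · exact mul_ne_zero hs (by exact_mod_cast l.length.succ_ne_zero)
  · rw [Module.End.mem_eigenspace_iff, bracket_cartan_bracketWord H hH y r hr]
    congr 1
    simp only [h1, List.map_const', List.sum_replicate, nsmul_eq_mul]
    ring

/-- Moving `x i` past the first letter of a word leaves a Cartan element acting on the shorter word
and that letter acting on `[x_i, shorter word]`, which induction places in the sum. It is stated for
abstract families so that it serves both halves of the triangular decomposition. -/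
theorem bracket_mem_cartan_sup (p : ι → ZMod 2) (x : ι → L) (hx : ∀ i, x i ∈ part (L := L) (p i))
    (hy : ∀ i, y i ∈ part (L := L) (p i)) (c : ι → ι → 𝔥)
    (hxy : ∀ i j, bracket (x i) (y j) = H (c i j)) (i : ι) {w : L} (hw : w ∈ bracketSpan y) :
    bracket (x i) w ∈ LinearMap.range H ⊔ bracketSpan y := by
  have : bracketSpan y ≤ (LinearMap.range H ⊔ bracketSpan y).comap (bracket (x i)) := by
    refine Submodule.span_le.2 ?_
    rintro _ ⟨j, l, rfl⟩
    change bracket (x i) (bracketWord y j l) ∈ LinearMap.range H ⊔ bracketSpan y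
    induction l with
    | nil => exact Submodule.mem_sup_left ⟨_, (hxy i j).symm⟩
    | cons k l ih =>
      have := (SuperModule.adjoint L).act_bracket (bracketWord y j l) (hx i) (hy k)
      change bracket (bracket _ _) _ = bracket _ (bracket _ _) - _ • bracket _ (bracket _ _) at this
      rw [eq_sub_iff_add_eq] at this
      rw [bracketWord, ← this]
      refine Submodule.mem_sup_right (Submodule.add_mem _ ?_ (Submodule.smul_mem _ _ ?_))
      · rw [hxy]
        exact bracket_cartan_mem_bracketSpan H hH y r hr _ (Submodule.subset_span ⟨j, l, rfl⟩)
      · obtain ⟨_, ⟨h, rfl⟩, b, hb, hab⟩ := Submodule.mem_sup.1 ih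
        rw [← hab, map_add]
        refine Submodule.add_mem _ ?_ (bracket_mem_bracketSpan y k hb)
        have h1 := bracket_skew_even (hH h) (y k)
        rw [hr, eq_neg_iff_add_eq_zero, add_comm, ← eq_neg_iff_add_eq_zero] at h1
        rw [h1]
        exact Submodule.neg_mem _ (Submodule.smul_mem _ _ (subset_bracketSpan y k))
  exact this hw

end Words

section Pre

variable {ι : Type} [Fintype ι] [DecidableEq ι] {𝔥 : Type u} [AddCommGroup 𝔥] [Module ℂ 𝔥]
  {A : Matrix ι ι ℂ} {R : Realization A 𝔥} {p : ι → ZMod 2}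

/-- Linear independence of the roots is injectivity of the dual of the map 𝔥 → ℂ^ι they define,
hence surjectivity of that map. Taking all values equal to 1 gives the element that measures height.
-/
theorem Realization.exists_grading (R : Realization A 𝔥) (c : ι → ℂ) :
    ∃ d : 𝔥, ∀ i, R.root i d = c i := by
  have := R.finiteDimensional
  have h : Function.Surjective (LinearMap.pi R.root : 𝔥 →ₗ[ℂ] ι → ℂ) := by
    rw [← LinearMap.dualMap_injective_iff]
    rw [← LinearMap.ker_eq_bot, LinearMap.ker_eq_bot']
    intro f hf
    have h1 := Fintype.linearIndependent_iff.1 R.linearIndependent_root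
      (fun i => f (Pi.single i 1)) (by
        ext d
        have := congrArg (fun g : Module.Dual ℂ 𝔥 => g d) hf
        simp only [LinearMap.dualMap_apply, LinearMap.zero_apply] at this
        rw [LinearMap.pi_apply_eq_sum_univ f] at this
        have hp : ∀ i : ι, (fun j => if i = j then (1 : ℂ) else 0) = Pi.single i 1 := fun i => by
          ext j; simp [Pi.single_apply, eq_comm]
        simpa [LinearMap.sum_apply, mul_comm, hp] using this)
    exact LinearMap.pi_ext' fun i => LinearMap.ext_ring (by simpa using h1 i)
  obtain ⟨d, hd⟩ := h c
  exact ⟨d, fun i => congrFun hd i⟩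

theorem preH_mem (h : 𝔥) : preH R p h ∈ part (L := PreContragredient R p) 0 := preGen_mem (Gen.H h)

variable (R p) in
/-- The sum of the eigenspaces of `ad d` with non-zero eigenvalues. -/
noncomputable def offCartan (d : 𝔥) : Submodule ℂ (PreContragredient R p) :=
  ⨆ ν, ⨆ (_ : ν ≠ 0), Module.End.eigenspace (bracket (preH R p d)) ν

/-- The sum of 𝔥, the brackets of the `X_i` and the brackets of the `Y_i` contains the generators
and is stable under them, so it is everything. Only this spanning half of the triangular
decomposition is needed: the height separates 𝔥 from the rest. -/
theorem exists_preH_add {d : 𝔥} (hd : ∀ i, R.root i d = 1) (x : PreContragredient R p) :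
    ∃ h, ∃ e ∈ offCartan R p d, preH R p h + e = x := by
  set X : ι → PreContragredient R p := fun i => preGen R p (Gen.X i) with hX
  set Y : ι → PreContragredient R p := fun i => preGen R p (Gen.Y i) with hY
  have mX : ∀ i, X i ∈ part (p i) := fun i => preGen_mem (Gen.X i)
  have mY : ∀ i, Y i ∈ part (p i) := fun i => preGen_mem (Gen.Y i)
  have rX : ∀ h i, bracket (preH R p h) (X i) = R.root i h • X i := pre_HX
  have rY : ∀ h i, bracket (preH R p h) (Y i) = (-R.root i) h • Y i := fun h i => by
    rw [LinearMap.neg_apply, neg_smul]; exact pre_HY h i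
  have hXY : ∀ i j, bracket (X i) (Y j) = preH R p (if i = j then R.coroot i else 0) := by
    intro i j; rw [pre_XY]; split_ifs <;> simp
  have hYX : ∀ i j, bracket (Y i) (X j) =
      preH R p (-superSign (p i) (p j) • if j = i then R.coroot j else 0) := by
    intro i j
    rw [map_smul, ← hXY, neg_smul]
    exact eq_neg_of_add_eq_zero_left (IsLieSuperalgebra.skew (mY i) (mX j))
  set S := LinearMap.range (preH R p) ⊔ bracketSpan X ⊔ bracketSpan Y with hS
  have hSg : ∀ g, preGen R p g ∈ S := by
    rintro (i | i | h)
    · exact Submodule.mem_sup_left (Submodule.mem_sup_right (subset_bracketSpan X i))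
    · exact Submodule.mem_sup_right (subset_bracketSpan Y i)
    · exact Submodule.mem_sup_left (Submodule.mem_sup_left ⟨h, rfl⟩)
  have hSt : ∀ g, ∀ m ∈ S, bracket (preGen R p g) m ∈ S := by
    intro g m hm
    have hle : S ≤ S.comap (bracket (preGen R p g)) := by
      refine sup_le (sup_le ?_ ?_) ?_
      · rintro _ ⟨h, rfl⟩
        change bracket _ _ ∈ S
        have := (neg_eq_iff_eq_neg.2 (bracket_skew_even (preH_mem (R := R) (p := p) h)
          (preGen R p g)))
        rw [← this]
        refine Submodule.neg_mem _ ?_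
        rcases g with i | i | h'
        · have := rX h i
          simp only [hX] at this
          rw [this]
          exact Submodule.smul_mem _ _ (hSg _)
        · have := rY h i
          simp only [hY] at this
          rw [this]
          exact Submodule.smul_mem _ _ (hSg _)
        · have := pre_HH (R := R) (p := p) h h'
          rw [preH_apply h'] at this
          rw [this]
          exact Submodule.zero_mem _
      · intro w hw
        rcases g with i | i | h'
        · exact Submodule.mem_sup_left (Submodule.mem_sup_right (bracket_mem_bracketSpan X i hw))
        · exact Submodule.mem_sup_left
            (bracket_mem_cartan_sup (preH R p) preH_mem X R.root rX p Y mY mX _ hYX i hw)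
        · exact Submodule.mem_sup_left (Submodule.mem_sup_right
            (bracket_cartan_mem_bracketSpan (preH R p) preH_mem X R.root rX h' hw))
      · intro w hw
        rcases g with i | i | h'
        · exact (sup_le_sup_right le_sup_left _ : _ ≤ S)
            (bracket_mem_cartan_sup (preH R p) preH_mem Y (-R.root) rY p X mX mY _ hXY i hw)
        · exact Submodule.mem_sup_right (bracket_mem_bracketSpan Y i hw)
        · exact Submodule.mem_sup_right
            (bracket_cartan_mem_bracketSpan (preH R p) preH_mem Y (-R.root) rY h' hw)
    exact hle hm
  have hx : x ∈ S := by
    refine pre_induction (P := fun x => x ∈ S) hSg (fun i j x _ y _ _ hy => ?_) S.zero_mem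
      (fun _ _ => S.add_mem) (fun c _ => S.smul_mem c) x
    exact (SuperModule.adjoint _).act_mem_of_pre S hSt x y hy
  rw [hS, sup_assoc] at hx
  obtain ⟨_, ⟨h, rfl⟩, e, he, rfl⟩ := Submodule.mem_sup.1 hx
  refine ⟨h, e, (sup_le ?_ ?_ : _ ≤ offCartan R p d) he, rfl⟩
  · exact bracketSpan_le_iSup_eigenspace (preH R p) preH_mem X R.root rX one_ne_zero hd
  · exact bracketSpan_le_iSup_eigenspace (preH R p) preH_mem Y (-R.root) rY (neg_ne_zero.2 one_ne_zero)
      (fun i => by rw [Pi.neg_apply, LinearMap.neg_apply, hd])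

/-- The ideal is stable under ad `d`, hence contains the Cartan component of each of its elements;
that component is zero by assumption. -/
theorem SuperIdeal.le_offCartan {d : 𝔥} (hd : ∀ i, R.root i d = 1)
    (I : SuperIdeal (PreContragredient R p))
    (hI : ∀ h : 𝔥, preH R p h ∈ I.toSubmodule → preH R p h = 0) :
    I.toSubmodule ≤ offCartan R p d := by
  intro x hx
  obtain ⟨h, e, he, rfl⟩ := exists_preH_add hd x
  have := mem_of_add_mem_of_eigenspace (bracket (preH R p d)) I.toSubmodule
    (fun v hv => I.bracket_left _ hv) (μ := 0) (by rw [pre_HH, zero_smul]) he hx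
  rwa [hI h this, zero_add]

/-- The bound by non-zero eigenspaces, unlike trivial intersection itself, passes to sums of ideals;
this is why the largest ideal exists with the expected property. -/
theorem maxIdeal_le_offCartan {d : 𝔥} (hd : ∀ i, R.root i d = 1) :
    (maxIdeal R p).toSubmodule ≤ offCartan R p d :=
  iSup₂_le fun I hI => I.le_offCartan hd hI

theorem preH_eq_zero_of_mem_offCartan {d h : 𝔥} (h1 : preH R p h ∈ offCartan R p d) :
    preH R p h = 0 :=
  eq_zero_of_mem_iSup_eigenspace (bracket (preH R p d)) (μ := 0) (by rw [pre_HH, zero_smul]) h1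

theorem SuperIdeal.le_maxIdeal (I : SuperIdeal (PreContragredient R p))
    (hI : ∀ h : 𝔥, preH R p h ∈ I.toSubmodule → preH R p h = 0) :
    I.toSubmodule ≤ (maxIdeal R p).toSubmodule :=
  le_iSup₂_of_le (f := fun (I : SuperIdeal (PreContragredient R p)) _ => I.toSubmodule) I hI le_rfl

variable (R p) in
/-- The linear map from the Cartan subalgebra to `𝔤(A)`. -/
noncomputable def genH : 𝔥 →ₗ[ℂ] Contragredient R p :=
  (maxIdeal R p).toSubmodule.mkQ.comp (preH R p)

/-- An ideal of `𝔤(A)` contained in the sum of the root spaces vanishes. -/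
theorem contragredient_ideal_eq_bot (d : 𝔥) (J : SuperIdeal (Contragredient R p))
    (hd : ∀ i, R.root i d = 1)
    (hJ : J.toSubmodule ≤ ⨆ ν, ⨆ (_ : ν ≠ 0), Module.End.eigenspace (bracket (genH R p d)) ν) :
    J.toSubmodule = ⊥ := by
  let J' : SuperIdeal (PreContragredient R p) :=
    { toSubmodule := J.toSubmodule.comap (maxIdeal R p).toSubmodule.mkQ
      bracket_left := fun x y hy => J.bracket_left ((maxIdeal R p).toSubmodule.mkQ x) hy
      bracket_right := fun y hx => J.bracket_right ((maxIdeal R p).toSubmodule.mkQ y) hx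
      graded := by
        intro x hx
        obtain ⟨a, ha, b, hb, rfl⟩ := exists_add_eq x
        have := mem_of_add_mem J.graded (Submodule.mem_map_of_mem ha) (Submodule.mem_map_of_mem hb)
          (by rw [← map_add]; exact hx)
        exact Submodule.add_mem_sup ⟨this.1, ha⟩ ⟨this.2, hb⟩ }
  -- The preimage of `J` still avoids 𝔥, because an element of 𝔥 has eigenvalue 0 while `J` lies in
  -- the other eigenspaces; so it is already contained in the maximal ideal.
  have h1 := J'.le_maxIdeal fun h hh => by
    have h2 : genH R p h = 0 := eq_zero_of_mem_iSup_eigenspace (bracket (genH R p d)) (μ := 0)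
      (by
        rw [zero_smul]
        have := congrArg (maxIdeal R p).toSubmodule.mkQ (pre_HH (R := R) (p := p) d h)
        rwa [map_zero] at this) (hJ hh)
    exact preH_eq_zero_of_mem_offCartan
      (maxIdeal_le_offCartan hd ((Submodule.Quotient.mk_eq_zero _).1 h2))
  rw [eq_bot_iff]
  intro x hx
  obtain ⟨x, rfl⟩ := Submodule.mkQ_surjective _ x
  exact (Submodule.Quotient.mk_eq_zero _).2 (h1 hx)

end Pre

/-! ### Verma modules and their irreducible quotients -/

namespace SuperModule

section General

variable {L : Type u} [AddCommGroup L] [Module ℂ L] [Superalgebra L]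
  {V : Type v} [AddCommGroup V] [Module ℂ V] {W : Type w} [AddCommGroup W] [Module ℂ W]

theorem IsSubmodule.comap {M : SuperModule L V} {M' : SuperModule L W} {N : Submodule ℂ W}
    (hN : M'.IsSubmodule N) (φ : V →ₗ[ℂ] W) (d : ZMod 2)
    (hφ : ∀ x m, φ (M.act x m) = M'.act x (φ m)) (hp : ∀ i, ∀ m ∈ M.vpart i, φ m ∈ M'.vpart (i + d)) :
    M.IsSubmodule (N.comap φ) := by
  refine ⟨fun x m hm => ?_, fun m hm => ?_⟩
  · rw [Submodule.mem_comap, hφ]; exact hN.1 x _ hm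
  · obtain ⟨a, ha, b, hb, rfl⟩ := M.exists_add_eq m
    have hm' : φ a + φ b ∈ N := by rw [← map_add]; exact hm
    rcases parity_cases d with rfl | rfl
    · obtain ⟨h1, h2⟩ := mem_of_add_mem hN.2 (hp 0 a ha) (hp 1 b hb) hm'
      exact Submodule.add_mem_sup ⟨h1, ha⟩ ⟨h2, hb⟩
    · obtain ⟨h1, h2⟩ := mem_of_add_mem hN.2 (hp 1 b hb) (hp 0 a ha) (by rwa [add_comm])
      exact Submodule.add_mem_sup ⟨h2, ha⟩ ⟨h1, hb⟩

theorem IsSubmodule.map {M : SuperModule L V} {M' : SuperModule L W} {N : Submodule ℂ V}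
    (hN : M.IsSubmodule N) (φ : V →ₗ[ℂ] W) (d : ZMod 2)
    (hφ : ∀ x m, φ (M.act x m) = M'.act x (φ m)) (hp : ∀ i, ∀ m ∈ M.vpart i, φ m ∈ M'.vpart (i + d)) :
    M'.IsSubmodule (N.map φ) := by
  constructor
  · rintro x _ ⟨m, hm, rfl⟩
    exact ⟨M.act x m, hN.1 x m hm, hφ x m⟩
  · rintro _ ⟨m, hm, rfl⟩
    obtain ⟨a, ha, b, hb, rfl⟩ := M.exists_add_eq m
    obtain ⟨h1, h2⟩ := mem_of_add_mem hN.2 ha hb hm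
    rw [map_add]
    rcases parity_cases d with rfl | rfl
    · exact Submodule.add_mem_sup ⟨⟨a, h1, rfl⟩, hp 0 a ha⟩ ⟨⟨b, h2, rfl⟩, hp 1 b hb⟩
    · rw [add_comm]
      exact Submodule.add_mem_sup ⟨⟨b, h2, rfl⟩, hp 1 b hb⟩ ⟨⟨a, h1, rfl⟩, hp 0 a ha⟩

theorem isSubmodule_bot (M : SuperModule L V) : M.IsSubmodule ⊥ :=
  ⟨fun x m hm => by rw [(Submodule.mem_bot ℂ).1 hm, map_zero]; exact Submodule.zero_mem _, bot_le⟩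

theorem isSubmodule_top (M : SuperModule L V) : M.IsSubmodule ⊤ :=
  ⟨fun _ _ _ => trivial, by rw [top_inf_eq, top_inf_eq, M.isCompl_vpart.sup_eq_top]⟩

theorem IsIsomorphic.symm {M : SuperModule L V} {M' : SuperModule L W} (h : M.IsIsomorphic M') :
    M'.IsIsomorphic M := by
  obtain ⟨e, he, d, hd⟩ := h
  refine ⟨e.symm, fun x m => ?_, d, fun i m hm => ?_⟩
  · rw [LinearEquiv.symm_apply_eq, he, LinearEquiv.apply_symm_apply]
  · obtain ⟨a, ha, b, hb, hab⟩ := M.exists_add_eq (e.symm m)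
    have h1 : e a + e b = m := by rw [← map_add, hab, LinearEquiv.apply_symm_apply]
    have key : ∀ j, j ≠ i + d → ∀ c ∈ M.vpart j, ∀ c', c' ∈ M.vpart (i + d) → e c + e c' = m →
        c = 0 := by
      intro j hj c hc c' hc' hcc
      have h2 : e c ∈ M'.vpart i := by
        rw [eq_sub_of_add_eq hcc]
        refine Submodule.sub_mem _ hm ?_
        have := hd _ c' hc'
        rwa [add_assoc, CharTwo.add_self_eq_zero, add_zero] at this
      have h3 : j + d ≠ i := fun h => hj (by
        rw [← h, add_assoc, CharTwo.add_self_eq_zero, add_zero])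
      exact e.map_eq_zero_iff.1 (M'.eq_zero_of_mem_of_mem h3 (hd j c hc) h2)
    rcases parity_cases (i + d) with h | h
    · have := key 1 (by simp [h]) b hb a (h ▸ ha) (by rwa [add_comm])
      rw [← hab, this, add_zero, h]; exact ha
    · have := key 0 (by simp [h]) a ha b (h ▸ hb) h1
      rw [← hab, this, zero_add, h]; exact hb

end General

end SuperModule

section Verma

variable {ι : Type} [Fintype ι] [DecidableEq ι] {𝔥 : Type u} [AddCommGroup 𝔥] [Module ℂ 𝔥]
  {A : Matrix ι ι ℂ} (R : Realization A 𝔥) (p : ι → ZMod 2) (lam : Module.Dual ℂ 𝔥)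

/-- The space of the Verma module: it has a basis of words in the `Y_i`. -/
abbrev VermaSpace (ι : Type) : Type u := List (ULift.{u} ι) →₀ ℂ

/-- The weight of a word in a Verma module. -/
noncomputable def wordWeight (l : List (ULift.{u} ι)) : Module.Dual ℂ 𝔥 :=
  lam - (l.map fun j => R.root j.down).sum

/-- The parity of a word in a Verma module. -/
def listParity (l : List (ULift.{u} ι)) : ZMod 2 := (l.map fun j => p j.down).sum

/-- The presentation before the maximal quotient imposes no relation among the `Y_i` beyond the Lie
axioms, so they act freely, by prepending a letter. -/
noncomputable def vermaY (i : ι) : Module.End ℂ (VermaSpace.{u} ι) :=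
  Finsupp.lmapDomain ℂ ℂ (List.cons ⟨i⟩)

theorem vermaY_single (i : ι) (l : List (ULift.{u} ι)) :
    vermaY i (Finsupp.single l 1) = Finsupp.single (⟨i⟩ :: l) 1 := by
  simp [vermaY]

noncomputable def vermaH : 𝔥 →ₗ[ℂ] Module.End ℂ (VermaSpace.{u} ι) where
  toFun h := Finsupp.linearCombination ℂ fun l => wordWeight R lam l h • Finsupp.single l 1
  map_add' h h' := by ext l : 2; simp [add_smul]
  map_smul' c h := by ext l : 2; simp [mul_smul]

theorem vermaH_single (h : 𝔥) (l : List (ULift.{u} ι)) :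
    vermaH R lam h (Finsupp.single l 1) = wordWeight R lam l h • Finsupp.single l 1 := by
  simp [vermaH]

/-- The recursion is forced by `X_i` killing the empty word and by the relation for `X_i Y_j`. -/
noncomputable def vermaXWord (i : ι) : List (ULift.{u} ι) → VermaSpace.{u} ι
  | [] => 0
  | j :: l => (if i = j.down then wordWeight R lam l (R.coroot i) • Finsupp.single l 1 else 0) +
      superSign (p i) (p j.down) • vermaY j.down (vermaXWord i l)

noncomputable def vermaX (i : ι) : Module.End ℂ (VermaSpace.{u} ι) :=
  Finsupp.linearCombination ℂ (vermaXWord R p lam i)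

theorem vermaX_single (i : ι) (l : List (ULift.{u} ι)) :
    vermaX R p lam i (Finsupp.single l 1) = vermaXWord R p lam i l := by
  simp [vermaX]

noncomputable def vermaOp : Gen ι 𝔥 → Module.End ℂ (VermaSpace.{u} ι)
  | Gen.X i => vermaX R p lam i
  | Gen.Y i => vermaY i
  | Gen.H h => vermaH R lam h

noncomputable def vermaPart (i : ZMod 2) : Submodule ℂ (VermaSpace.{u} ι) :=
  Finsupp.supported ℂ ℂ {l | listParity p l = i}

theorem single_mem_vermaPart (l : List (ULift.{u} ι)) :
    (Finsupp.single l 1 : VermaSpace.{u} ι) ∈ vermaPart p (listParity p l) :=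
  Finsupp.single_mem_supported ℂ 1 (rfl : l ∈ {l' | listParity p l' = listParity p l})

theorem isCompl_vermaPart : IsCompl (vermaPart.{u} p 0) (vermaPart p 1) := by
  constructor
  · refine Finsupp.disjoint_supported_supported (Set.disjoint_left.2 fun l h0 h1 => ?_)
    exact zero_ne_one (h0.symm.trans h1)
  · refine Finsupp.codisjoint_supported_supported (codisjoint_iff_le_sup.2 fun l _ => ?_)
    exact parity_cases (listParity p l)

theorem map_mem_of_vermaPart {f : Module.End ℂ (VermaSpace.{u} ι)} {i : ZMod 2}
    {N : Submodule ℂ (VermaSpace.{u} ι)}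
    (h : ∀ l, listParity p l = i → f (Finsupp.single l 1) ∈ N) :
    ∀ m ∈ vermaPart p i, f m ∈ N := by
  have : vermaPart p i ≤ N.comap f := by
    rw [vermaPart, Finsupp.supported_eq_span_single]
    refine Submodule.span_le.2 ?_
    rintro _ ⟨l, hl, rfl⟩
    exact h l hl
  exact this

theorem listParity_cons (j : ULift.{u} ι) (l : List (ULift.{u} ι)) :
    listParity p (j :: l) = p j.down + listParity p l := by simp [listParity]

theorem vermaY_mem (i : ι) (j : ZMod 2) :
    ∀ m ∈ vermaPart.{u} p j, vermaY i m ∈ vermaPart p (p i + j) := by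
  refine map_mem_of_vermaPart p fun l hl => ?_
  have := single_mem_vermaPart p (⟨i⟩ :: l)
  rw [listParity_cons, hl] at this
  rw [vermaY_single]; exact this

theorem vermaXWord_mem (i : ι) (l : List (ULift.{u} ι)) :
    vermaXWord R p lam i l ∈ vermaPart p (p i + listParity p l) := by
  induction l with
  | nil => exact Submodule.zero_mem _
  | cons j l ih =>
    rw [vermaXWord, listParity_cons]
    refine Submodule.add_mem _ ?_ (Submodule.smul_mem _ _ ?_)
    · split_ifs with h
      · refine Submodule.smul_mem _ _ ?_
        rw [h, ← add_assoc, CharTwo.add_self_eq_zero, zero_add]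
        exact single_mem_vermaPart p l
      · exact Submodule.zero_mem _
    · have := vermaY_mem p j.down _ _ ih
      rwa [add_left_comm] at this

theorem wordWeight_cons (j : ULift.{u} ι) (l : List (ULift.{u} ι)) :
    wordWeight R lam (j :: l) = wordWeight R lam l - R.root j.down := by
  simp only [wordWeight, List.map_cons, List.sum_cons]; abel

theorem vermaH_vermaY (h : 𝔥) (i : ι) (m : VermaSpace.{u} ι) :
    vermaH R lam h (vermaY i m) = vermaY i (vermaH R lam h m) - R.root i h • vermaY i m := by
  revert m
  refine LinearMap.congr_fun (f := vermaH R lam h * vermaY i)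
    (g := vermaY i * vermaH R lam h - R.root i h • vermaY i) ?_
  refine Finsupp.lhom_ext' fun l => LinearMap.ext_ring ?_
  change vermaH R lam h (vermaY i (Finsupp.single l 1)) = vermaY i (vermaH R lam h
    (Finsupp.single l 1)) - R.root i h • vermaY i (Finsupp.single l 1)
  rw [vermaY_single, vermaH_single, vermaH_single, map_smul, vermaY_single, wordWeight_cons,
    LinearMap.sub_apply, sub_smul]

theorem vermaH_vermaXWord (h : 𝔥) (i : ι) (l : List (ULift.{u} ι)) :
    vermaH R lam h (vermaXWord R p lam i l) =
      (wordWeight R lam l h + R.root i h) • vermaXWord R p lam i l := by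
  induction l with
  | nil => simp [vermaXWord]
  | cons j l ih =>
    rw [vermaXWord, map_add, map_smul, vermaH_vermaY, ih, wordWeight_cons]
    split_ifs with hij
    · subst hij
      simp only [map_smul, vermaH_single, LinearMap.sub_apply]
      module
    · simp only [map_smul, LinearMap.sub_apply, map_zero]
      module

theorem vermaX_vermaY (i j : ι) (m : VermaSpace.{u} ι) : vermaX R p lam i (vermaY j m) =
    (if i = j then vermaH R lam (R.coroot i) m else 0) +
      superSign (p i) (p j) • vermaY j (vermaX R p lam i m) := by
  have h : vermaX R p lam i * vermaY j = (if i = j then vermaH R lam (R.coroot i) else 0) +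
      superSign (p i) (p j) • (vermaY j * vermaX R p lam i) := by
    refine Finsupp.lhom_ext' fun l => LinearMap.ext_ring ?_
    change vermaX R p lam i (vermaY j (Finsupp.single l 1)) =
      (if i = j then vermaH R lam (R.coroot i) else 0) (Finsupp.single l 1) +
        superSign (p i) (p j) • vermaY j (vermaX R p lam i (Finsupp.single l 1))
    rw [vermaY_single, vermaX_single, vermaX_single, vermaXWord]
    split_ifs
    · rw [vermaH_single]
    · rfl
  have := LinearMap.congr_fun h m
  split_ifs at this ⊢ <;> exact this

/-- The Verma module of `PreContragredient R p`. -/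
noncomputable def verma : SuperModule (PreContragredient R p) (VermaSpace.{u} ι) :=
  preModule (vermaPart p) (isCompl_vermaPart p) (vermaOp R p lam)
    (by
      rintro (i | i | h) j
      · refine map_mem_of_vermaPart p fun l hl => ?_
        have := vermaXWord_mem R p lam i l
        rw [hl] at this
        change vermaX R p lam i _ ∈ _
        rw [vermaX_single]; exact this
      · exact vermaY_mem p i j
      · refine map_mem_of_vermaPart p fun l hl => ?_
        change vermaH R lam h _ ∈ _
        rw [vermaH_single]
        refine Submodule.smul_mem _ _ ?_
        rw [← hl]
        have := single_mem_vermaPart p l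
        rwa [← zero_add (listParity p l)] at this)
    (vermaH R lam) (fun _ => rfl)
    (by
      intro h h'
      refine LinearMap.congr_fun (f := vermaH R lam h * vermaH R lam h')
        (g := vermaH R lam h' * vermaH R lam h) ?_
      refine Finsupp.lhom_ext' fun l => LinearMap.ext_ring ?_
      change vermaH R lam h (vermaH R lam h' (Finsupp.single l 1)) =
        vermaH R lam h' (vermaH R lam h (Finsupp.single l 1))
      simp only [vermaH_single, map_smul, smul_smul, mul_comm])
    (by
      intro h i
      refine LinearMap.congr_fun (f := vermaH R lam h * vermaX R p lam i)
        (g := vermaX R p lam i * vermaH R lam h + R.root i h • vermaX R p lam i) ?_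
      refine Finsupp.lhom_ext' fun l => LinearMap.ext_ring ?_
      change vermaH R lam h (vermaX R p lam i (Finsupp.single l 1)) =
        vermaX R p lam i (vermaH R lam h (Finsupp.single l 1)) +
          R.root i h • vermaX R p lam i (Finsupp.single l 1)
      rw [vermaX_single, vermaH_single, map_smul, vermaX_single, vermaH_vermaXWord, add_smul])
    (vermaH_vermaY R lam)
    (vermaX_vermaY R p lam)

theorem verma_act_gen (g : Gen ι 𝔥) :
    (verma R p lam).act (preGen R p g) = vermaOp R p lam g :=
  freeOp_of (genParity p) (vermaOp R p lam) g

/-- The coefficient of the highest weight vector. -/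
noncomputable def vermaCoeff (ι : Type) : VermaSpace.{u} ι →ₗ[ℂ] ℂ := Finsupp.lapply []

theorem vermaCoeff_vermaY (i : ι) (m : VermaSpace.{u} ι) : vermaCoeff ι (vermaY i m) = 0 := by
  revert m
  refine LinearMap.congr_fun (f := (vermaCoeff ι).comp (vermaY i)) (g := 0) ?_
  refine Finsupp.lhom_ext' fun l => LinearMap.ext_ring ?_
  change vermaCoeff ι (vermaY i (Finsupp.single l 1)) = 0
  rw [vermaY_single]
  simp [vermaCoeff]

theorem vermaCoeff_vermaH (h : 𝔥) (m : VermaSpace.{u} ι) :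
    vermaCoeff ι (vermaH R lam h m) = lam h * vermaCoeff ι m := by
  revert m
  refine LinearMap.congr_fun (f := (vermaCoeff ι).comp (vermaH R lam h))
    (g := lam h • vermaCoeff ι) ?_
  refine Finsupp.lhom_ext' fun l => LinearMap.ext_ring ?_
  change vermaCoeff ι (vermaH R lam h (Finsupp.single l 1)) = lam h * vermaCoeff ι
    (Finsupp.single l 1)
  rw [vermaH_single]
  by_cases hl : l = [] <;> simp [vermaCoeff, wordWeight, hl]

variable {R p lam}

/-- The empty word is the only word of height eigenvalue `lam d`, since a word of length k has
eigenvalue `lam d - k`. A stable subspace therefore contains the top component of each of its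
vectors. -/
theorem nil_mem_of_vermaCoeff_ne_zero {d : 𝔥} (hd : ∀ i, R.root i d = 1)
    {N : Submodule ℂ (VermaSpace.{u} ι)} (hN : ∀ m ∈ N, vermaH R lam d m ∈ N)
    {w : VermaSpace.{u} ι} (hw : w ∈ N) (h0 : vermaCoeff ι w ≠ 0) :
    (Finsupp.single [] 1 : VermaSpace.{u} ι) ∈ N := by
  have hs : w [] • (Finsupp.single [] 1 : VermaSpace.{u} ι) + w.erase [] = w := by
    rw [Finsupp.smul_single, smul_eq_mul, mul_one, Finsupp.single_add_erase]
  have := mem_of_add_mem_of_eigenspace (vermaH R lam d) N hN (μ := lam d)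
    (a := w [] • (Finsupp.single [] 1 : VermaSpace.{u} ι)) (e := w.erase []) ?_ ?_ (by rwa [hs])
  · have := N.smul_mem (w [])⁻¹ this
    rwa [smul_smul, inv_mul_cancel₀ (show w [] ≠ 0 from h0), one_smul] at this
  · rw [map_smul, vermaH_single, smul_comm]; simp [wordWeight]
  · have h1 : w.erase [] ∈ Finsupp.supported ℂ ℂ {l : List (ULift.{u} ι) | l ≠ []} := by
      intro l hl
      simp only [Finset.mem_coe, Finsupp.mem_support_iff] at hl
      intro h
      rw [h, Finsupp.erase_same] at hl
      exact hl rfl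
    rw [Finsupp.supported_eq_span_single] at h1
    refine (Submodule.span_le.2 ?_ : _ ≤ _) h1
    rintro _ ⟨l, hl, rfl⟩
    refine Submodule.mem_iSup_of_mem (wordWeight R lam l d) (Submodule.mem_iSup_of_mem ?_ ?_)
    · have h2 : (l.map fun j => R.root j.down).sum d = l.length := by
        clear hl
        induction l with
        | nil => simp
        | cons j l ih => simp [ih, hd, add_comm]
      rw [wordWeight, LinearMap.sub_apply, h2, Ne, sub_eq_self, Nat.cast_eq_zero,
        List.length_eq_zero_iff]
      exact hl
    · rw [Module.End.mem_eigenspace_iff, vermaH_single]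

theorem eq_top_of_nil_mem {N : Submodule ℂ (VermaSpace.{u} ι)}
    (hN : (verma R p lam).IsSubmodule N) (h0 : (Finsupp.single [] 1 : VermaSpace.{u} ι) ∈ N) :
    N = ⊤ := by
  have key : ∀ l, (Finsupp.single l 1 : VermaSpace.{u} ι) ∈ N := by
    intro l
    induction l with
    | nil => exact h0
    | cons j l ih =>
      have := hN.1 (preGen R p (Gen.Y j.down)) _ ih
      rw [verma_act_gen] at this
      change vermaY j.down _ ∈ N at this
      rwa [vermaY_single] at this
  rw [eq_top_iff]
  intro w _
  rw [← Finsupp.sum_single w]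
  refine Submodule.sum_mem _ fun l _ => ?_
  have := N.smul_mem (w l) (key l)
  rwa [Finsupp.smul_single, smul_eq_mul, mul_one] at this

variable (R p lam) in
/-- The maximal submodule of the Verma module. -/
noncomputable def vermaMax : Submodule ℂ (VermaSpace.{u} ι) :=
  ⨆ N ∈ {N | (verma R p lam).IsSubmodule N ∧ N ≤ LinearMap.ker (vermaCoeff ι)}, N

variable (R p lam) in
theorem isSubmodule_vermaMax : (verma R p lam).IsSubmodule (vermaMax R p lam) :=
  (verma R p lam).isSubmodule_iSup _ fun _ h => h.1

variable (R p lam) in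
theorem vermaMax_le : vermaMax R p lam ≤ LinearMap.ker (vermaCoeff ι) :=
  iSup₂_le fun _ h => h.2

theorem le_vermaMax {N : Submodule ℂ (VermaSpace.{u} ι)} (hN : (verma R p lam).IsSubmodule N)
    (h : N ≤ LinearMap.ker (vermaCoeff ι)) : N ≤ vermaMax R p lam :=
  le_iSup₂_of_le (f := fun (N : Submodule ℂ (VermaSpace.{u} ι)) _ => N) N ⟨hN, h⟩ le_rfl

/-- A submodule with a vector of non-zero top coefficient contains the generator and is everything.
Vanishing of the top coefficient survives sums, so there is a largest proper submodule. -/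
theorem le_vermaMax_of_ne_top {N : Submodule ℂ (VermaSpace.{u} ι)}
    (hN : (verma R p lam).IsSubmodule N) (h : N ≠ ⊤) : N ≤ vermaMax R p lam := by
  obtain ⟨d, hd⟩ := R.exists_grading fun _ => 1
  refine le_vermaMax hN fun w hw => ?_
  by_contra h0
  refine h (eq_top_of_nil_mem hN (nil_mem_of_vermaCoeff_ne_zero (lam := lam) hd (fun m hm => ?_) hw h0))
  have := hN.1 (preGen R p (Gen.H d)) m hm
  rwa [verma_act_gen] at this

theorem nil_notMem_vermaMax : (Finsupp.single [] 1 : VermaSpace.{u} ι) ∉ vermaMax R p lam :=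
  fun h => by simpa [vermaCoeff] using vermaMax_le R p lam h

/-- Induction on the word: moving `x` past the first letter leaves `[x, Y_j]`, again in the ideal,
on a shorter word, and a term starting with `Y_j`, which has no top coefficient. -/
theorem vermaCoeff_act_eq_zero (x : PreContragredient R p) (hx : x ∈ (maxIdeal R p).toSubmodule)
    (w : VermaSpace.{u} ι) : vermaCoeff ι ((verma R p lam).act x w) = 0 := by
  obtain ⟨d, hd⟩ := R.exists_grading fun _ => 1
  have key : ∀ l : List (ULift.{u} ι), ∀ x ∈ (maxIdeal R p).toSubmodule,
      vermaCoeff ι ((verma R p lam).act x (Finsupp.single l 1)) = 0 := by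
    intro l
    induction l with
    | nil =>
      intro x hx
      -- An element of height ν ≠ 0 changes the height of the empty word by ν; comparing top
      -- coefficients gives ν times the coefficient equal to 0.
      have hle : offCartan R p d ≤ LinearMap.ker ((vermaCoeff ι).comp
          ((verma R p lam).act.flip (Finsupp.single [] 1))) := by
        refine iSup₂_le fun ν hν x hx => ?_
        rw [Module.End.mem_eigenspace_iff] at hx
        have h1 := (verma R p lam).act_even (preH_mem d) x (Finsupp.single [] 1)
        rw [preH_apply, verma_act_gen, ← preH_apply, hx] at h1
        change vermaH R lam d _ = _ + (verma R p lam).act x (vermaH R lam d _) at h1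
        have h2 := congrArg (vermaCoeff ι) h1
        rw [vermaCoeff_vermaH, vermaH_single, map_add, map_smul, map_smul, map_smul,
          LinearMap.smul_apply, map_smul] at h2
        have h3 : wordWeight R lam ([] : List (ULift.{u} ι)) d = lam d := by simp [wordWeight]
        rw [h3, smul_eq_mul, smul_eq_mul] at h2
        exact (mul_eq_zero.1 (by linear_combination -h2 :
          ν * vermaCoeff ι ((verma R p lam).act x (Finsupp.single [] 1)) = 0)).resolve_left hν
      exact hle (maxIdeal_le_offCartan hd hx)
    | cons j l ih =>
      have hom : ∀ i, ∀ x ∈ part i, x ∈ (maxIdeal R p).toSubmodule →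
          vermaCoeff ι ((verma R p lam).act x (Finsupp.single (j :: l) 1)) = 0 := by
        intro i x hx hxI
        have h1 := (verma R p lam).act_bracket (Finsupp.single l 1) hx
          (preGen_mem (Gen.Y j.down))
        rw [verma_act_gen] at h1
        change _ = (verma R p lam).act x (vermaY j.down _) - _ • vermaY j.down _ at h1
        rw [vermaY_single, eq_sub_iff_add_eq] at h1
        have h2 := congrArg (vermaCoeff ι) h1
        rw [map_add, map_smul, vermaCoeff_vermaY,
          ih _ ((maxIdeal R p).bracket_right _ hxI)] at h2
        rw [← h2]; simp
      intro x hx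
      obtain ⟨a, ha, b, hb, rfl⟩ := exists_add_eq x
      obtain ⟨h1, h2⟩ := mem_of_add_mem (maxIdeal R p).graded ha hb hx
      rw [map_add, LinearMap.add_apply, map_add, hom 0 a ha h1, hom 1 b hb h2, add_zero]
  revert w
  refine LinearMap.congr_fun (f := (vermaCoeff ι).comp ((verma R p lam).act x)) (g := 0) ?_
  exact Finsupp.lhom_ext' fun l => LinearMap.ext_ring (key l x hx)

/-- The vectors x·w with x in the ideal span a graded submodule without top coefficient. Hence the
ideal acts by zero on the irreducible quotient, which becomes a module over 𝔤(A). -/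
theorem maxIdeal_act_mem (x : PreContragredient R p) (hx : x ∈ (maxIdeal R p).toSubmodule)
    (w : VermaSpace.{u} ι) : (verma R p lam).act x w ∈ vermaMax R p lam := by
  set M := verma.{u} R p lam
  let S : Set (VermaSpace.{u} ι) := {m | ∃ i j, ∃ x ∈ part i, x ∈ (maxIdeal R p).toSubmodule ∧
    ∃ w ∈ M.vpart j, m = M.act x w}
  have hact : ∀ x ∈ (maxIdeal R p).toSubmodule, ∀ w, M.act x w ∈ Submodule.span ℂ S := by
    intro x hx w
    obtain ⟨a, ha, b, hb, rfl⟩ := exists_add_eq x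
    obtain ⟨h1, h2⟩ := mem_of_add_mem (maxIdeal R p).graded ha hb hx
    obtain ⟨c, hc, d, hd, rfl⟩ := M.exists_add_eq w
    simp only [map_add, LinearMap.add_apply]
    refine Submodule.add_mem _ (Submodule.add_mem _ ?_ ?_) (Submodule.add_mem _ ?_ ?_) <;>
      refine Submodule.subset_span ?_
    · exact ⟨_, _, a, ha, h1, c, hc, rfl⟩
    · exact ⟨_, _, b, hb, h2, c, hc, rfl⟩
    · exact ⟨_, _, a, ha, h1, d, hd, rfl⟩
    · exact ⟨_, _, b, hb, h2, d, hd, rfl⟩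
  refine le_vermaMax (N := Submodule.span ℂ S) ⟨?_, ?_⟩ ?_ (hact x hx w)
  · refine homogeneous_induction (P := fun y => ∀ m ∈ Submodule.span ℂ S, M.act y m ∈
      Submodule.span ℂ S) (fun y z hy hz m hm => ?_) (fun k y hy m hm => ?_)
    · rw [map_add]; exact Submodule.add_mem _ (hy m hm) (hz m hm)
    · have hle : Submodule.span ℂ S ≤ (Submodule.span ℂ S).comap (M.act y) := by
        refine Submodule.span_le.2 ?_
        rintro _ ⟨i, j, x, hx, hxI, w, hw, rfl⟩
        change M.act y (M.act x w) ∈ Submodule.span ℂ S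
        have := M.act_bracket w hy hx
        rw [eq_sub_iff_add_eq] at this
        rw [← this]
        exact Submodule.add_mem _ (hact _ ((maxIdeal R p).bracket_left y hxI) _)
          (Submodule.smul_mem _ _ (hact x hxI _))
      exact hle hm
  · refine M.span_le_graded S ?_
    rintro _ ⟨i, j, x, hx, hxI, w, hw, rfl⟩
    exact ⟨_, M.act_mem hx hw⟩
  · refine Submodule.span_le.2 ?_
    rintro _ ⟨i, j, x, hx, hxI, w, hw, rfl⟩
    exact vermaCoeff_act_eq_zero x hxI w

variable (R p lam) in
/-- The irreducible highest weight module of highest weight `lam`. -/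
noncomputable def irreducibleModule :
    SuperModule (Contragredient R p) (VermaSpace.{u} ι ⧸ vermaMax R p lam) :=
  SuperModule.ofIdeal (maxIdeal R p)
    ((verma R p lam).quotient (vermaMax R p lam) (isSubmodule_vermaMax R p lam)) fun x hx => by
      refine LinearMap.ext fun m => ?_
      obtain ⟨m, rfl⟩ := Submodule.mkQ_surjective _ m
      exact (Submodule.Quotient.mk_eq_zero _).2 (maxIdeal_act_mem x hx m)

theorem irreducibleModule_act_mk (x : PreContragredient R p) (m : VermaSpace.{u} ι) :
    (irreducibleModule R p lam).act ((maxIdeal R p).toSubmodule.mkQ x)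
      ((vermaMax R p lam).mkQ m) = (vermaMax R p lam).mkQ ((verma R p lam).act x m) := rfl

theorem isSubmodule_comap_vermaMax {N : Submodule ℂ (VermaSpace.{u} ι ⧸ vermaMax R p lam)}
    (hN : (irreducibleModule R p lam).IsSubmodule N) :
    (verma R p lam).IsSubmodule (N.comap (vermaMax R p lam).mkQ) :=
  SuperModule.IsSubmodule.comap
    (M' := SuperModule.inflate (maxIdeal R p) (irreducibleModule R p lam))
    ⟨fun x m hm => hN.1 ((maxIdeal R p).toSubmodule.mkQ x) m hm, hN.2⟩ _ 0 (fun _ _ => rfl)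
    fun i m hm => by rw [add_zero]; exact ⟨m, hm, rfl⟩

theorem isIrreducible_irreducibleModule : (irreducibleModule.{u} R p lam).IsIrreducible := by
  refine ⟨⟨0, (vermaMax R p lam).mkQ (Finsupp.single [] 1), fun h => ?_⟩, fun N hN => ?_⟩
  · exact nil_notMem_vermaMax ((Submodule.Quotient.mk_eq_zero _).1 h.symm)
  · by_cases h : N.comap (vermaMax R p lam).mkQ = ⊤
    · refine Or.inr (eq_top_iff.2 fun m _ => ?_)
      obtain ⟨m, rfl⟩ := Submodule.mkQ_surjective _ m
      have : m ∈ N.comap (vermaMax R p lam).mkQ := by rw [h]; trivial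
      exact this
    · refine Or.inl (eq_bot_iff.2 fun m hm => ?_)
      obtain ⟨m, rfl⟩ := Submodule.mkQ_surjective _ m
      exact (Submodule.Quotient.mk_eq_zero _).2
        (le_vermaMax_of_ne_top (isSubmodule_comap_vermaMax hN) h hm)

theorem isHighestWeight_irreducibleModule :
    (irreducibleModule.{u} R p lam).IsHighestWeight lam := by
  refine ⟨(vermaMax R p lam).mkQ (Finsupp.single [] 1), fun h => ?_, ⟨_, _,
    single_mem_vermaPart p [], rfl⟩, fun i => ?_, fun h => ?_, fun N hN h0 => ?_⟩
  · exact nil_notMem_vermaMax ((Submodule.Quotient.mk_eq_zero _).1 h)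
  · rw [gen, irreducibleModule_act_mk, verma_act_gen]
    change (vermaMax R p lam).mkQ (vermaX R p lam i _) = 0
    rw [vermaX_single, vermaXWord, map_zero]
  · rw [gen, irreducibleModule_act_mk, verma_act_gen]
    change (vermaMax R p lam).mkQ (vermaH R lam h _) = _
    rw [vermaH_single, map_smul]
    simp [wordWeight]
  · rcases isIrreducible_irreducibleModule.2 N hN with rfl | h
    · exact absurd ((Submodule.Quotient.mk_eq_zero _).1 ((Submodule.mem_bot ℂ).1 h0))
        nil_notMem_vermaMax
    · exact h

/-! ### Uniqueness of the irreducible module of given highest weight. -/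

section Uniqueness

variable {V : Type v} [AddCommGroup V] [Module ℂ V] (M : SuperModule (Contragredient R p) V)

/-- The vector obtained by applying a word in the `Y_i`. -/
noncomputable def wordVector (m : V) : List (ULift.{u} ι) → V
  | [] => m
  | j :: l => M.act (gen R p (Gen.Y j.down)) (wordVector m l)

/-- The map from the Verma module to a highest weight module. -/
noncomputable def vermaMap (m : V) : VermaSpace.{u} ι →ₗ[ℂ] V :=
  Finsupp.linearCombination ℂ (wordVector M m)

theorem vermaMap_single (m : V) (l : List (ULift.{u} ι)) :
    vermaMap M m (Finsupp.single l 1) = wordVector M m l := by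
  simp [vermaMap]

theorem vermaMap_vermaY (m : V) (i : ι) (w : VermaSpace.{u} ι) :
    vermaMap M m (vermaY i w) = M.act (gen R p (Gen.Y i)) (vermaMap M m w) := by
  revert w
  refine LinearMap.congr_fun (f := (vermaMap M m).comp (vermaY i))
    (g := (M.act (gen R p (Gen.Y i))).comp (vermaMap M m)) ?_
  refine Finsupp.lhom_ext' fun l => LinearMap.ext_ring ?_
  change vermaMap M m (vermaY i (Finsupp.single l 1)) =
    M.act (gen R p (Gen.Y i)) (vermaMap M m (Finsupp.single l 1))
  rw [vermaY_single, vermaMap_single, vermaMap_single]; rfl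

theorem gen_mk_bracket (x y : PreContragredient R p) :
    (maxIdeal R p).toSubmodule.mkQ (bracket x y) =
      bracket ((maxIdeal R p).toSubmodule.mkQ x) ((maxIdeal R p).toSubmodule.mkQ y) := rfl

theorem gen_HY (h : 𝔥) (i : ι) : bracket (genH R p h) (gen R p (Gen.Y i)) =
    -(R.root i h • gen R p (Gen.Y i)) := by
  have := congrArg (maxIdeal R p).toSubmodule.mkQ (pre_HY (R := R) (p := p) h i)
  rwa [map_neg, map_smul] at this

theorem gen_HX (h : 𝔥) (i : ι) : bracket (genH R p h) (gen R p (Gen.X i)) =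
    R.root i h • gen R p (Gen.X i) := by
  have := congrArg (maxIdeal R p).toSubmodule.mkQ (pre_HX (R := R) (p := p) h i)
  rwa [map_smul] at this

theorem gen_HH (h h' : 𝔥) : bracket (genH R p h) (genH R p h') = 0 := by
  have := congrArg (maxIdeal R p).toSubmodule.mkQ (pre_HH (R := R) (p := p) h h')
  rwa [map_zero] at this

theorem gen_XY (i j : ι) : bracket (gen R p (Gen.X i)) (gen R p (Gen.Y j)) =
    if i = j then genH R p (R.coroot i) else 0 := by
  have := congrArg (maxIdeal R p).toSubmodule.mkQ (pre_XY (R := R) (p := p) i j)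
  rw [gen_mk_bracket] at this
  rw [gen, gen, this]
  split_ifs
  · rfl
  · rw [map_zero]

theorem genH_mem (h : 𝔥) : genH R p h ∈ part (L := Contragredient R p) 0 := gen_mem (Gen.H h)

variable {M}

theorem act_wordVector_cartan {m : V} (hm : ∀ h, M.act (gen R p (Gen.H h)) m = lam h • m) (h : 𝔥)
    (l : List (ULift.{u} ι)) : M.act (gen R p (Gen.H h)) (wordVector M m l) =
      wordWeight R lam l h • wordVector M m l := by
  induction l with
  | nil => simp [wordVector, hm, wordWeight]
  | cons j l ih =>
    have := M.act_even (genH_mem h) (gen R p (Gen.Y j.down)) (wordVector M m l)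
    rw [gen_HY] at this
    change M.act (gen R p (Gen.H h)) _ = _ + M.act _ (M.act (gen R p (Gen.H h)) _) at this
    rw [wordVector, this, ih, wordWeight_cons, map_neg, map_smul, map_smul, LinearMap.neg_apply,
      LinearMap.smul_apply, LinearMap.sub_apply]
    module

/-- It is enough to compare generators on words. For `X_i` an induction on the word reproduces the
recursion that defines `vermaXWord`. -/
theorem vermaMap_act {m : V} (hX : ∀ i, M.act (gen R p (Gen.X i)) m = 0)
    (hm : ∀ h, M.act (gen R p (Gen.H h)) m = lam h • m) (x : PreContragredient R p)
    (w : VermaSpace.{u} ι) : vermaMap M m ((verma R p lam).act x w) =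
      M.act ((maxIdeal R p).toSubmodule.mkQ x) (vermaMap M m w) := by
  refine SuperModule.map_act_of_pre (verma R p lam) (M.inflate (maxIdeal R p)) _ (fun g => ?_) x w
  refine LinearMap.congr_fun (f := (vermaMap M m).comp ((verma R p lam).act (preGen R p g)))
    (g := (M.act (gen R p g)).comp (vermaMap M m)) ?_
  refine Finsupp.lhom_ext' fun l => LinearMap.ext_ring ?_
  change vermaMap M m ((verma R p lam).act (preGen R p g) (Finsupp.single l 1)) =
    M.act (gen R p g) (vermaMap M m (Finsupp.single l 1))
  rw [verma_act_gen, vermaMap_single]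
  rcases g with i | i | h
  · change vermaMap M m (vermaX R p lam i _) = _
    rw [vermaX_single]
    induction l with
    | nil => rw [vermaXWord, map_zero, wordVector, hX]
    | cons j l ih =>
      have := M.act_bracket (wordVector M m l) (gen_mem (R := R) (p := p) (Gen.X i))
        (gen_mem (Gen.Y j.down))
      rw [eq_sub_iff_add_eq, gen_XY] at this
      rw [vermaXWord, map_add, map_smul, vermaMap_vermaY, ih, wordVector, ← this]
      congr 1
      split_ifs
      · rw [map_smul, vermaMap_single]
        exact (act_wordVector_cartan hm _ l).symm
      · simp
  · change vermaMap M m (vermaY i _) = _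
    rw [vermaY_single, vermaMap_single]; rfl
  · change vermaMap M m (vermaH R lam h _) = _
    rw [vermaH_single, map_smul, vermaMap_single, act_wordVector_cartan hm]

theorem vermaMap_mem {m : V} {d : ZMod 2} (hd : m ∈ M.vpart d) (i : ZMod 2) :
    ∀ w ∈ vermaPart.{u} p i, vermaMap M m w ∈ M.vpart (i + d) := by
  have key : ∀ l : List (ULift.{u} ι), wordVector M m l ∈ M.vpart (listParity p l + d) := by
    intro l
    induction l with
    | nil => simpa [listParity, wordVector] using hd
    | cons j l ih =>
      rw [listParity_cons, add_assoc]
      exact M.act_mem (gen_mem (Gen.Y j.down)) ih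
  have hle : vermaPart.{u} p i ≤ (M.vpart (i + d)).comap (vermaMap M m) := by
    rw [vermaPart, Finsupp.supported_eq_span_single]
    refine Submodule.span_le.2 ?_
    rintro _ ⟨l, rfl, rfl⟩
    change vermaMap M m _ ∈ M.vpart _
    rw [vermaMap_single]; exact key l
  exact hle

/-- The Verma module maps onto `M`. The kernel is proper, hence inside the largest proper submodule,
and irreducibility of `M` forces equality. The parity shift is the parity `d` of the chosen vector.
-/
theorem isIsomorphic_irreducibleModule (hirr : M.IsIrreducible) (hM : M.IsHighestWeight lam) :
    M.IsIsomorphic (irreducibleModule.{u} R p lam) := by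
  obtain ⟨m, hm0, ⟨d, hd⟩, hX, hH, hgen⟩ := hM
  set φ := vermaMap.{u} M m
  have hφ : ∀ x w, φ ((verma R p lam).act x w) = (M.inflate (maxIdeal R p)).act x (φ w) :=
    vermaMap_act hX hH
  have hp := vermaMap_mem.{u} (M := M) hd
  have hsub : ∀ N, (M.inflate (maxIdeal R p)).IsSubmodule N ↔ M.IsSubmodule N := fun N =>
    ⟨fun h => ⟨fun x => by obtain ⟨x, rfl⟩ := Submodule.mkQ_surjective _ x; exact h.1 x, h.2⟩,
      fun h => ⟨fun x => h.1 _, h.2⟩⟩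
  have hnil : φ (Finsupp.single [] 1) = m := vermaMap_single M m []
  have hsurj : Function.Surjective φ := by
    rw [← LinearMap.range_eq_top]
    refine hgen _ ((hsub _).1 ?_) ⟨_, hnil⟩
    rw [LinearMap.range_eq_map]
    exact (verma R p lam).isSubmodule_top.map φ d hφ hp
  have hker : LinearMap.ker φ = vermaMax R p lam := by
    refine le_antisymm ?_ ?_
    · refine le_vermaMax_of_ne_top ?_ fun h => hm0 ?_
      · exact (M.inflate (maxIdeal R p)).isSubmodule_bot.comap φ d hφ hp
      · rw [← hnil]
        exact LinearMap.mem_ker.1 (h ▸ trivial)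
    · rcases hirr.2 _ ((hsub _).1 ((isSubmodule_vermaMax R p lam).map φ d hφ hp)) with h | h
      · exact LinearMap.le_ker_iff_map.2 h
      -- If the largest proper submodule mapped onto `M`, the generator would differ from one of its
      -- elements by a kernel element, hence would lie in it.
      · exfalso
        obtain ⟨w, hw, hwm⟩ : m ∈ (vermaMax R p lam).map φ := by rw [h]; trivial
        have h1 : Finsupp.single [] 1 - w ∈ LinearMap.ker φ := by
          rw [LinearMap.mem_ker, map_sub, hnil, hwm, sub_self]
        have h2 : LinearMap.ker φ ≤ vermaMax R p lam := by
          refine le_vermaMax_of_ne_top ?_ fun h => hm0 ?_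
          · exact (M.inflate (maxIdeal R p)).isSubmodule_bot.comap φ d hφ hp
          · rw [← hnil]
            exact LinearMap.mem_ker.1 (h ▸ trivial)
        exact nil_notMem_vermaMax ((Submodule.sub_mem_iff_left _ hw).1 (h2 h1))
  refine SuperModule.IsIsomorphic.symm ⟨(Submodule.quotEquivOfEq _ _ hker.symm).trans
    (φ.quotKerEquivOfSurjective hsurj), fun x w => ?_, d, ?_⟩
  · obtain ⟨x, rfl⟩ := Submodule.mkQ_surjective _ x
    obtain ⟨w, rfl⟩ := Submodule.mkQ_surjective _ w
    exact hφ x w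
  · rintro i _ ⟨w, hw, rfl⟩
    exact hp i w hw

end Uniqueness

end Verma

/-! ### Lie superalgebras with odd Chevalley generators -/

/-- Odd Chevalley generators of a Lie superalgebra without ideals that avoid the Cartan
subalgebra. -/
structure OddChevalley (L : Type u) [AddCommGroup L] [Module ℂ L] [Superalgebra L]
    (ι : Type) (𝔥 : Type v) [AddCommGroup 𝔥] [Module ℂ 𝔥] where
  X : ι → L
  Y : ι → L
  H : 𝔥 →ₗ[ℂ] L
  root : ι → Module.Dual ℂ 𝔥
  coroot : ι → 𝔥
  deg : 𝔥
  root_deg : ∀ i, root i deg = 1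
  X_mem : ∀ i, X i ∈ part (L := L) 1
  Y_mem : ∀ i, Y i ∈ part (L := L) 1
  H_mem : ∀ h, H h ∈ part (L := L) 0
  HH : ∀ h h', bracket (H h) (H h') = 0
  HX : ∀ h i, bracket (H h) (X i) = root i h • X i
  HY : ∀ h i, bracket (H h) (Y i) = -(root i h • Y i)
  XY_same : ∀ i, bracket (X i) (Y i) = H (coroot i)
  XY_ne : ∀ i j, i ≠ j → bracket (X i) (Y j) = 0
  induction : ∀ {P : L → Prop}, (∀ i, P (X i)) → (∀ i, P (Y i)) → (∀ h, P (H h)) →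
    (∀ i j, ∀ x ∈ part (L := L) i, ∀ y ∈ part (L := L) j, P x → P y → P (bracket x y)) →
    P 0 → (∀ x y, P x → P y → P (x + y)) → (∀ (c : ℂ) x, P x → P (c • x)) → ∀ x, P x
  ideal_eq_bot : ∀ J : SuperIdeal L,
    J.toSubmodule ≤ ⨆ ν, ⨆ (_ : ν ≠ 0), Module.End.eigenspace (bracket (H deg)) ν →
      J.toSubmodule = ⊥

namespace OddChevalley

variable {L : Type u} [AddCommGroup L] [Module ℂ L] [Superalgebra L]
  {ι : Type} {𝔥 : Type v} [AddCommGroup 𝔥] [Module ℂ 𝔥] (S : OddChevalley L ι 𝔥)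
  {V : Type w} [AddCommGroup V] [Module ℂ V]

/-- The Chevalley generators with positive and negative roots exchanged. -/
def swap [IsLieSuperalgebra L] : OddChevalley L ι 𝔥 where
  X := S.Y
  -- The sign, together with the sign on coroots, leaves every Cartan entry unchanged, since roots
  -- are negated as well.
  Y := -S.X
  H := S.H
  root := -S.root
  coroot := -S.coroot
  deg := -S.deg
  root_deg i := by simp [S.root_deg]
  X_mem := S.Y_mem
  Y_mem i := Submodule.neg_mem _ (S.X_mem i)
  H_mem := S.H_mem
  HH := S.HH
  HX h i := by simp [S.HY]
  HY h i := by simp [S.HX]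
  XY_same i := by
    rw [Pi.neg_apply, map_neg, ← bracket_comm_odd (S.X_mem i) (S.Y_mem i), S.XY_same, ← map_neg]
    rfl
  XY_ne i j hij := by
    rw [Pi.neg_apply, map_neg, ← bracket_comm_odd (S.X_mem j) (S.Y_mem i), S.XY_ne _ _ hij.symm,
      neg_zero]
  induction := by
    intro P hX hY hH hbr h0 hadd hsmul x
    refine S.induction (fun i => ?_) hX hH hbr h0 hadd hsmul x
    have := hsmul (-1) _ (hY i)
    rwa [Pi.neg_apply, neg_one_smul, neg_neg] at this
  ideal_eq_bot J hJ := by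
    refine S.ideal_eq_bot J (hJ.trans (iSup₂_le fun ν hν => ?_))
    refine le_iSup₂_of_le (f := fun ν (_ : ν ≠ 0) =>
      Module.End.eigenspace (bracket (S.H S.deg)) ν) (-ν) (neg_ne_zero.2 hν) fun x hx => ?_
    rw [Module.End.mem_eigenspace_iff] at hx ⊢
    rw [map_neg, map_neg, LinearMap.neg_apply] at hx
    rw [neg_smul, ← hx, neg_neg]

theorem act_mem (M : SuperModule L V) {N : Submodule ℂ V}
    (hX : ∀ i, ∀ m ∈ N, M.act (S.X i) m ∈ N) (hY : ∀ i, ∀ m ∈ N, M.act (S.Y i) m ∈ N)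
    (hH : ∀ h, ∀ m ∈ N, M.act (S.H h) m ∈ N) (x : L) : ∀ m ∈ N, M.act x m ∈ N := by
  refine S.induction (P := fun x => ∀ m ∈ N, M.act x m ∈ N) hX hY hH
    (fun i j x hx y hy h1 h2 m hm => ?_)
    (by simp) (fun x y h1 h2 m hm => ?_) (fun c x h m hm => ?_) x
  · rw [M.act_bracket m hx hy]
    exact N.sub_mem (h1 _ (h2 _ hm)) (N.smul_mem _ (h2 _ (h1 _ hm)))
  · rw [map_add]; exact N.add_mem (h1 _ hm) (h2 _ hm)
  · rw [map_smul]; exact N.smul_mem _ (h _ hm)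

theorem act_H_X (M : SuperModule L V) (h : 𝔥) (i : ι) (m : V) : M.act (S.H h) (M.act (S.X i) m) =
    M.act (S.X i) (M.act (S.H h) m) + S.root i h • M.act (S.X i) m := by
  rw [M.act_even (S.H_mem h), S.HX, map_smul, LinearMap.smul_apply, add_comm]

theorem act_H_Y (M : SuperModule L V) (h : 𝔥) (i : ι) (m : V) : M.act (S.H h) (M.act (S.Y i) m) =
    M.act (S.Y i) (M.act (S.H h) m) - S.root i h • M.act (S.Y i) m := by
  rw [M.act_even (S.H_mem h), S.HY, map_neg, map_smul, LinearMap.neg_apply, LinearMap.smul_apply]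
  abel

theorem act_H_H (M : SuperModule L V) (h h' : 𝔥) (m : V) :
    M.act (S.H h) (M.act (S.H h') m) = M.act (S.H h') (M.act (S.H h) m) := by
  rw [M.act_even (S.H_mem h), S.HH, map_zero, LinearMap.zero_apply, zero_add]

open Classical in
theorem act_X_Y (M : SuperModule L V) (i j : ι) (m : V) : M.act (S.X i) (M.act (S.Y j) m) =
    (if i = j then M.act (S.H (S.coroot i)) m else 0) - M.act (S.Y j) (M.act (S.X i) m) := by
  rw [M.act_odd (S.X_mem i) (S.Y_mem j)]
  congr 1
  split_ifs with h
  · subst h; rw [S.XY_same]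
  · rw [S.XY_ne i j h]; simp

/-- The vectors obtained from `u` by applying elements `Y_i` and elements of `𝔥`. -/
inductive Descendant (M : SuperModule L V) (u : V) : V → Prop
  | base : Descendant M u u
  | lower (i : ι) {m : V} (hm : Descendant M u m) : Descendant M u (M.act (S.Y i) m)
  | cartan (h : 𝔥) {m : V} (hm : Descendant M u m) : Descendant M u (M.act (S.H h) m)

/-- The submodule generated by a singular vector lies in the sum of the eigenspaces below. -/
theorem exists_isSubmodule (M : SuperModule L V) {j : ZMod 2} {u : V} (hu : u ∈ M.vpart j)
    (hX : ∀ i, M.act (S.X i) u = 0) {d : 𝔥} (hd : ∀ i, ∃ k : ℕ, S.root i d = k) {κ : ℂ}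
    (hκ : M.act (S.H d) u = κ • u) :
    ∃ N, M.IsSubmodule N ∧ u ∈ N ∧
      N ≤ ⨆ ν ∈ {ν : ℂ | ∃ n : ℕ, ν = κ - n}, Module.End.eigenspace (M.act (S.H d)) ν := by
  set N := Submodule.span ℂ {m | S.Descendant M u m} with hN
  have hY : ∀ i, ∀ m ∈ N, M.act (S.Y i) m ∈ N := fun i => by
    refine (Submodule.span_le.2 fun m hm => ?_ : N ≤ N.comap (M.act (S.Y i)))
    exact Submodule.subset_span (Descendant.lower i hm)
  have hH : ∀ h, ∀ m ∈ N, M.act (S.H h) m ∈ N := fun h => by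
    refine (Submodule.span_le.2 fun m hm => ?_ : N ≤ N.comap (M.act (S.H h)))
    exact Submodule.subset_span (Descendant.cartan h hm)
  have hX' : ∀ i, ∀ m ∈ N, M.act (S.X i) m ∈ N := fun i => by
    refine (Submodule.span_le.2 fun m hm => ?_ : N ≤ N.comap (M.act (S.X i)))
    change M.act (S.X i) m ∈ N
    induction hm with
    | base => rw [hX]; exact N.zero_mem
    | @lower k m hm ih =>
      rw [S.act_X_Y]
      refine N.sub_mem ?_ (hY _ _ ih)
      split_ifs
      · exact hH _ _ (Submodule.subset_span hm)
      · exact N.zero_mem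
    | @cartan h m hm ih =>
      have := S.act_H_X M h i m
      rw [← sub_eq_iff_eq_add] at this
      rw [← this]
      exact N.sub_mem (hH _ _ ih) (N.smul_mem _ ih)
  refine ⟨N, ⟨S.act_mem M hX' hY hH, M.span_le_graded _ fun m hm => ?_⟩,
    Submodule.subset_span Descendant.base, Submodule.span_le.2 fun m hm => ?_⟩
  · induction hm with
    | base => exact ⟨j, hu⟩
    | lower i _ ih => obtain ⟨k, hk⟩ := ih; exact ⟨_, M.act_mem (S.Y_mem i) hk⟩
    | cartan h _ ih => obtain ⟨k, hk⟩ := ih; exact ⟨_, M.act_mem (S.H_mem h) hk⟩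
  · have : ∃ n : ℕ, M.act (S.H d) m = (κ - n) • m := by
      induction hm with
      | base => exact ⟨0, by simpa using hκ⟩
      | lower i _ ih =>
        obtain ⟨n, hn⟩ := ih
        obtain ⟨k, hk⟩ := hd i
        refine ⟨n + k, ?_⟩
        rw [act_H_Y, hn, hk, map_smul]
        push_cast; module
      | cartan h _ ih =>
        obtain ⟨n, hn⟩ := ih
        exact ⟨n, by rw [act_H_H, hn, map_smul]⟩
    obtain ⟨n, hn⟩ := this
    exact (le_iSup₂_of_le (f := fun ν (_ : ν ∈ {ν : ℂ | ∃ n : ℕ, ν = κ - n}) =>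
      Module.End.eigenspace (M.act (S.H d)) ν) (κ - n) ⟨n, rfl⟩ le_rfl)
      (Module.End.mem_eigenspace_iff.2 hn)

/-- There are no singular vectors whose degree lies in `K`. -/
def SingularFree (M : SuperModule L V) (K : Set ℂ) : Prop :=
  ∀ κ ∈ K, ∀ i, ∀ u ∈ M.vpart i, M.act (S.H S.deg) u = κ • u → (∀ l, M.act (S.X l) u = 0) → u = 0

theorem root_deg_nat (i : ι) : ∃ k : ℕ, S.root i S.deg = k := ⟨1, by rw [S.root_deg]; simp⟩

/-- A singular vector of negative degree generates an ideal living in negative degrees only; such an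
ideal avoids 𝔥 and vanishes. Applied to `swap` it kills the vectors of positive degree that commute
with all `Y_i`. -/
theorem singularFree_adjoint [IsLieSuperalgebra L] :
    S.SingularFree (SuperModule.adjoint L) {κ | ∃ n : ℕ, κ = -(n + 1)} := by
  rintro _ ⟨k, rfl⟩ i u hu hκ hX
  obtain ⟨N, hN, huN, hle⟩ := S.exists_isSubmodule _ hu hX S.root_deg_nat hκ
  have h1 : (SuperIdeal.ofSubmodule N hN).toSubmodule = ⊥ := by
    refine S.ideal_eq_bot _ (hle.trans (iSup₂_le ?_))
    rintro _ ⟨n, rfl⟩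
    refine le_iSup₂_of_le (f := fun ν (_ : ν ≠ 0) =>
      Module.End.eigenspace (bracket (S.H S.deg)) ν) (-(k + 1) - n : ℂ) ?_ le_rfl
    intro h
    have : ((k + 1 + n : ℕ) : ℂ) = 0 := by push_cast; linear_combination -h
    exact absurd (Nat.cast_eq_zero.1 this) (by omega)
  have h2 : u ∈ (SuperIdeal.ofSubmodule N hN).toSubmodule := huN
  rw [h1] at h2
  exact (Submodule.mem_bot ℂ).1 h2

/-- A highest weight vector: non-zero, homogeneous, killed by all `X_i`. -/
structure IsHighestVector (M : SuperModule L V) (lam : Module.Dual ℂ 𝔥) (m : V) : Prop where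
  ne_zero : m ≠ 0
  homogeneous : ∃ i, m ∈ M.vpart i
  act_X : ∀ i, M.act (S.X i) m = 0
  act_H : ∀ h, M.act (S.H h) m = lam h • m

variable {S} {M : SuperModule L V} {lam : Module.Dual ℂ 𝔥} {m : V}

/-- The submodule generated by the highest weight vector is everything. Any `d` with natural values
on the simple roots is allowed: besides the height, another choice is needed to compare a weight
with its negative. -/
theorem IsHighestVector.iSup_eigenspace_eq_top (hirr : M.IsIrreducible)
    (hm : S.IsHighestVector M lam m) {d : 𝔥} (hd : ∀ i, ∃ k : ℕ, S.root i d = k) :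
    ⨆ ν ∈ {ν : ℂ | ∃ n : ℕ, ν = lam d - n}, Module.End.eigenspace (M.act (S.H d)) ν = ⊤ := by
  obtain ⟨i, hi⟩ := hm.homogeneous
  obtain ⟨N, hN, hmN, hle⟩ := S.exists_isSubmodule M hi hm.act_X hd (hm.act_H d)
  rcases hirr.2 N hN with rfl | rfl
  · exact absurd ((Submodule.mem_bot ℂ).1 hmN) hm.ne_zero
  · exact top_le_iff.1 hle

theorem IsHighestVector.eigenvalue (hirr : M.IsIrreducible)
    (hm : S.IsHighestVector M lam m) {d : 𝔥} (hd : ∀ i, ∃ k : ℕ, S.root i d = k) {u : V}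
    (hu : u ≠ 0) {κ : ℂ} (hκ : M.act (S.H d) u = κ • u) : ∃ n : ℕ, κ = lam d - n :=
  eigenvalue_mem_of_mem_iSup _ _ hu hκ (by rw [hm.iSup_eigenspace_eq_top hirr hd]; trivial)

/-- A non-zero singular vector would generate the module, so the top degree would be at most its own
degree; but its degree is at most the top one, so the two agree. -/
theorem IsHighestVector.singularFree (hirr : M.IsIrreducible) (hm : S.IsHighestVector M lam m) :
    S.SingularFree M {κ | κ ≠ lam S.deg} := by
  intro κ hκ0 i u hu hκ hX
  by_contra hu0
  obtain ⟨N, hN, huN, hle⟩ := S.exists_isSubmodule M hu hX S.root_deg_nat hκ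
  rcases hirr.2 N hN with rfl | rfl
  · exact hu0 ((Submodule.mem_bot ℂ).1 huN)
  · obtain ⟨n, hn⟩ := eigenvalue_mem_of_mem_iSup _ _ hm.ne_zero (hm.act_H S.deg) (hle trivial)
    obtain ⟨k, hk⟩ := hm.eigenvalue hirr S.root_deg_nat hu0 hκ
    have h1 : ((n + k : ℕ) : ℂ) = 0 := by push_cast; linear_combination hn + hk
    have h2 : k = 0 := by have := Nat.cast_eq_zero.1 h1; omega
    rw [h2] at hk
    exact hκ0 (by simpa using hk)

/-- Elements of positive degree act locally nilpotently on highest weight modules. -/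
theorem IsHighestVector.exists_pow_eq_zero (hirr : M.IsIrreducible)
    (hm : S.IsHighestVector M lam m) {x : L} {k : ℕ} (hk : k ≠ 0)
    (hx : bracket (S.H S.deg) x = (k : ℂ) • x) (u : V) : ∃ n : ℕ, ((M.act x) ^ n) u = 0 := by
  have hu : u ∈ ⨆ ν ∈ {ν : ℂ | ∃ n : ℕ, ν = lam S.deg - n},
      Module.End.eigenspace (M.act (S.H S.deg)) ν := by
    rw [hm.iSup_eigenspace_eq_top hirr S.root_deg_nat]; trivial
  have key : ∀ n : ℕ, ∀ u, M.act (S.H S.deg) u = (lam S.deg - n) • u →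
      ((M.act x) ^ (n + 1)) u = 0 := by
    intro n u hu
    by_contra h0
    have h1 : ∀ j : ℕ, M.act (S.H S.deg) (((M.act x) ^ j) u) =
        (lam S.deg - n + j * k) • ((M.act x) ^ j) u := by
      intro j
      induction j with
      | zero => simpa using hu
      | succ j ih =>
        rw [pow_succ', Module.End.mul_apply, M.act_even (S.H_mem _), hx, ih, map_smul, map_smul,
          LinearMap.smul_apply]
        push_cast; module
    -- After n + 1 steps from depth n the degree would exceed the top degree.
    obtain ⟨q, hq⟩ := hm.eigenvalue hirr S.root_deg_nat h0 (h1 (n + 1))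
    have h2 : (((n + 1) * k + q : ℕ) : ℂ) = (n : ℕ) := by push_cast at hq ⊢; linear_combination hq
    have h3 := Nat.cast_injective h2
    have : n + 1 ≤ (n + 1) * k := Nat.le_mul_of_pos_right _ (Nat.pos_of_ne_zero hk)
    omega
  induction hu using Submodule.iSup_induction' with
  | mem ν u hu =>
    by_cases h : ν ∈ {ν : ℂ | ∃ n : ℕ, ν = lam S.deg - n}
    · simp only [h, iSup_pos] at hu
      obtain ⟨n, rfl⟩ := h
      exact ⟨n + 1, key n u (Module.End.mem_eigenspace_iff.1 hu)⟩
    · simp only [h, iSup_neg, not_false_eq_true, Submodule.mem_bot] at hu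
      exact ⟨0, by simpa using hu⟩
  | zero => exact ⟨0, by simp⟩
  | add a b _ _ ha hb =>
    obtain ⟨n, hn⟩ := ha
    obtain ⟨n', hn'⟩ := hb
    refine ⟨n + n', ?_⟩
    rw [map_add]
    nth_rw 1 [add_comm n n']
    rw [pow_add, Module.End.mul_apply, hn, pow_add, Module.End.mul_apply, hn', map_zero, map_zero,
      add_zero]

end OddChevalley

section Contragredient

variable {ι : Type} [Fintype ι] [DecidableEq ι] {𝔥 : Type u} [AddCommGroup 𝔥] [Module ℂ 𝔥]
  {A : Matrix ι ι ℂ} (R : Realization A 𝔥)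

/-- The Chevalley generators of a contragredient Lie superalgebra with odd simple roots. -/
noncomputable def chevalley : OddChevalley (Contragredient R fun _ => 1) ι 𝔥 where
  X i := gen R _ (Gen.X i)
  Y i := gen R _ (Gen.Y i)
  H := genH R _
  root := R.root
  coroot := R.coroot
  deg := (R.exists_grading fun _ => 1).choose
  root_deg := (R.exists_grading fun _ => 1).choose_spec
  X_mem i := gen_mem (Gen.X i)
  Y_mem i := gen_mem (Gen.Y i)
  H_mem := genH_mem
  HH := gen_HH
  HX := gen_HX
  HY := gen_HY
  XY_same i := by rw [gen_XY, if_pos rfl]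
  XY_ne i j h := by rw [gen_XY, if_neg h]
  induction := by
    intro P hX hY hH hbr h0 hadd hsmul
    exact contragredient_induction (by rintro (i | i | h); exacts [hX i, hY i, hH h]) hbr h0 hadd
      hsmul
  ideal_eq_bot J := contragredient_ideal_eq_bot _ J (R.exists_grading fun _ => 1).choose_spec

end Contragredient

/-! ### Exponentials of locally nilpotent operators -/

section Exp

variable {U V W : Type*} [AddCommGroup U] [Module ℂ U] [AddCommGroup V] [Module ℂ V]
  [AddCommGroup W] [Module ℂ W]

/-- Every vector is killed by a power of the operator. -/
def LocallyNilpotent (D : Module.End ℂ V) : Prop := ∀ v, ∃ n : ℕ, (D ^ n) v = 0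

theorem pow_apply_eq_zero_of_le {D : Module.End ℂ V} {v : V} {n k : ℕ} (h : (D ^ n) v = 0)
    (hnk : n ≤ k) : (D ^ k) v = 0 := by
  obtain ⟨j, rfl⟩ := Nat.exists_eq_add_of_le hnk
  rw [add_comm, pow_add, Module.End.mul_apply, h, map_zero]

theorem LocallyNilpotent.neg {D : Module.End ℂ V} (h : LocallyNilpotent D) :
    LocallyNilpotent (-D) := fun v => by
  obtain ⟨n, hn⟩ := h v
  refine ⟨n, ?_⟩
  rw [neg_pow, ← neg_one_smul ℂ (1 : Module.End ℂ V), smul_pow, one_pow, smul_one_mul,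
    LinearMap.smul_apply, hn, smul_zero]

theorem LocallyNilpotent.smul {D : Module.End ℂ V} (h : LocallyNilpotent D) (c : ℂ) :
    LocallyNilpotent (c • D) := fun v => by
  obtain ⟨n, hn⟩ := h v
  exact ⟨n, by rw [smul_pow, LinearMap.smul_apply, hn, smul_zero]⟩

theorem sum_range_eq_of_pow_eq_zero {D : Module.End ℂ V} {v : V} {n k : ℕ} (h : (D ^ n) v = 0)
    (hnk : n ≤ k) : ∑ i ∈ Finset.range k, (i.factorial : ℂ)⁻¹ • (D ^ i) v =
      ∑ i ∈ Finset.range n, (i.factorial : ℂ)⁻¹ • (D ^ i) v := by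
  refine (Finset.sum_subset (Finset.range_mono hnk) fun i _ hi => ?_).symm
  rw [pow_apply_eq_zero_of_le h (by simpa using hi), smul_zero]

/-- The exponential of a locally nilpotent operator. -/
noncomputable def locExp (D : Module.End ℂ V) (hD : LocallyNilpotent D) : Module.End ℂ V where
  toFun v := ∑ i ∈ Finset.range (hD v).choose, (i.factorial : ℂ)⁻¹ • (D ^ i) v
  map_add' v w := by
    set n := (hD v).choose + (hD w).choose + (hD (v + w)).choose
    rw [← sum_range_eq_of_pow_eq_zero (hD v).choose_spec (k := n) (by omega),
      ← sum_range_eq_of_pow_eq_zero (hD w).choose_spec (k := n) (by omega),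
      ← sum_range_eq_of_pow_eq_zero (hD (v + w)).choose_spec (k := n) (by omega),
      ← Finset.sum_add_distrib]
    simp
  map_smul' c v := by
    set n := (hD v).choose + (hD (c • v)).choose
    rw [← sum_range_eq_of_pow_eq_zero (hD v).choose_spec (k := n) (by omega),
      ← sum_range_eq_of_pow_eq_zero (hD (c • v)).choose_spec (k := n) (by omega),
      Finset.smul_sum]
    simp only [map_smul, smul_comm c, RingHom.id_apply]

theorem locExp_apply {D : Module.End ℂ V} (hD : LocallyNilpotent D) {v : V} {n : ℕ}
    (h : (D ^ n) v = 0) :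
    locExp D hD v = ∑ i ∈ Finset.range n, (i.factorial : ℂ)⁻¹ • (D ^ i) v := by
  rw [← sum_range_eq_of_pow_eq_zero h (k := n + (hD v).choose) (by omega),
    sum_range_eq_of_pow_eq_zero (hD v).choose_spec (by omega)]
  rfl

/-- Truncated Cauchy product: the rectangle fits into the triangle i + j < p + q, and `F` vanishes
on the rest of the triangle. -/
theorem sum_antidiagonal_eq {F : ℕ × ℕ → W} {p q : ℕ} (h1 : ∀ i j, p ≤ i → F (i, j) = 0)
    (h2 : ∀ i j, q ≤ j → F (i, j) = 0) :
    ∑ n ∈ Finset.range (p + q), ∑ x ∈ Finset.HasAntidiagonal.antidiagonal n, F x =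
      ∑ i ∈ Finset.range p, ∑ j ∈ Finset.range q, F (i, j) := by
  rw [← Finset.sum_product' (f := fun i j => F (i, j)), Finset.sum_sigma']
  symm
  refine Finset.sum_of_injOn (fun x => ⟨x.1 + x.2, x⟩) ?_ ?_ ?_ ?_
  · rintro ⟨a, b⟩ _ ⟨c, d⟩ _ h
    simp only [Sigma.mk.injEq] at h
    exact eq_of_heq h.2
  · rintro ⟨a, b⟩ h
    simp only [Finset.coe_product, Set.mem_prod, Finset.mem_coe, Finset.mem_range] at h
    simp only [Finset.coe_sigma, Set.mem_sigma_iff, Finset.mem_coe, Finset.mem_range,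
      Finset.HasAntidiagonal.mem_antidiagonal, and_true]
    omega
  · rintro ⟨n, a, b⟩ h hn
    simp only [Finset.mem_sigma, Finset.HasAntidiagonal.mem_antidiagonal] at h
    by_cases ha : p ≤ a
    · exact h1 _ _ ha
    by_cases hb : q ≤ b
    · exact h2 _ _ hb
    refine absurd ⟨(a, b), ?_, ?_⟩ hn
    · simp only [Finset.coe_product, Set.mem_prod, Finset.mem_coe, Finset.mem_range]; omega
    · simp only [h.2]
  · rintro ⟨a, b⟩ _; rfl

variable {b : U →ₗ[ℂ] V →ₗ[ℂ] W} {D₁ : Module.End ℂ U} {D₂ : Module.End ℂ V} {D₃ : Module.End ℂ W}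

theorem pow_leibniz (hb : ∀ u v, D₃ (b u v) = b (D₁ u) v + b u (D₂ v)) (n : ℕ) (u : U) (v : V) :
    (n.factorial : ℂ)⁻¹ • (D₃ ^ n) (b u v) = ∑ x ∈ Finset.HasAntidiagonal.antidiagonal n,
      b ((x.1.factorial : ℂ)⁻¹ • (D₁ ^ x.1) u) ((x.2.factorial : ℂ)⁻¹ • (D₂ ^ x.2) v) := by
  -- the two one-sided actions commute, so the binomial theorem applies on bilinear maps
  let E₁ : Module.End ℂ (U →ₗ[ℂ] V →ₗ[ℂ] W) := LinearMap.lcomp ℂ _ D₁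
  let E₂ : Module.End ℂ (U →ₗ[ℂ] V →ₗ[ℂ] W) := LinearMap.llcomp ℂ U _ _ (LinearMap.lcomp ℂ W D₂)
  have h1 : ∀ (i : ℕ) (c : U →ₗ[ℂ] V →ₗ[ℂ] W) u v, (E₁ ^ i) c u v = c ((D₁ ^ i) u) v := by
    intro i
    induction i with
    | zero => intros; rfl
    | succ i ih => intro c u v; rw [pow_succ', Module.End.mul_apply, pow_succ, Module.End.mul_apply, ← ih]; rfl
  have h2 : ∀ (i : ℕ) (c : U →ₗ[ℂ] V →ₗ[ℂ] W) u v, (E₂ ^ i) c u v = c u ((D₂ ^ i) v) := by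
    intro i
    induction i with
    | zero => intros; rfl
    | succ i ih => intro c u v; rw [pow_succ', Module.End.mul_apply, pow_succ, Module.End.mul_apply, ← ih]; rfl
  have hc : Commute E₁ E₂ := by
    ext c u v; rfl
  have h3 : ∀ u v, (D₃ ^ n) (b u v) = ((E₁ + E₂) ^ n) b u v := by
    induction n with
    | zero => intros; rfl
    | succ n ih =>
      intro u v
      rw [pow_succ, Module.End.mul_apply, hb, map_add, ih, ih, pow_succ', Module.End.mul_apply]
      rfl
  rw [h3, hc.add_pow', LinearMap.sum_apply, LinearMap.sum_apply, LinearMap.sum_apply,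
    Finset.smul_sum]
  refine Finset.sum_congr rfl fun x hx => ?_
  rw [Finset.HasAntidiagonal.mem_antidiagonal] at hx
  rw [← Nat.cast_smul_eq_nsmul ℂ, LinearMap.smul_apply, LinearMap.smul_apply, LinearMap.smul_apply,
    Module.End.mul_apply, h1, h2, map_smul, map_smul, LinearMap.smul_apply, smul_smul, smul_smul]
  congr 1
  rw [← hx, Nat.cast_add_choose]
  have := Nat.cast_ne_zero (R := ℂ).2 (x.1 + x.2).factorial_ne_zero
  field_simp

/-- If i + j = p + q then i ≥ p or j ≥ q, so every term of the Leibniz expansion vanishes. -/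
theorem pow_apply_eq_zero_of_leibniz (hb : ∀ u v, D₃ (b u v) = b (D₁ u) v + b u (D₂ v)) {u : U}
    {v : V} {p q : ℕ} (hp : (D₁ ^ p) u = 0) (hq : (D₂ ^ q) v = 0) :
    (D₃ ^ (p + q)) (b u v) = 0 := by
  have := pow_leibniz hb (p + q) u v
  rw [Finset.sum_eq_zero] at this
  · exact (smul_eq_zero_iff_right (inv_ne_zero (Nat.cast_ne_zero.2 (Nat.factorial_ne_zero _)))).1
      this
  · intro x hx
    rw [Finset.HasAntidiagonal.mem_antidiagonal] at hx
    rcases le_or_gt p x.1 with h | h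
    · rw [pow_apply_eq_zero_of_le hp h]; simp
    · rw [pow_apply_eq_zero_of_le hq (by omega : q ≤ x.2)]; simp

theorem locExp_leibniz (hb : ∀ u v, D₃ (b u v) = b (D₁ u) v + b u (D₂ v))
    (h₁ : LocallyNilpotent D₁) (h₂ : LocallyNilpotent D₂) (h₃ : LocallyNilpotent D₃) (u : U)
    (v : V) : locExp D₃ h₃ (b u v) = b (locExp D₁ h₁ u) (locExp D₂ h₂ v) := by
  obtain ⟨p, hp⟩ := h₁ u
  obtain ⟨q, hq⟩ := h₂ v
  rw [locExp_apply h₁ hp, locExp_apply h₂ hq,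
    locExp_apply h₃ (pow_apply_eq_zero_of_leibniz hb hp hq),
    Finset.sum_congr rfl fun n _ => pow_leibniz hb n u v, sum_antidiagonal_eq (F := fun x =>
      b ((x.1.factorial : ℂ)⁻¹ • (D₁ ^ x.1) u) ((x.2.factorial : ℂ)⁻¹ • (D₂ ^ x.2) v))]
  · simp only [map_sum, LinearMap.sum_apply]
    rw [Finset.sum_comm]
  · intro i j h; rw [pow_apply_eq_zero_of_le hp h]; simp
  · intro i j h; rw [pow_apply_eq_zero_of_le hq h]; simp

/-- The coefficient of `D ^ k` in the product of the two series is (-1 + 1)^k / k!. -/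
theorem locExp_neg_locExp {D : Module.End ℂ V} (h : LocallyNilpotent D) (h' : LocallyNilpotent (-D))
    (v : V) : locExp (-D) h' (locExp D h v) = v := by
  obtain ⟨n, hn⟩ := h v
  have hs : ∀ i : ℕ, (-D) ^ i = ((-1 : ℂ) ^ i) • D ^ i := fun i => by
    rw [← neg_one_smul ℂ D, smul_pow]
  have h0 : ∀ i j, n ≤ i + j → (D ^ i) ((D ^ j) v) = 0 := fun i j hij => by
    rw [← Module.End.mul_apply, ← pow_add]; exact pow_apply_eq_zero_of_le hn hij
  have h1 : ∀ j, locExp (-D) h' ((D ^ j) v) = ∑ i ∈ Finset.range n,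
      (i.factorial : ℂ)⁻¹ • ((-1 : ℂ) ^ i) • (D ^ i) ((D ^ j) v) := fun j => by
    rw [locExp_apply h' (n := n) (by rw [hs, LinearMap.smul_apply, h0 _ _ (by omega), smul_zero])]
    simp only [hs, LinearMap.smul_apply]
  rw [locExp_apply h hn, map_sum]
  simp only [map_smul, h1, Finset.smul_sum]
  rw [Finset.sum_comm, ← sum_antidiagonal_eq (F := fun x => (x.2.factorial : ℂ)⁻¹ •
    (x.1.factorial : ℂ)⁻¹ • ((-1 : ℂ) ^ x.1) • (D ^ x.1) ((D ^ x.2) v))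
    (fun i j hi => by rw [h0 _ _ (by omega)]; simp) (fun i j hi => by rw [h0 _ _ (by omega)]; simp)]
  have h2 : ∀ k, ∑ x ∈ Finset.HasAntidiagonal.antidiagonal k, (x.2.factorial : ℂ)⁻¹ • (x.1.factorial : ℂ)⁻¹ •
      ((-1 : ℂ) ^ x.1) • (D ^ x.1) ((D ^ x.2) v) = if k = 0 then v else 0 := by
    intro k
    have hk := (Commute.all (-1 : ℂ) 1).add_pow' k
    have h3 : ∀ x ∈ Finset.HasAntidiagonal.antidiagonal k, (x.2.factorial : ℂ)⁻¹ • (x.1.factorial : ℂ)⁻¹ •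
        ((-1 : ℂ) ^ x.1) • (D ^ x.1) ((D ^ x.2) v) =
        ((k.factorial : ℂ)⁻¹ * (k.choose x.1 • ((-1) ^ x.1 * 1 ^ x.2))) • (D ^ k) v := by
      intro x hx
      rw [Finset.HasAntidiagonal.mem_antidiagonal] at hx
      rw [← Module.End.mul_apply, ← pow_add, hx, smul_smul, smul_smul]
      congr 1
      rw [← hx, ← Nat.cast_smul_eq_nsmul ℂ, Nat.cast_add_choose, one_pow, mul_one, smul_eq_mul]
      have := Nat.cast_ne_zero (R := ℂ).2 (x.1 + x.2).factorial_ne_zero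
      field_simp
    rw [Finset.sum_congr rfl h3, ← Finset.sum_smul, ← Finset.mul_sum, ← hk, neg_add_cancel]
    split_ifs with h
    · subst h; simp
    · rw [zero_pow h, mul_zero, zero_smul]
  simp only [h2]
  rw [Finset.sum_ite_eq']
  split_ifs with h
  · rfl
  · have : n = 0 := by simpa using h
    subst this
    simpa using hn.symm

end Exp

/-! ### Exponentials of the action of even elements -/

namespace SuperModule

variable {L : Type u} [AddCommGroup L] [Module ℂ L] [Superalgebra L] [IsLieSuperalgebra L]
  {V : Type v} [AddCommGroup V] [Module ℂ V] (M : SuperModule L V)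

/-- An even element acts as a derivation of the action map, without signs, so its exponential
intertwines the action with its own adjoint exponential. -/
theorem locExp_act {x : L} (hx : x ∈ part (L := L) 0) (h : LocallyNilpotent (bracket x))
    (hM : LocallyNilpotent (M.act x)) (y : L) (m : V) :
    locExp (M.act x) hM (M.act y m) = M.act (locExp (bracket x) h y) (locExp (M.act x) hM m) :=
  locExp_leibniz (M.act_even hx) h hM hM y m

/-- If an even element acts nilpotently on a generating set, it is locally nilpotent. -/
theorem isSubmodule_locallyNilpotent {x : L} (hx : x ∈ part (L := L) 0)
    (h : LocallyNilpotent (bracket x)) :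
    ∃ N, M.IsSubmodule N ∧ ∀ m, m ∈ N ↔ ∃ n : ℕ, ((M.act x) ^ n) m = 0 := by
  let N : Submodule ℂ V :=
    { carrier := {m | ∃ n : ℕ, ((M.act x) ^ n) m = 0}
      zero_mem' := ⟨0, by simp⟩
      add_mem' := by
        rintro a b ⟨n, hn⟩ ⟨k, hk⟩
        exact ⟨n + k, by rw [map_add, pow_apply_eq_zero_of_le hn (by omega),
          pow_apply_eq_zero_of_le hk (by omega), add_zero]⟩
      smul_mem' := by
        rintro c a ⟨n, hn⟩
        exact ⟨n, by rw [map_smul, hn, smul_zero]⟩ }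
  refine ⟨N, ⟨?_, ?_⟩, fun m => Iff.rfl⟩
  · rintro y m ⟨n, hn⟩
    obtain ⟨k, hk⟩ := h y
    exact ⟨k + n, pow_apply_eq_zero_of_leibniz (M.act_even hx) hk hn⟩
  · rintro m ⟨n, hn⟩
    obtain ⟨a, ha, b, hb, rfl⟩ := M.exists_add_eq m
    have hp : ∀ i, ∀ c ∈ M.vpart i, ((M.act x) ^ n) c ∈ M.vpart i := by
      intro i c hc
      clear hn
      induction n with
      | zero => exact hc
      | succ n ih =>
        rw [pow_succ', Module.End.mul_apply]
        have := M.act_mem hx ih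
        rwa [zero_add] at this
    rw [map_add] at hn
    have h1 := eq_neg_of_add_eq_zero_left hn
    have h2 : ((M.act x) ^ n) a = 0 := M.eq_zero_of_mem_of_mem zero_ne_one (hp 0 a ha)
      (h1 ▸ Submodule.neg_mem _ (hp 1 b hb))
    rw [h2, zero_add] at hn
    exact Submodule.add_mem_sup ⟨⟨n, h2⟩, ha⟩ ⟨⟨n, hn⟩, hb⟩

end SuperModule

/-! ### Even `sl₂`-triples and reflections -/

section Reflection

variable {𝔥 : Type v} [AddCommGroup 𝔥] [Module ℂ 𝔥]

/-- The reflection `h ↦ h - β(h) h_β`. -/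
noncomputable def coReflection (β : Module.Dual ℂ 𝔥) (hβ : 𝔥) : 𝔥 →ₗ[ℂ] 𝔥 :=
  LinearMap.id - β.smulRight hβ

theorem coReflection_apply (β : Module.Dual ℂ 𝔥) (hβ h : 𝔥) :
    coReflection β hβ h = h - β h • hβ := rfl

theorem coReflection_involutive {β : Module.Dual ℂ 𝔥} {hβ : 𝔥} (h2 : β hβ = 2) (h : 𝔥) :
    coReflection β hβ (coReflection β hβ h) = h := by
  simp only [coReflection_apply, map_sub, map_smul, h2]
  module

end Reflection

namespace OddChevalley

variable {L : Type u} [AddCommGroup L] [Module ℂ L] [Superalgebra L]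
  {ι : Type} {𝔥 : Type v} [AddCommGroup 𝔥] [Module ℂ 𝔥] (S : OddChevalley L ι 𝔥)
  {V : Type w} [AddCommGroup V] [Module ℂ V]

/-- An `sl₂`-triple `e, h_β, f` of even root vectors. -/
structure EvenTriple (β : Module.Dual ℂ 𝔥) (hβ : 𝔥) (e f : L) : Prop where
  e_mem : e ∈ part (L := L) 0
  f_mem : f ∈ part (L := L) 0
  e_f : bracket e f = S.H hβ
  H_e : ∀ h, bracket (S.H h) e = β h • e
  H_f : ∀ h, bracket (S.H h) f = -(β h • f)
  root_coroot : β hβ = 2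

namespace EvenTriple

variable {S} {β : Module.Dual ℂ 𝔥} {hβ : 𝔥} {e f : L} (t : S.EvenTriple β hβ e f)
  (M : SuperModule L V)

include t

theorem act_H_pow {w : V} {c : ℂ} (hw : M.act (S.H hβ) w = c • w) (n : ℕ) :
    M.act (S.H hβ) (((M.act f) ^ n) w) = (c - 2 * n) • ((M.act f) ^ n) w := by
  induction n with
  | zero => simpa using hw
  | succ n ih =>
    rw [pow_succ', Module.End.mul_apply, M.act_even (S.H_mem _), t.H_f, ih, t.root_coroot, map_neg,
      map_smul, map_smul, LinearMap.neg_apply, LinearMap.smul_apply]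
    push_cast; module

/-- The factor vanishes exactly at `c = n`; both the integrality of weights and the production of
new primitive vectors rest on this. -/
theorem act_e_pow {w : V} {c : ℂ} (hw : M.act (S.H hβ) w = c • w) (he : M.act e w = 0) (n : ℕ) :
    M.act e (((M.act f) ^ (n + 1)) w) = ((n + 1) * (c - n)) • ((M.act f) ^ n) w := by
  induction n with
  | zero =>
    rw [zero_add, pow_one, M.act_even t.e_mem, t.e_f, hw, he]
    simp
  | succ n ih =>
    rw [pow_succ' _ (n + 1), Module.End.mul_apply, M.act_even t.e_mem, t.e_f, ih,
      t.act_H_pow M hw, map_smul, ← Module.End.mul_apply, ← pow_succ']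
    push_cast; module

/-- The weight of a primitive vector killed by a power of `f` is a natural number. -/
theorem exists_nat_of_pow_eq_zero {w : V} (hw0 : w ≠ 0) {c : ℂ} (hw : M.act (S.H hβ) w = c • w)
    (he : M.act e w = 0) {n : ℕ} (hn : ((M.act f) ^ n) w = 0) : ∃ k : ℕ, c = k := by
  classical
  have hex : ∃ n : ℕ, ((M.act f) ^ n) w = 0 := ⟨n, hn⟩
  obtain ⟨k, hk⟩ : ∃ k, Nat.find hex = k + 1 :=
    Nat.exists_eq_succ_of_ne_zero fun h => hw0 (by simpa [h] using Nat.find_spec hex)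
  have h1 := t.act_e_pow M hw he k
  rw [← hk, Nat.find_spec hex, map_zero, eq_comm, smul_eq_zero] at h1
  rcases h1 with h1 | h1
  · rcases mul_eq_zero.1 h1 with h | h
    · exact absurd h (by exact_mod_cast k.succ_ne_zero)
    · exact ⟨k, sub_eq_zero.1 h⟩
  · exact absurd h1 (Nat.find_min hex (by omega))

variable [IsLieSuperalgebra L]

theorem e_H (h : 𝔥) : bracket e (S.H h) = -(β h • e) := by
  rw [bracket_skew_even t.e_mem, t.H_e]

theorem f_H (h : 𝔥) : bracket f (S.H h) = β h • f := by
  rw [bracket_skew_even t.f_mem, t.H_f, neg_neg]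

theorem f_e : bracket f e = -S.H hβ := by rw [bracket_skew_even t.f_mem, t.e_f]

omit t in
theorem locallyNilpotent_act_neg {M : SuperModule L V} (h : LocallyNilpotent (M.act f)) :
    LocallyNilpotent (M.act (-f)) := by
  rw [map_neg]; exact h.neg

omit t in
/-- The operator `exp(e) exp(-f) exp(e)`. -/
noncomputable def reflect (M : SuperModule L V) (he : LocallyNilpotent (M.act e))
    (hf : LocallyNilpotent (M.act f)) : Module.End ℂ V :=
  locExp (M.act e) he * locExp (M.act (-f)) (locallyNilpotent_act_neg hf) * locExp (M.act e) he

omit t in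
theorem locExp_injective {D : Module.End ℂ V} (h : LocallyNilpotent D) :
    Function.Injective (locExp D h) :=
  Function.LeftInverse.injective (locExp_neg_locExp h h.neg)

omit t in
theorem reflect_injective (M : SuperModule L V) (he : LocallyNilpotent (M.act e))
    (hf : LocallyNilpotent (M.act f)) : Function.Injective (reflect M he hf) :=
  (locExp_injective he).comp ((locExp_injective (locallyNilpotent_act_neg hf)).comp
    (locExp_injective he))

variable (hade : LocallyNilpotent ((SuperModule.adjoint L).act e))
  (hadf : LocallyNilpotent ((SuperModule.adjoint L).act f))

theorem reflect_act (M : SuperModule L V) (he : LocallyNilpotent (M.act e))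
    (hf : LocallyNilpotent (M.act f)) (x : L) (m : V) :
    reflect M he hf (M.act x m) =
      M.act (reflect (SuperModule.adjoint L) hade hadf x) (reflect M he hf m) := by
  simp only [reflect, Module.End.mul_apply]
  rw [M.locExp_act t.e_mem hade, M.locExp_act (Submodule.neg_mem _ t.f_mem)
    (locallyNilpotent_act_neg hadf), M.locExp_act t.e_mem hade]
  rfl

/-- An `sl₂` computation: the exponential series end after the first or second order terms on 𝔥, on
`e` and on `f`, and the multiples of `e` and `f` cancel. -/
theorem reflect_H (h : 𝔥) :
    reflect (SuperModule.adjoint L) hade hadf (S.H h) = S.H (coReflection β hβ h) := by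
  have fin2 : ∀ {D : Module.End ℂ L} (hD : LocallyNilpotent D) (x : L), D (D x) = 0 →
      locExp D hD x = x + D x := fun hD x h0 => by
    rw [locExp_apply hD (n := 2) (by rw [pow_two, Module.End.mul_apply, h0])]
    simp [Finset.sum_range_succ]
  have fin3 : ∀ {D : Module.End ℂ L} (hD : LocallyNilpotent D) (x : L), D (D (D x)) = 0 →
      locExp D hD x = x + D x + (2 : ℂ)⁻¹ • D (D x) := fun hD x h0 => by
    rw [locExp_apply hD (n := 3) (by
      rw [pow_succ, pow_two, Module.End.mul_apply, Module.End.mul_apply, h0])]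
    simp [Finset.sum_range_succ, pow_two]
  have hee := bracket_self_even t.e_mem
  have hff := bracket_self_even t.f_mem
  have eH : ∀ h, locExp ((SuperModule.adjoint L).act e) hade (S.H h) = S.H h - β h • e := by
    intro h
    rw [fin2 hade]
    · change _ + bracket e _ = _
      rw [t.e_H, sub_eq_add_neg]
    · change bracket e (bracket e _) = 0
      rw [t.e_H, map_neg, map_smul, hee, smul_zero, neg_zero]
  have ee : locExp ((SuperModule.adjoint L).act e) hade e = e := by
    rw [fin2 hade]
    · change _ + bracket e _ = _
      rw [hee, add_zero]
    · change bracket e (bracket e _) = 0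
      rw [hee, map_zero]
  have fH : ∀ h, locExp ((SuperModule.adjoint L).act (-f)) (locallyNilpotent_act_neg hadf) (S.H h) =
      S.H h - β h • f := by
    intro h
    rw [fin2 (locallyNilpotent_act_neg hadf)]
    · change _ + bracket (-f) _ = _
      rw [map_neg, LinearMap.neg_apply, t.f_H, sub_eq_add_neg]
    · change bracket (-f) (bracket (-f) _) = 0
      rw [map_neg, LinearMap.neg_apply, LinearMap.neg_apply, t.f_H, map_neg, map_smul, hff]
      simp
  have fe : locExp ((SuperModule.adjoint L).act (-f)) (locallyNilpotent_act_neg hadf) e =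
      e + S.H hβ - f := by
    have h1 : bracket (-f) e = S.H hβ := by rw [map_neg, LinearMap.neg_apply, t.f_e, neg_neg]
    have h2 : bracket (-f) (S.H hβ) = -((2 : ℂ) • f) := by
      rw [map_neg, LinearMap.neg_apply, t.f_H, t.root_coroot]
    rw [fin3 (locallyNilpotent_act_neg hadf)]
    · change _ + bracket (-f) e + _ • bracket (-f) (bracket (-f) e) = _
      rw [h1, h2]
      module
    · change bracket (-f) (bracket (-f) (bracket (-f) e)) = 0
      rw [h1, h2, map_neg, map_smul, map_neg, LinearMap.neg_apply, hff]; simp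
  simp only [reflect, Module.End.mul_apply]
  rw [eH, map_sub, map_smul, fH, fe]
  have h3 : S.H h - β h • f - β h • (e + S.H hβ - f) = S.H (coReflection β hβ h) - β h • e := by
    rw [coReflection_apply, map_sub, map_smul]; module
  rw [h3, map_sub, map_smul, eH, ee, coReflection_apply, map_sub β, map_smul β, t.root_coroot,
    smul_eq_mul]
  module

include hade hadf

/-- The reflection of a weight is a weight. -/
theorem exists_weight_reflect (M : SuperModule L V) (he : LocallyNilpotent (M.act e))
    (hf : LocallyNilpotent (M.act f)) {μ : Module.Dual ℂ 𝔥} {m : V} (hm : m ≠ 0)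
    (hμ : ∀ h, M.act (S.H h) m = μ h • m) :
    ∃ m', m' ≠ 0 ∧ ∀ h, M.act (S.H h) m' = μ (coReflection β hβ h) • m' := by
  refine ⟨reflect M he hf m, fun h => hm (reflect_injective M he hf (by rw [h, map_zero])),
    fun h => ?_⟩
  have := t.reflect_act hade hadf M he hf (S.H (coReflection β hβ h)) m
  rw [t.reflect_H, coReflection_involutive t.root_coroot, hμ, map_smul] at this
  exact this.symm

/-- Local nilpotency of root vectors is invariant under reflections. -/
theorem locallyNilpotent_reflect (M : SuperModule L V) (he : LocallyNilpotent (M.act e))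
    (hf : LocallyNilpotent (M.act f)) {α : Module.Dual ℂ 𝔥}
    (hα : ∀ x, (∀ h, bracket (S.H h) x = α h • x) → LocallyNilpotent (M.act x)) {y : L}
    (hy : ∀ h, bracket (S.H h) y = α (coReflection β hβ h) • y) :
    LocallyNilpotent (M.act y) := by
  set τ := reflect (SuperModule.adjoint L) hade hadf
  have h1 : LocallyNilpotent (M.act (τ y)) := by
    refine hα _ fun h => ?_
    have := t.reflect_act hade hadf (SuperModule.adjoint L) hade hadf (S.H (coReflection β hβ h)) y
    rw [t.reflect_H, coReflection_involutive t.root_coroot] at this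
    change τ (bracket _ _) = bracket _ (τ y) at this
    rw [← this, hy, coReflection_involutive t.root_coroot, map_smul]
  intro m
  obtain ⟨n, hn⟩ := h1 (reflect M he hf m)
  refine ⟨n, reflect_injective M he hf ?_⟩
  rw [map_zero, ← hn]
  clear hn
  induction n with
  | zero => rfl
  | succ n ih =>
    rw [pow_succ', Module.End.mul_apply, t.reflect_act hade hadf, ih, pow_succ',
      Module.End.mul_apply]

end EvenTriple

end OddChevalley

/-! ### Three odd isotropic simple roots -/

namespace OddChevalley

variable {L : Type u} [AddCommGroup L] [Module ℂ L] [Superalgebra L]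
  {𝔥 : Type v} [AddCommGroup 𝔥] [Module ℂ 𝔥] (S : OddChevalley L (Fin 3) 𝔥)
  {V : Type w} [AddCommGroup V] [Module ℂ V]

/-- The normalized coroot of the even root `α_i + α_j`. -/
noncomputable def pairCoroot (i j : Fin 3) : 𝔥 :=
  (S.root j (S.coroot i))⁻¹ • S.coroot i + (S.root i (S.coroot j))⁻¹ • S.coroot j

/-- Three odd isotropic simple roots, no two of them orthogonal, such that the even roots
`α_i + α_j` have a generalized Cartan matrix with negative off-diagonal entries. -/
structure IsTriangle : Prop where
  diag : ∀ i, S.root i (S.coroot i) = 0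
  off : ∀ i j, i ≠ j → S.root j (S.coroot i) ≠ 0
  exists_nat : ∀ i j k, i ≠ j → i ≠ k → j ≠ k →
    ∃ N : ℕ, S.root k (S.pairCoroot i j) + 1 = -(N + 1 : ℂ)

variable {S}

theorem pairCoroot_comm (i j : Fin 3) : S.pairCoroot i j = S.pairCoroot j i := add_comm _ _

theorem swap_pairCoroot [IsLieSuperalgebra L] (i j : Fin 3) :
    S.swap.pairCoroot i j = -S.pairCoroot i j := by
  simp only [pairCoroot, swap, Pi.neg_apply, map_neg, LinearMap.neg_apply, neg_neg, smul_neg,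
    neg_add]

theorem eq_of_ne {i j k : Fin 3} (hij : i ≠ j) (hik : i ≠ k) (hjk : j ≠ k) (l : Fin 3) :
    l = i ∨ l = j ∨ l = k := by
  omega

namespace IsTriangle

variable (hS : S.IsTriangle)

include hS

theorem root_left {i j : Fin 3} (hij : i ≠ j) : S.root i (S.pairCoroot i j) = 1 := by
  simp [pairCoroot, hS.diag, hS.off j i hij.symm]

theorem root_right {i j : Fin 3} (hij : i ≠ j) : S.root j (S.pairCoroot i j) = 1 := by
  rw [pairCoroot_comm, hS.root_left hij.symm]

variable [IsLieSuperalgebra L]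

theorem swap : S.swap.IsTriangle where
  diag i := by simpa [OddChevalley.swap] using hS.diag i
  off i j hij := by simpa [OddChevalley.swap] using hS.off i j hij
  exists_nat i j k hij hik hjk := by
    obtain ⟨N, hN⟩ := hS.exists_nat i j k hij hik hjk
    refine ⟨N, ?_⟩
    rw [swap_pairCoroot]
    simpa [OddChevalley.swap] using hN

/-- The square commutes with every `Y_j`, with isotropy used for `j = i`, so it is singular of
degree -2 for the exchanged generators. -/
theorem X_X (i : Fin 3) : bracket (S.X i) (S.X i) = 0 := by
  refine S.swap.singularFree_adjoint (-2) ⟨1, by norm_num⟩ 0 _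
    (Superalgebra.bracket_mem (S.X_mem i) (S.X_mem i)) ?_ fun j => ?_
  · change bracket (S.H (-S.deg)) _ = _
    rw [bracket_even_left (S.H_mem _), S.HX, map_neg, S.root_deg, map_smul, map_smul,
      LinearMap.smul_apply]
    module
  · change bracket (S.Y j) (bracket (S.X i) (S.X i)) = 0
    rw [bracket_odd_odd (S.Y_mem j) (S.X_mem i), ← bracket_comm_odd (S.X_mem i) (S.Y_mem j)]
    by_cases hij : i = j
    · subst hij
      rw [S.XY_same, S.HX, hS.diag, bracket_skew_even (S.H_mem _) (S.X i) |> neg_eq_iff_eq_neg.2 |>.symm,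
        S.HX, hS.diag]
      simp
    · rw [S.XY_ne i j hij]; simp

theorem Y_Y (i : Fin 3) : bracket (S.Y i) (S.Y i) = 0 := hS.swap.X_X i

theorem X_XX (i j : Fin 3) : bracket (S.X i) (bracket (S.X i) (S.X j)) = 0 := by
  have := bracket_odd_odd (S.X_mem i) (S.X_mem i) (S.X j)
  rw [hS.X_X, map_zero, LinearMap.zero_apply, zero_sub, eq_neg_iff_add_eq_zero, ← two_smul ℂ] at this
  exact (smul_eq_zero_iff_right two_ne_zero).1 this

omit hS in
theorem XX_mem (i j : Fin 3) : bracket (S.X i) (S.X j) ∈ part (L := L) 0 :=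
  Superalgebra.bracket_mem (S.X_mem i) (S.X_mem j)

omit hS in
theorem YY_mem (i j : Fin 3) : bracket (S.Y i) (S.Y j) ∈ part (L := L) 0 :=
  Superalgebra.bracket_mem (S.Y_mem i) (S.Y_mem j)

omit hS in
theorem XX_comm (i j : Fin 3) : bracket (S.X i) (S.X j) = bracket (S.X j) (S.X i) :=
  bracket_comm_odd (S.X_mem i) (S.X_mem j)

theorem XX_X_left (i j : Fin 3) : bracket (bracket (S.X i) (S.X j)) (S.X i) = 0 := by
  rw [bracket_skew_even (XX_mem i j), hS.X_XX, neg_zero]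

theorem XX_X_right (i j : Fin 3) : bracket (bracket (S.X i) (S.X j)) (S.X j) = 0 := by
  rw [XX_comm, hS.XX_X_left]

omit hS in
theorem X_H (h : 𝔥) (i : Fin 3) : bracket (S.X i) (S.H h) = -(S.root i h • S.X i) := by
  rw [← S.HX, bracket_skew_even (S.H_mem h), neg_neg]

omit hS in
theorem XX_Y (i j k : Fin 3) : bracket (bracket (S.X i) (S.X j)) (S.Y k) =
    bracket (S.X i) (bracket (S.X j) (S.Y k)) + bracket (S.X j) (bracket (S.X i) (S.Y k)) := by
  rw [bracket_odd_odd (S.X_mem i) (S.X_mem j), sub_add_cancel]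

omit hS in
theorem XX_Y_left {i j : Fin 3} (hij : i ≠ j) : bracket (bracket (S.X i) (S.X j)) (S.Y i) =
    -(S.root j (S.coroot i) • S.X j) := by
  rw [XX_Y, S.XY_ne j i hij.symm, S.XY_same, X_H, map_zero, zero_add]

omit hS in
theorem XX_Y_right {i j : Fin 3} (hij : i ≠ j) : bracket (bracket (S.X i) (S.X j)) (S.Y j) =
    -(S.root i (S.coroot j) • S.X i) := by
  rw [XX_comm, XX_Y_left hij.symm]

omit hS in
theorem XX_Y_ne {i j k : Fin 3} (hik : i ≠ k) (hjk : j ≠ k) :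
    bracket (bracket (S.X i) (S.X j)) (S.Y k) = 0 := by
  rw [XX_Y, S.XY_ne j k hjk, S.XY_ne i k hik, map_zero, map_zero, add_zero]

omit hS in
theorem YY_X_left {i j : Fin 3} (hij : i ≠ j) : bracket (bracket (S.Y i) (S.Y j)) (S.X i) =
    S.root j (S.coroot i) • S.Y j := by
  have := XX_Y_left (S := S.swap) hij
  simpa [OddChevalley.swap] using this

omit hS in
theorem YY_X_right {i j : Fin 3} (hij : i ≠ j) : bracket (bracket (S.Y i) (S.Y j)) (S.X j) =
    S.root i (S.coroot j) • S.Y i := by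
  have := XX_Y_right (S := S.swap) hij
  simpa [OddChevalley.swap] using this

omit hS in
theorem YY_X_ne {i j k : Fin 3} (hik : i ≠ k) (hjk : j ≠ k) :
    bracket (bracket (S.Y i) (S.Y j)) (S.X k) = 0 := by
  have := XX_Y_ne (S := S.swap) hik hjk
  simpa [OddChevalley.swap] using this

theorem YY_Y_left (i j : Fin 3) : bracket (bracket (S.Y i) (S.Y j)) (S.Y i) = 0 :=
  hS.swap.XX_X_left i j

theorem YY_Y_right (i j : Fin 3) : bracket (bracket (S.Y i) (S.Y j)) (S.Y j) = 0 :=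
  hS.swap.XX_X_right i j

omit hS in
theorem XX_YY {i j : Fin 3} (hij : i ≠ j) :
    bracket (bracket (S.X i) (S.X j)) (bracket (S.Y i) (S.Y j)) =
      -S.H (S.root j (S.coroot i) • S.coroot j + S.root i (S.coroot j) • S.coroot i) := by
  rw [bracket_even_left (XX_mem i j), XX_Y_left hij, XX_Y_right hij]
  simp only [map_neg, map_smul, LinearMap.neg_apply, LinearMap.smul_apply, S.XY_same, map_add,
    ← bracket_comm_odd (S.X_mem i) (S.Y_mem i)]
  abel

/-- The negative root vector of the `sl₂`-triple of `α_i + α_j`. -/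
noncomputable def _root_.SuperKM.OddChevalley.pairY (S : OddChevalley L (Fin 3) 𝔥) (i j : Fin 3) :
    L := -((S.root j (S.coroot i) * S.root i (S.coroot j))⁻¹ • bracket (S.Y i) (S.Y j))

omit hS in
theorem pairY_mem (i j : Fin 3) : S.pairY i j ∈ part (L := L) 0 :=
  Submodule.neg_mem _ (Submodule.smul_mem _ _ (YY_mem i j))

theorem triple {i j : Fin 3} (hij : i ≠ j) :
    S.EvenTriple (S.root i + S.root j) (S.pairCoroot i j) (bracket (S.X i) (S.X j))
      (S.pairY i j) where
  e_mem := XX_mem i j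
  f_mem := pairY_mem i j
  e_f := by
    have h1 := hS.off i j hij
    have h2 := hS.off j i hij.symm
    rw [pairY, map_neg, map_smul, XX_YY hij, smul_neg, neg_neg, ← map_smul, pairCoroot, smul_add,
      smul_smul, smul_smul, add_comm]
    congr 3 <;> field_simp
  H_e h := by
    rw [bracket_even_left (S.H_mem h), S.HX, S.HX, map_smul, map_smul, LinearMap.smul_apply,
      LinearMap.add_apply, add_smul]
  H_f h := by
    rw [pairY, map_neg, map_smul, bracket_even_left (S.H_mem h), S.HY, S.HY, map_neg, map_neg,
      map_smul, map_smul, LinearMap.neg_apply, LinearMap.smul_apply, LinearMap.add_apply]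
    module
  root_coroot := by
    rw [LinearMap.add_apply, hS.root_left hij, hS.root_right hij]; norm_num

theorem pairY_Y_left (i j : Fin 3) : bracket (S.pairY i j) (S.Y i) = 0 := by
  rw [pairY, map_neg, map_smul, LinearMap.neg_apply, LinearMap.smul_apply, hS.YY_Y_left, smul_zero,
    neg_zero]

omit [IsLieSuperalgebra L] hS in
theorem act_pow_comm (M : SuperModule L V) {f y : L} (hf : f ∈ part (L := L) 0)
    (hy : bracket f y = 0) (n : ℕ) (m : V) :
    M.act y (((M.act f) ^ n) m) = ((M.act f) ^ n) (M.act y m) := by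
  induction n with
  | zero => rfl
  | succ n ih =>
    rw [pow_succ', Module.End.mul_apply, Module.End.mul_apply, ← ih, M.act_even hf, hy, map_zero,
      LinearMap.zero_apply, zero_add]

omit [IsLieSuperalgebra L] hS in
theorem pow_mem (M : SuperModule L V) {f : L} (hf : f ∈ part (L := L) 0) {d : ZMod 2} {m : V}
    (hm : m ∈ M.vpart d) (n : ℕ) : ((M.act f) ^ n) m ∈ M.vpart d := by
  induction n with
  | zero => exact hm
  | succ n ih =>
    rw [pow_succ', Module.End.mul_apply]
    have := M.act_mem hf ih
    rwa [zero_add] at this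

/-- A vector that is primitive for the odd reflection at `α_i` of the simple roots yields a
singular vector, which vanishes if there are none. -/
theorem pow_pairY_eq_zero {i j k : Fin 3} (hij : i ≠ j) (hik : i ≠ k) (hjk : j ≠ k)
    {M : SuperModule L V} {K : Set ℂ} (hM : S.SingularFree M K) {d : ZMod 2} {w : V}
    (hw : w ∈ M.vpart d) {κ : ℂ} (hκ : M.act (S.H S.deg) w = κ • w) {n : ℕ}
    (h1 : κ - 2 * (n + 1) ∈ K) (h2 : κ - 2 * (n + 1) + 1 ∈ K)
    (hn : M.act (S.H (S.pairCoroot i j)) w = (n : ℂ) • w) (hY : M.act (S.Y i) w = 0)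
    (he : M.act (bracket (S.X i) (S.X j)) w = 0)
    (he' : M.act (bracket (S.X i) (S.X k)) (((M.act (S.pairY i j)) ^ (n + 1)) w) = 0) :
    ((M.act (S.pairY i j)) ^ (n + 1)) w = 0 := by
  have t := hS.triple hij
  set u := ((M.act (S.pairY i j)) ^ (n + 1)) w with hu
  have hud : u ∈ M.vpart d := pow_mem M t.f_mem hw _
  have huκ : M.act (S.H S.deg) u = (κ - 2 * (n + 1)) • u := by
    have : ∀ q : ℕ, M.act (S.H S.deg) (((M.act (S.pairY i j)) ^ q) w) =
        (κ - 2 * q) • ((M.act (S.pairY i j)) ^ q) w := by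
      intro q
      induction q with
      | zero => simpa using hκ
      | succ q ih =>
        rw [pow_succ', Module.End.mul_apply, M.act_even (S.H_mem _), t.H_f, ih, LinearMap.add_apply,
          S.root_deg, S.root_deg, map_neg, map_smul, map_smul, LinearMap.neg_apply,
          LinearMap.smul_apply]
        push_cast; module
    have := this (n + 1)
    push_cast at this
    exact this
  have hYu : M.act (S.Y i) u = 0 := by
    rw [hu, act_pow_comm M t.f_mem (hS.pairY_Y_left i j), hY, map_zero]
  -- The exponent is one more than the weight n of the primitive vector, which is where the `sl₂`
  -- coefficient vanishes.
  have heu : M.act (bracket (S.X i) (S.X j)) u = 0 := by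
    rw [hu, t.act_e_pow M hn he, sub_self, mul_zero, zero_smul]
  -- The commutator of `[X_i, X_l]` with `Y_i` is a non-zero multiple of `X_l`, and both factors
  -- kill `u`.
  have hX : ∀ l, i ≠ l → M.act (bracket (S.X i) (S.X l)) u = 0 → M.act (S.X l) u = 0 := by
    intro l hil h
    have h3 := M.act_even (XX_mem (S := S) i l) (S.Y i) u
    rw [hYu, h, map_zero, map_zero, add_zero, XX_Y_left hil, map_neg, map_smul,
      LinearMap.neg_apply, eq_comm, neg_eq_zero] at h3
    exact (smul_eq_zero_iff_right (hS.off i l hil)).1 h3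
  have hXj := hX j hij heu
  have hXk := hX k hik he'
  -- Nothing so far shows that `X_i` kills `u`, but `X_i u` is itself singular, one degree higher;
  -- this is why a second degree is required to lie in `K`.
  have hXi : M.act (S.X i) u = 0 := by
    refine hM _ h2 _ _ (M.act_mem (S.X_mem i) hud) ?_ fun l => ?_
    · rw [S.act_H_X, huκ, S.root_deg, map_smul, one_smul]; module
    · have hl : ∀ l, M.act (S.X l) u = 0 → M.act (bracket (S.X i) (S.X l)) u = 0 →
          M.act (S.X l) (M.act (S.X i) u) = 0 := by
        intro l h3 h4
        rw [M.act_odd (S.X_mem l) (S.X_mem i), XX_comm, h4, h3, map_zero, sub_zero]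
      rcases eq_of_ne hij hik hjk l with rfl | rfl | rfl
      · have := M.act_odd (S.X_mem l) (S.X_mem l) u
        rw [hS.X_X, map_zero, LinearMap.zero_apply, zero_sub, eq_neg_iff_add_eq_zero,
          ← two_smul ℂ] at this
        exact (smul_eq_zero_iff_right two_ne_zero).1 this
      · exact hl _ hXj heu
      · exact hl _ hXk he'
  refine hM _ h1 _ _ hud huκ fun l => ?_
  rcases eq_of_ne hij hik hjk l with rfl | rfl | rfl
  exacts [hXi, hXj, hXk]

theorem pairY_XX {i j k : Fin 3} (hij : i ≠ j) (hik : i ≠ k) (hjk : j ≠ k) :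
    bracket (S.pairY i j) (bracket (S.X i) (S.X k)) = 0 := by
  rw [bracket_skew_even (hS.triple hij).f_mem, pairY, map_neg, map_smul,
    bracket_even_left (XX_mem i k), XX_Y_left hik, XX_Y_ne hij hjk.symm, map_neg, map_smul]
  simp [S.XY_ne k j hjk.symm]

/-- The Serre relation after an odd reflection. -/
theorem exists_pow_pairY_YY {i j k : Fin 3} (hij : i ≠ j) (hik : i ≠ k) (hjk : j ≠ k) :
    ∃ n : ℕ, ((bracket (S.pairY i j)) ^ n) (bracket (S.Y i) (S.Y k)) = 0 := by
  obtain ⟨N, hN⟩ := hS.exists_nat i j k hij hik hjk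
  have t := hS.triple hij
  have hH : ∀ h, bracket (S.H h) (bracket (S.Y i) (S.Y k)) =
      -((S.root i h + S.root k h) • bracket (S.Y i) (S.Y k)) := by
    intro h
    rw [bracket_even_left (S.H_mem h), S.HY, S.HY, map_neg, map_neg, map_smul, map_smul,
      LinearMap.neg_apply, LinearMap.smul_apply]
    module
  -- The vector `[Y_i, Y_k]` has degree -2 and h_ij-weight -(1 + α_k(h_ij)) = N + 1, so the exponent
  -- is N + 2. The degrees of the two singular vectors produced are then -2N - 6 and -2N - 5.
  refine ⟨N + 1 + 1, hS.pow_pairY_eq_zero (M := SuperModule.adjoint L) hij hik hjk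
    S.singularFree_adjoint (d := 0) (κ := -2) (YY_mem i k) ?_
    ⟨2 * N + 5, by push_cast; ring⟩ ⟨2 * N + 4, by push_cast; ring⟩ ?_ ?_ ?_ ?_⟩
  · change bracket _ (bracket _ _) = _
    rw [hH, S.root_deg, S.root_deg]; module
  · change bracket _ (bracket _ _) = _
    rw [hH, hS.root_left hij, add_comm, hN]; push_cast; module
  · change bracket _ (bracket _ _) = _
    exact hS.swap.X_XX i k
  · change bracket _ (bracket _ _) = _
    rw [bracket_even_left (XX_mem i j), XX_Y_left hij, XX_Y_ne hik hjk, map_neg, map_smul]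
    simp [S.XY_ne j k hjk]
  -- `[X_i, X_k]` commutes with f and sends `[Y_i, Y_k]` into 𝔥, on which the square of ad f
  -- vanishes.
  · rw [act_pow_comm _ t.f_mem (hS.pairY_XX hij hik hjk)]
    refine pow_apply_eq_zero_of_le (n := 2) ?_ (by omega)
    change ((bracket (S.pairY i j)) ^ 2) (bracket _ _) = 0
    rw [XX_YY hik, pow_two, Module.End.mul_apply, map_neg, t.f_H, map_neg, map_smul,
      bracket_self_even t.f_mem, smul_zero, neg_zero]

/-- Because ad f is an even derivation, the elements killed by some power of it are closed under
brackets, so generators suffice. Only `Y_k` is not immediate. -/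
theorem locallyNilpotent_pairY {i j : Fin 3} (hij : i ≠ j) :
    LocallyNilpotent (bracket (S.pairY i j)) := by
  obtain ⟨k, hik, hjk⟩ : ∃ k, i ≠ k ∧ j ≠ k := by
    revert i j; decide
  have t := hS.triple hij
  set f := S.pairY i j with hf
  have hb : ∀ x y, bracket f (bracket x y) = bracket (bracket f x) y + bracket x (bracket f y) :=
    bracket_even_left t.f_mem
  have hbr : ∀ x y, (∃ n : ℕ, ((bracket f) ^ n) x = 0) → (∃ n : ℕ, ((bracket f) ^ n) y = 0) →
      ∃ n : ℕ, ((bracket f) ^ n) (bracket x y) = 0 := by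
    rintro x y ⟨n, hn⟩ ⟨q, hq⟩
    exact ⟨n + q, pow_apply_eq_zero_of_leibniz hb hn hq⟩
  have hsmul : ∀ (c : ℂ) x, (∃ n : ℕ, ((bracket f) ^ n) x = 0) →
      ∃ n : ℕ, ((bracket f) ^ n) (c • x) = 0 := by
    rintro c x ⟨n, hn⟩
    exact ⟨n, by rw [map_smul, hn, smul_zero]⟩
  have hfY : ∀ c l, bracket f (S.Y l) = 0 → ((bracket f) ^ 1) (c • S.Y l) = 0 := fun c l h => by
    rw [pow_one, map_smul, h, smul_zero]
  have hYi : bracket f (S.Y i) = 0 := hS.pairY_Y_left i j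
  have hYj : bracket f (S.Y j) = 0 := by
    rw [hf, pairY, map_neg, map_smul, LinearMap.neg_apply, LinearMap.smul_apply, hS.YY_Y_right,
      smul_zero, neg_zero]
  have hX : ∀ l, ∃ n : ℕ, ((bracket f) ^ n) (S.X l) = 0 := by
    intro l
    rcases eq_of_ne hij hik hjk l with rfl | rfl | rfl
    · refine ⟨1 + 1, ?_⟩
      have h1 : bracket f (S.X l) =
          (-((S.root j (S.coroot l) * S.root l (S.coroot j))⁻¹ * S.root j (S.coroot l))) • S.Y j := by
        rw [hf, pairY, map_neg, map_smul, LinearMap.neg_apply, LinearMap.smul_apply,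
          YY_X_left hij, smul_smul, ← neg_smul]
      rw [pow_succ, Module.End.mul_apply, h1]
      exact hfY _ _ hYj
    · refine ⟨1 + 1, ?_⟩
      have h1 : bracket f (S.X l) =
          (-((S.root l (S.coroot i) * S.root i (S.coroot l))⁻¹ * S.root i (S.coroot l))) • S.Y i := by
        rw [hf, pairY, map_neg, map_smul, LinearMap.neg_apply, LinearMap.smul_apply,
          YY_X_right hij, smul_smul, ← neg_smul]
      rw [pow_succ, Module.End.mul_apply, h1]
      exact hfY _ _ hYi
    · refine ⟨1, ?_⟩
      rw [pow_one, hf, pairY, map_neg, map_smul, LinearMap.neg_apply, LinearMap.smul_apply,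
        YY_X_ne hik hjk, smul_zero, neg_zero]
  refine S.induction hX (fun l => ?_) (fun h => ⟨2, ?_⟩) (fun i j x _ y _ => hbr x y) ⟨0, by simp⟩
    ?_ hsmul
  · rcases eq_of_ne hij hik hjk l with rfl | rfl | rfl
    · exact ⟨1, by rw [pow_one, hYi]⟩
    · exact ⟨1, by rw [pow_one, hYj]⟩
    -- `Y_k` is recovered, up to a non-zero scalar, as the bracket of `X_i` with `[Y_i, Y_k]`, for
    -- which the Serre relation is available.
    · have h1 : bracket (S.X i) (bracket (S.Y i) (S.Y l)) =
          -(S.root l (S.coroot i) • S.Y l) := by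
        rw [bracket_odd_odd (S.X_mem i) (S.Y_mem i), S.XY_same, S.HY, S.XY_ne i l hik, map_zero,
          sub_zero]
      have h2 : S.Y l = (-(S.root l (S.coroot i))⁻¹) • bracket (S.X i) (bracket (S.Y i) (S.Y l)) := by
        rw [h1, smul_neg, neg_smul, neg_neg, smul_smul, inv_mul_cancel₀ (hS.off i l hik), one_smul]
      rw [h2]
      exact hsmul _ _ (hbr _ _ (hX i) (hS.exists_pow_pairY_YY hij hik hjk))
  · rw [pow_two, Module.End.mul_apply, t.f_H, map_smul, bracket_self_even t.f_mem, smul_zero]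
  · rintro x y ⟨n, hn⟩ ⟨q, hq⟩
    exact ⟨n + q, by rw [map_add, pow_apply_eq_zero_of_le hn (by omega),
      pow_apply_eq_zero_of_le hq (by omega), add_zero]⟩

theorem locallyNilpotent_XX {i j : Fin 3} (hij : i ≠ j) :
    LocallyNilpotent (bracket (bracket (S.X i) (S.X j))) := by
  have h := hS.swap.locallyNilpotent_pairY hij
  have h1 := hS.off i j hij
  have h2 := hS.off j i hij.symm
  have h3 : bracket (S.X i) (S.X j) =
      (-(S.root j (S.coroot i) * S.root i (S.coroot j))) • S.swap.pairY i j := by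
    have : bracket (S.swap.Y i) (S.swap.Y j) = bracket (S.X i) (S.X j) := by
      simp [OddChevalley.swap]
    rw [pairY, this, smul_neg, neg_smul, neg_neg, smul_smul]
    have h4 : S.swap.root j (S.swap.coroot i) * S.swap.root i (S.swap.coroot j) =
        S.root j (S.coroot i) * S.root i (S.coroot j) := by simp [OddChevalley.swap]
    rw [h4, mul_inv_cancel₀ (mul_ne_zero h1 h2), one_smul]
  rw [h3, map_smul]
  exact h.smul _

end IsTriangle

end OddChevalley

/-! ### Highest weights of integrable modules -/

namespace OddChevalley

variable {L : Type u} [AddCommGroup L] [Module ℂ L] [Superalgebra L]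
  {𝔥 : Type v} [AddCommGroup 𝔥] [Module ℂ 𝔥] (S : OddChevalley L (Fin 3) 𝔥)
  {V : Type w} [AddCommGroup V] [Module ℂ V]

/-- A triangle with a nondegenerate Cartan matrix whose entries have irrational ratios. -/
structure IsGenericTriangle : Prop extends S.IsTriangle where
  irrational : ∀ i j k, i ≠ j → i ≠ k → j ≠ k → ∀ p q : ℤ,
    (p : ℂ) * S.root j (S.coroot i) + q * S.root k (S.coroot i) = 0 → q = 0
  span_coroot : Submodule.span ℂ (Set.range S.coroot) = ⊤

/-- Weights that take integral values on the coroots of the even roots `α_i + α_j`. -/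
def IsIntegral (μ : Module.Dual ℂ 𝔥) : Prop :=
  ∀ i j, i ≠ j → ∃ x : ℤ, μ (S.pairCoroot i j) = x

/-- Weights that take positive integral values on the coroots of the even roots `α_i + α_j`. -/
def IsPositive (μ : Module.Dual ℂ 𝔥) : Prop :=
  ∀ i j, i ≠ j → ∃ x : ℕ, μ (S.pairCoroot i j) = x + 1

variable {S}

theorem IsPositive.isIntegral {μ : Module.Dual ℂ 𝔥} (h : S.IsPositive μ) : S.IsIntegral μ :=
  fun i j hij => by
    obtain ⟨x, hx⟩ := h i j hij
    exact ⟨x + 1, by rw [hx]; push_cast; ring⟩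

theorem exists_ne_ne {i j : Fin 3} (hij : i ≠ j) : ∃ k, i ≠ k ∧ j ≠ k := by
  revert i j; decide

theorem exists_ne_ne_ne (i : Fin 3) : ∃ j k, i ≠ j ∧ i ≠ k ∧ j ≠ k := by
  revert i; decide

namespace IsTriangle

variable (hS : S.IsTriangle)

include hS

/-- `Y_i m`, when non-zero, plays the role of the highest weight vector for the base reflected at
α_i, in which α_i + α_j is simple. -/
theorem act_XX_Y {M : SuperModule L V} {lam : Module.Dual ℂ 𝔥} {m : V}
    (hm : S.IsHighestVector M lam m) {i j : Fin 3} (hij : i ≠ j) :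
    M.act (bracket (S.X i) (S.X j)) (M.act (S.Y i) m) = 0 := by
  have h := M.act_odd (S.X_mem i) (S.X_mem j) (M.act (S.Y i) m)
  rw [S.act_X_Y, S.act_X_Y, if_neg hij.symm, if_pos rfl, hm.act_X, hm.act_X, map_zero, sub_zero,
    sub_zero, map_zero, eq_comm, hm.act_H, map_smul, hm.act_X, smul_zero, sub_zero] at h
  exact h

theorem act_H_Y_highest {M : SuperModule L V} {lam : Module.Dual ℂ 𝔥} {m : V}
    (hm : S.IsHighestVector M lam m) (h : 𝔥) (i : Fin 3) :
    M.act (S.H h) (M.act (S.Y i) m) = (lam h - S.root i h) • M.act (S.Y i) m := by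
  rw [S.act_H_Y, hm.act_H, map_smul, sub_smul]

theorem act_Y_ne_zero {M : SuperModule L V} {lam : Module.Dual ℂ 𝔥} {m : V}
    (hm : S.IsHighestVector M lam m) {i : Fin 3} (hi : lam (S.coroot i) ≠ 0) :
    M.act (S.Y i) m ≠ 0 := fun h0 => by
  have h := S.act_X_Y M i i m
  rw [h0, if_pos rfl, hm.act_X, map_zero, map_zero, sub_zero, hm.act_H, eq_comm] at h
  exact (smul_ne_zero hi hm.ne_zero) h

variable [IsLieSuperalgebra L]

theorem locallyNilpotent_act_XX {M : SuperModule L V} {lam : Module.Dual ℂ 𝔥} {m : V}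
    (hirr : M.IsIrreducible) (hm : S.IsHighestVector M lam m) (i j : Fin 3) :
    LocallyNilpotent (M.act (bracket (S.X i) (S.X j))) :=
  hm.exists_pow_eq_zero hirr (k := 2) two_ne_zero (by
    rw [bracket_even_left (S.H_mem _), S.HX, S.HX, map_smul, map_smul, LinearMap.smul_apply,
      S.root_deg, S.root_deg]
    push_cast; module)

/-- The primitive vector is `Y_i m`, not `m`; its weight is smaller by α_i(h_ij) = 1, which turns
natural numbers into positive ones. -/
theorem exists_nat_of_locallyNilpotent {M : SuperModule L V} {lam : Module.Dual ℂ 𝔥} {m : V}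
    (hm : S.IsHighestVector M lam m) {i j : Fin 3} (hij : i ≠ j)
    (hf : LocallyNilpotent (M.act (S.pairY i j))) (hi : lam (S.coroot i) ≠ 0) :
    ∃ x : ℕ, lam (S.pairCoroot i j) = x + 1 := by
  obtain ⟨n, hn⟩ := hf (M.act (S.Y i) m)
  obtain ⟨x, hx⟩ := (hS.triple hij).exists_nat_of_pow_eq_zero M (hS.act_Y_ne_zero hm hi)
    (hS.act_H_Y_highest hm _ i) (hS.act_XX_Y hm hij) hn
  exact ⟨x, by rw [← hx, hS.root_left hij, sub_add_cancel]⟩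

/-- The vectors killed by a power of f form a submodule. It contains the non-zero vector `Y_i m`,
whose image under f^(x+1) vanishes for lack of singular vectors below the top; irreducibility does
the rest. -/
theorem locallyNilpotent_act_pairY {M : SuperModule L V} {lam : Module.Dual ℂ 𝔥} {m : V}
    (hirr : M.IsIrreducible) (hm : S.IsHighestVector M lam m) {i j : Fin 3} (hij : i ≠ j)
    (hi : lam (S.coroot i) ≠ 0) {x : ℕ} (hx : lam (S.pairCoroot i j) = x + 1) :
    LocallyNilpotent (M.act (S.pairY i j)) := by
  obtain ⟨k, hik, hjk⟩ := exists_ne_ne hij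
  obtain ⟨d, hd⟩ := hm.homogeneous
  have t := hS.triple hij
  obtain ⟨N, hN, hmem⟩ := M.isSubmodule_locallyNilpotent t.f_mem (hS.locallyNilpotent_pairY hij)
  have hw : M.act (S.Y i) m ∈ N := by
    refine (hmem _).2 ⟨x + 1, hS.pow_pairY_eq_zero hij hik hjk (hm.singularFree hirr)
      (M.act_mem (S.Y_mem i) hd) (hS.act_H_Y_highest hm _ i) ?_ ?_ ?_ ?_ (hS.act_XX_Y hm hij) ?_⟩
    · intro h
      rw [S.root_deg] at h
      have : ((2 * x + 3 : ℕ) : ℂ) = 0 := by push_cast; linear_combination -h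
      exact absurd (Nat.cast_eq_zero.1 this) (by omega)
    · intro h
      rw [S.root_deg] at h
      have : ((2 * x + 2 : ℕ) : ℂ) = 0 := by push_cast; linear_combination -h
      exact absurd (Nat.cast_eq_zero.1 this) (by omega)
    · rw [hS.act_H_Y_highest hm, hx, hS.root_left hij, add_sub_cancel_right]
    · rw [M.act_odd (S.Y_mem i) (S.Y_mem i), hS.Y_Y, map_zero, LinearMap.zero_apply, zero_sub,
        neg_eq_zero]
      have := M.act_odd (S.Y_mem i) (S.Y_mem i) m
      rw [hS.Y_Y, map_zero, LinearMap.zero_apply, zero_sub, eq_neg_iff_add_eq_zero,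
        ← two_smul ℂ] at this
      exact (smul_eq_zero_iff_right two_ne_zero).1 this
    · rw [act_pow_comm M t.f_mem (hS.pairY_XX hij hik hjk), hS.act_XX_Y hm hik, map_zero]
  rcases hirr.2 N hN with rfl | rfl
  · exact absurd ((Submodule.mem_bot ℂ).1 hw) (hS.act_Y_ne_zero hm hi)
  · exact fun u => (hmem u).1 trivial

end IsTriangle

namespace IsGenericTriangle

variable (hS : S.IsGenericTriangle)

include hS

theorem ext_coroot {μ ν : Module.Dual ℂ 𝔥} (h : ∀ i, μ (S.coroot i) = ν (S.coroot i)) : μ = ν :=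
  LinearMap.ext_on_range hS.span_coroot h

/-- The values on h_ij and h_ik show that μ agrees with xα_i on h_j and with zα_i on h_k.
Integrality on h_jk is then a rational relation between two entries of row `j` with coefficient x -
z, so x = z. On h_i both μ and α_i vanish. -/
theorem eq_smul_root {μ : Module.Dual ℂ 𝔥} (hμ : S.IsIntegral μ) {i : Fin 3}
    (hi : μ (S.coroot i) = 0) : ∃ x : ℤ, μ = (x : ℂ) • S.root i := by
  obtain ⟨j, k, hij, hik, hjk⟩ := exists_ne_ne_ne i
  obtain ⟨x, hx⟩ := hμ i j hij
  obtain ⟨z, hz⟩ := hμ i k hik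
  obtain ⟨y, hy⟩ := hμ j k hjk
  obtain ⟨N, hN⟩ := hS.exists_nat j k i hjk hij.symm hik.symm
  have hji := hS.off j i hij.symm
  have hki := hS.off k i hik.symm
  have hj' := hS.off j k hjk
  have hk' := hS.off k j hjk.symm
  simp only [pairCoroot, map_add, map_smul, smul_eq_mul, hi, mul_zero, zero_add] at hx hy hz hN
  have hj : μ (S.coroot j) = x * S.root i (S.coroot j) := by rw [← hx]; field_simp
  have hk : μ (S.coroot k) = z * S.root i (S.coroot k) := by rw [← hz]; field_simp
  rw [hj, hk] at hy
  have hxz : x - z = 0 := by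
    refine hS.irrational j k i hjk hij.symm hik.symm (-z * (N + 2) - y) (x - z) ?_
    have h1 : (S.root k (S.coroot j))⁻¹ * S.root k (S.coroot j) = 1 := inv_mul_cancel₀ hj'
    push_cast
    have h2 : (x - z : ℂ) * ((S.root k (S.coroot j))⁻¹ * S.root i (S.coroot j)) =
        y + z * (N + 2) := by linear_combination hy - z * hN
    linear_combination S.root k (S.coroot j) * h2 - (x - z : ℂ) * S.root i (S.coroot j) * h1
  rw [← sub_eq_zero.1 hxz] at hk
  refine ⟨x, hS.ext_coroot fun l => ?_⟩
  rcases eq_of_ne hij hik hjk l with rfl | rfl | rfl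
  · simp [hi, hS.diag]
  · simpa using hj
  · simpa using hk

/-- Otherwise λ = xα_i, with x > 0 from the value on h_ij, whereas the value on h_jk is -x(N + 2) <
0. -/
theorem coroot_ne_zero_of_isPositive {lam : Module.Dual ℂ 𝔥} (h : S.IsPositive lam) (i : Fin 3) :
    lam (S.coroot i) ≠ 0 := fun hi => by
  obtain ⟨j, k, hij, hik, hjk⟩ := exists_ne_ne_ne i
  obtain ⟨x, rfl⟩ := hS.eq_smul_root h.isIntegral hi
  obtain ⟨p, hp⟩ := h i j hij
  obtain ⟨q, hq⟩ := h j k hjk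
  obtain ⟨N, hN⟩ := hS.exists_nat j k i hjk hij.symm hik.symm
  rw [LinearMap.smul_apply, hS.root_left hij, smul_eq_mul, mul_one] at hp
  rw [LinearMap.smul_apply, eq_sub_of_add_eq hN, hp, smul_eq_mul] at hq
  have : (((p + 1) * (N + 2) + q + 1 : ℕ) : ℂ) = 0 := by push_cast; linear_combination -hq
  exact absurd (Nat.cast_eq_zero.1 this) (by omega)

/-- Each `Y_i m` is singular below the top, hence zero, so the line through `m` is a submodule on
which everything acts by zero. -/
theorem isTrivial_of_eq_zero {M : SuperModule L V} {m : V} (hirr : M.IsIrreducible)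
    (hm : S.IsHighestVector M 0 m) : M.IsTrivial := by
  obtain ⟨d, hd⟩ := hm.homogeneous
  have hY : ∀ i, M.act (S.Y i) m = 0 := fun i => by
    refine hm.singularFree hirr (0 - 1) ?_ _ _ (M.act_mem (S.Y_mem i) hd) ?_ fun l => ?_
    · simp
    · rw [hS.toIsTriangle.act_H_Y_highest hm, S.root_deg, LinearMap.zero_apply]
    · rw [S.act_X_Y, hm.act_X, map_zero, sub_zero]
      split_ifs
      · rw [hm.act_H]; simp
      · rfl
  have hact : ∀ x, M.act x m = 0 := fun x => by
    refine S.induction (P := fun x => M.act x m = 0) hm.act_X hY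
      (fun h => by rw [hm.act_H]; simp) (fun i j x hx y hy h1 h2 => ?_) (by simp)
      (fun x y h1 h2 => by rw [map_add, LinearMap.add_apply, h1, h2, add_zero])
      (fun c x h => by rw [map_smul, LinearMap.smul_apply, h, smul_zero]) x
    rw [M.act_bracket m hx hy, h1, h2]; simp
  have hz : ∀ x, ∀ u ∈ Submodule.span ℂ {m}, M.act x u = 0 := fun x u hu => by
    obtain ⟨c, rfl⟩ := Submodule.mem_span_singleton.1 hu
    rw [map_smul, hact, smul_zero]
  rcases hirr.2 (Submodule.span ℂ {m}) ⟨fun x u hu => by rw [hz x u hu]; exact Submodule.zero_mem _,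
    M.span_le_graded _ (by rintro _ rfl; exact ⟨d, hd⟩)⟩ with h | h
  · exact absurd (Submodule.span_singleton_eq_bot.1 h) hm.ne_zero
  · exact fun x u => hz x u (by rw [h]; trivial)

variable [IsLieSuperalgebra L]

theorem isPositive_of_locallyNilpotent {M : SuperModule L V} {lam : Module.Dual ℂ 𝔥} {m : V}
    (hirr : M.IsIrreducible) (hm : S.IsHighestVector M lam m)
    (hf : ∀ i j, i ≠ j → LocallyNilpotent (M.act (S.pairY i j))) (hM : ¬ M.IsTrivial) :
    S.IsPositive lam := by
  have key : ∀ i j, i ≠ j → lam (S.coroot i) ≠ 0 → ∃ x : ℕ, lam (S.pairCoroot i j) = x + 1 :=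
    fun i j hij hi => hS.toIsTriangle.exists_nat_of_locallyNilpotent hm hij (hf i j hij) hi
  intro i j hij
  by_cases hi : lam (S.coroot i) = 0
  · by_cases hj : lam (S.coroot j) = 0
    · obtain ⟨k, hik, hjk⟩ := exists_ne_ne hij
      by_cases hk : lam (S.coroot k) = 0
      · refine absurd (hS.isTrivial_of_eq_zero hirr (m := m) ?_) hM
        have h0 : lam = 0 := hS.ext_coroot fun l => by
          rcases eq_of_ne hij hik hjk l with rfl | rfl | rfl <;> simpa
        rwa [← h0]
      -- If only λ(h_k) is non-zero, then λ(h_k)/a_ki and λ(h_k)/a_kj are both positive integers,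
      -- making the ratio of these entries rational.
      · obtain ⟨x, hx⟩ := key k i hik.symm hk
        obtain ⟨y, hy⟩ := key k j hjk.symm hk
        have h1 := hS.off k i hik.symm
        have h2 := hS.off k j hjk.symm
        simp only [pairCoroot, map_add, map_smul, smul_eq_mul, hi, hj, mul_zero, add_zero] at hx hy
        have := hS.irrational k i j hik.symm hjk.symm hij (x + 1) (-(y + 1)) (by
          push_cast
          rw [← hx, neg_mul, ← hy]
          field_simp
          ring)
        omega
    · rw [pairCoroot_comm]; exact key j i hij.symm hj
  · exact key i j hij hi

end IsGenericTriangle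

end OddChevalley

/-! ### Twists of bases -/

namespace Base

variable {ι : Type} [Fintype ι] [DecidableEq ι] {𝔥 : Type u} [AddCommGroup 𝔥] [Module ℂ 𝔥]

/-- `B` is the image of `B₀` under `σ`, up to non-zero scalars in front of the coroots. -/
def IsTwist (σ : 𝔥 ≃ₗ[ℂ] 𝔥) (B₀ B : Base ι 𝔥) : Prop :=
  ∃ c : ι → ℂ, (∀ i, c i ≠ 0) ∧ (∀ i h, B.root i (σ h) = B₀.root i h) ∧
    (∀ i, B.coroot i = c i • σ (B₀.coroot i)) ∧ B.parity = B₀.parity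

variable {σ τ : 𝔥 ≃ₗ[ℂ] 𝔥} {B₀ B₁ B : Base ι 𝔥}

theorem IsTwist.refl (B : Base ι 𝔥) : IsTwist 1 B B :=
  ⟨fun _ => 1, fun _ => one_ne_zero, fun _ _ => rfl, fun _ => (one_smul ℂ _).symm, rfl⟩

theorem IsTwist.trans (h₁ : IsTwist σ B₀ B₁) (h₂ : IsTwist τ B₁ B) : IsTwist (τ * σ) B₀ B := by
  obtain ⟨c, hc, hr, hco, hp⟩ := h₁
  obtain ⟨c', hc', hr', hco', hp'⟩ := h₂
  refine ⟨fun i => c' i * c i, fun i => mul_ne_zero (hc' i) (hc i), fun i h => ?_, fun i => ?_,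
    hp'.trans hp⟩
  · rw [← hr, ← hr']; rfl
  · rw [hco', hco, map_smul, smul_smul]; rfl

theorem IsTwist.exists_cartan (h : IsTwist σ B₀ B) :
    ∃ c : ι → ℂ, (∀ i, c i ≠ 0) ∧ ∀ i j, B.cartan i j = c i * B₀.cartan i j := by
  obtain ⟨c, hc, hr, hco, hp⟩ := h
  exact ⟨c, hc, fun i j => by rw [cartan, cartan, hco, map_smul, hr, smul_eq_mul]⟩

theorem IsTwist.cartan_eq_zero (h : IsTwist σ B₀ B) (i j : ι) :
    B.cartan i j = 0 ↔ B₀.cartan i j = 0 := by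
  obtain ⟨c, hc, hcc⟩ := h.exists_cartan
  rw [hcc, mul_eq_zero, or_iff_right (hc i)]

theorem IsTwist.isIsotropic (h : IsTwist σ B₀ B) {i : ι} (hi : B.IsIsotropic i) :
    B₀.IsIsotropic i := by
  refine ⟨(h.cartan_eq_zero i i).1 hi.1, ?_⟩
  obtain ⟨c, hc, hr, hco, hp⟩ := h
  exact hp ▸ hi.2

/-- The root reflection uses only ratios within row `k`, which do not see the scaling of the coroot;
each reflected coroot keeps its old scalar. -/
theorem IsTwist.evenReflection (h : IsTwist σ B₀ B) (k : ι) :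
    IsTwist σ (B₀.evenReflection k) (B.evenReflection k) := by
  obtain ⟨c, hc, hr, hco, hp⟩ := h
  have hcc : ∀ i j, B.cartan i j = c i * B₀.cartan i j := fun i j => by
    rw [cartan, cartan, hco, map_smul, hr, smul_eq_mul]
  have hck : (c k)⁻¹ * c k = 1 := inv_mul_cancel₀ (hc k)
  refine ⟨c, hc, fun i h => ?_, fun i => ?_, hp⟩
  · simp only [Base.evenReflection, LinearMap.sub_apply, LinearMap.smul_apply, hr, hcc, smul_eq_mul]
    linear_combination (-(2 / B₀.cartan k k * B₀.cartan k i * B₀.root k h)) * hck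
  · simp only [Base.evenReflection, hcc, hco, map_sub, map_smul, smul_sub, smul_smul]
    congr 2
    linear_combination (2 / B₀.cartan k k * (c i * B₀.cartan i k)) * hck

theorem IsTwist.oddReflection (h : IsTwist σ B₀ B) (k : ι) :
    IsTwist σ (B₀.oddReflection k) (B.oddReflection k) := by
  classical
  have hz := h.cartan_eq_zero
  obtain ⟨c, hc, hr, hco, hp⟩ := h
  have hcc : ∀ i j, B.cartan i j = c i * B₀.cartan i j := fun i j => by
    rw [cartan, cartan, hco, map_smul, hr, smul_eq_mul]
  -- A reflected coroot is bilinear in the data of rows `i` and `k`, so its scalar is the product of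
  -- the two.
  refine ⟨fun i => if i = k then c k
    else if B₀.cartan i k = 0 ∧ B₀.cartan k i = 0 then c i else c i * c k, fun i => ?_,
    fun i h => ?_, fun i => ?_, ?_⟩
  · dsimp only
    split_ifs
    exacts [hc k, hc i, mul_ne_zero (hc i) (hc k)]
  · simp only [Base.oddReflection, hz]
    split_ifs <;> simp [hr]
  · simp only [Base.oddReflection, hz, hp]
    split_ifs
    · exact hco k
    · exact hco i
    all_goals
      simp only [hco, hcc, map_add, map_smul, smul_add, smul_smul]
      congr 2 <;> ring
  · funext i
    simp only [Base.oddReflection, hz, hp]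

/-- An even reflection is a twist. -/
theorem isTwist_evenReflection (B : Base ι 𝔥) (k : ι) {hβ : 𝔥}
    (hβk : (2 / B.cartan k k) • B.coroot k = hβ) (hσ : ∀ h, σ h = coReflection (B.root k) hβ h)
    (h2 : B.root k hβ = 2) :
    IsTwist σ B (B.evenReflection k) := by
  have hr : ∀ i h, (B.evenReflection k).root i h = B.root i (coReflection (B.root k) hβ h) := by
    intro i h
    simp only [Base.evenReflection, coReflection_apply, ← hβk, LinearMap.sub_apply,
      LinearMap.smul_apply, map_sub, map_smul, smul_eq_mul]
    rw [cartan, cartan]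
    ring
  refine ⟨fun _ => 1, fun _ => one_ne_zero, fun i h => ?_, fun i => ?_, rfl⟩
  · rw [hr, hσ, coReflection_involutive h2]
  · rw [one_smul, hσ, coReflection_apply, ← hβk, smul_smul]
    simp only [Base.evenReflection]
    rw [mul_comm (B.root k _)]; rfl

end Base

namespace OddChevalley

variable {L : Type w} [AddCommGroup L] [Module ℂ L] [Superalgebra L]
  {𝔥 : Type u} [AddCommGroup 𝔥] [Module ℂ 𝔥] (S : OddChevalley L (Fin 3) 𝔥)

/-- The base formed by the simple roots. -/
def toBase : Base (Fin 3) 𝔥 := ⟨S.root, S.coroot, fun _ => 1⟩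

variable {S} (hS : S.IsTriangle)

/-- The reflection in the even root `α_i + α_j`. -/
noncomputable def IsTriangle.pairReflection {i j : Fin 3} (hij : i ≠ j) : 𝔥 ≃ₗ[ℂ] 𝔥 :=
  LinearEquiv.ofInvolutive (coReflection (S.root i + S.root j) (S.pairCoroot i j))
    (coReflection_involutive (by
      rw [LinearMap.add_apply, hS.root_left hij, hS.root_right hij]; norm_num))

/-- The group generated by the reflections in the even roots `α_i + α_j`. -/
def IsTriangle.weylGroup : Subgroup (𝔥 ≃ₗ[ℂ] 𝔥) :=
  Subgroup.closure {σ | ∃ (i j : Fin 3) (hij : i ≠ j), σ = hS.pairReflection hij}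

namespace IsTriangle

theorem pairReflection_apply {i j : Fin 3} (hij : i ≠ j) (h : 𝔥) :
    hS.pairReflection hij h = h - (S.root i h + S.root j h) • S.pairCoroot i j := rfl

theorem pairReflection_mem {i j : Fin 3} (hij : i ≠ j) : hS.pairReflection hij ∈ hS.weylGroup :=
  Subgroup.subset_closure ⟨i, j, hij, rfl⟩

/-- A property of weights that is stable under the generators of the Weyl group is stable. -/
theorem weylGroup_stable {P : Module.Dual ℂ 𝔥 → Prop}
    (hP : ∀ i j (hij : i ≠ j) μ, P μ → P (μ ∘ₗ (hS.pairReflection hij).toLinearMap))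
    {σ : 𝔥 ≃ₗ[ℂ] 𝔥} (hσ : σ ∈ hS.weylGroup) {μ : Module.Dual ℂ 𝔥} (hμ : P μ) :
    P (μ ∘ₗ σ.toLinearMap) := by
  induction hσ using Subgroup.closure_induction'' generalizing μ with
  | mem σ h => obtain ⟨i, j, hij, rfl⟩ := h; exact hP i j hij μ hμ
  | inv_mem σ h => obtain ⟨i, j, hij, rfl⟩ := h; exact hP i j hij μ hμ
  | one => exact hμ
  | mul σ τ _ _ h1 h2 => exact h2 (h1 hμ)

include hS

theorem cartan_oddReflection_left (k i : Fin 3) (hik : i ≠ k) :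
    ¬ (S.toBase.cartan i k = 0 ∧ S.toBase.cartan k i = 0) := fun h => hS.off i k hik h.1

theorem oddReflection_root_self (k : Fin 3) : (S.toBase.oddReflection k).root k = -S.root k := by
  simp [Base.oddReflection, toBase]

theorem oddReflection_coroot_self (k : Fin 3) :
    (S.toBase.oddReflection k).coroot k = S.coroot k := by
  simp [Base.oddReflection, toBase]

theorem oddReflection_root {i k : Fin 3} (hik : i ≠ k) :
    (S.toBase.oddReflection k).root i = S.root i + S.root k := by
  simp only [Base.oddReflection, if_neg hik, if_neg (hS.cartan_oddReflection_left k i hik)]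
  rfl

/-- After the odd reflection the two other simple roots are the even roots α_i + α_k, and their
coroots are proportional to the normalized ones; even reflections of that base are thus the
reflections of the `sl₂`-triples. -/
theorem oddReflection_coroot {i k : Fin 3} (hik : i ≠ k) :
    (S.toBase.oddReflection k).coroot i =
      (-(S.root k (S.coroot i) * S.root i (S.coroot k))) • S.pairCoroot i k := by
  have h1 := hS.off i k hik
  have h2 := hS.off k i hik.symm
  simp only [Base.oddReflection, if_neg hik, if_neg (hS.cartan_oddReflection_left k i hik)]
  rw [if_pos (show S.toBase.parity i = 1 from rfl), pairCoroot, neg_smul, one_smul, neg_smul,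
    smul_add, smul_smul, smul_smul, mul_inv_cancel_right₀ h2, mul_comm (S.root k _),
    mul_inv_cancel_right₀ h1, add_comm]
  rfl

theorem oddReflection_parity_self (k : Fin 3) : (S.toBase.oddReflection k).parity k = 1 := by
  simp [Base.oddReflection, toBase]

theorem oddReflection_parity {i k : Fin 3} (hik : i ≠ k) :
    (S.toBase.oddReflection k).parity i = 0 := by
  simp only [Base.oddReflection, if_neg hik, if_neg (hS.cartan_oddReflection_left k i hik)]
  change (1 + 1 : ZMod 2) = 0
  rfl

theorem oddReflection_cartan_self (k : Fin 3) : (S.toBase.oddReflection k).cartan k k = 0 := by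
  rw [Base.cartan, hS.oddReflection_root_self, hS.oddReflection_coroot_self, LinearMap.neg_apply,
    hS.diag, neg_zero]

theorem oddReflection_cartan {i k : Fin 3} (hik : i ≠ k) :
    (S.toBase.oddReflection k).cartan i i =
      -(S.root k (S.coroot i) * S.root i (S.coroot k)) * 2 := by
  rw [Base.cartan, hS.oddReflection_root hik, hS.oddReflection_coroot hik, map_smul,
    LinearMap.add_apply, hS.root_left hik, hS.root_right hik, smul_eq_mul]
  norm_num

theorem oddReflection_cartan_ne_zero {i k : Fin 3} (hik : i ≠ k) :
    (S.toBase.oddReflection k).cartan i i ≠ 0 := by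
  rw [hS.oddReflection_cartan hik]
  exact mul_ne_zero (neg_ne_zero.2 (mul_ne_zero (hS.off i k hik) (hS.off k i hik.symm))) two_ne_zero

theorem isTwist_evenReflection_oddReflection {i k : Fin 3} (hik : i ≠ k) :
    Base.IsTwist (hS.pairReflection hik) (S.toBase.oddReflection k)
      ((S.toBase.oddReflection k).evenReflection i) := by
  refine Base.isTwist_evenReflection _ i (hβ := S.pairCoroot i k) ?_ (fun h => ?_) ?_
  · have h1 := hS.off i k hik
    have h2 := hS.off k i hik.symm
    rw [hS.oddReflection_cartan hik, hS.oddReflection_coroot hik, smul_smul]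
    have : 2 / (-(S.root k (S.coroot i) * S.root i (S.coroot k)) * 2) *
        -(S.root k (S.coroot i) * S.root i (S.coroot k)) = 1 := by
      field_simp
    rw [this, one_smul]
  · rw [hS.oddReflection_root hik]; rfl
  · rw [hS.oddReflection_root hik, LinearMap.add_apply, hS.root_left hik, hS.root_right hik]
    norm_num

theorem isTwist_oddReflection_oddReflection (k : Fin 3) :
    Base.IsTwist 1 S.toBase ((S.toBase.oddReflection k).oddReflection k) := by
  classical
  set B := S.toBase.oddReflection k with hB
  have hik : ∀ i, i ≠ k → B.cartan i k = S.root k (S.coroot i) * S.root i (S.coroot k) := by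
    intro i hi
    rw [Base.cartan, hS.oddReflection_root_self, hS.oddReflection_coroot hi, map_smul,
      LinearMap.neg_apply, hS.root_right hi, smul_eq_mul]
    ring
  have hki : ∀ i, i ≠ k → B.cartan k i = S.root i (S.coroot k) := by
    intro i hi
    rw [Base.cartan, hS.oddReflection_root hi, hS.oddReflection_coroot_self, LinearMap.add_apply,
      hS.diag, add_zero]
  have hne : ∀ i, i ≠ k → ¬ (B.cartan i k = 0 ∧ B.cartan k i = 0) := fun i hi h =>
    hS.off k i hi.symm (by rw [← hki i hi]; exact h.2)
  -- The roots return exactly. In the coroot of `i` the two multiples of h_k cancel and -a_ki² h_i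
  -- remains.
  refine ⟨fun i => if i = k then 1 else -(S.root i (S.coroot k)) ^ 2, fun i => ?_, fun i h => ?_,
    fun i => ?_, ?_⟩
  · dsimp only
    split_ifs with hi
    · exact one_ne_zero
    · exact neg_ne_zero.2 (pow_ne_zero 2 (hS.off k i (Ne.symm hi)))
  · by_cases hi : i = k
    · subst hi
      simp only [Base.oddReflection, if_true]
      rw [hS.oddReflection_root_self, neg_neg]; rfl
    · simp only [Base.oddReflection, if_neg hi, if_neg (hne i hi)]
      rw [hS.oddReflection_root hi, hS.oddReflection_root_self, add_neg_cancel_right]; rfl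
  · by_cases hi : i = k
    · subst hi
      simp only [Base.oddReflection, if_true, one_smul]
      rw [hS.oddReflection_coroot_self]; rfl
    · simp only [Base.oddReflection, if_neg hi, if_neg (hne i hi)]
      rw [hS.oddReflection_parity hi, if_neg zero_ne_one, one_smul, hik i hi, hki i hi,
        hS.oddReflection_coroot_self, hS.oddReflection_coroot hi, pairCoroot]
      have h1 := hS.off i k hi
      have h2 := hS.off k i (Ne.symm hi)
      change _ = _ • S.coroot i
      match_scalars <;> field_simp
      ring
  · funext i
    by_cases hi : i = k
    · subst hi
      simp only [Base.oddReflection, if_true]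
      exact hS.oddReflection_parity_self i
    · simp only [Base.oddReflection, if_neg hi, if_neg (hne i hi)]
      rw [hS.oddReflection_parity hi, hS.oddReflection_parity_self]; rfl

/-- The bases obtained by reflections are, up to scalars, the images under the Weyl group of the
standard base and of its odd reflections. -/
theorem exists_isTwist_of_reachable {B : Base (Fin 3) 𝔥} (hB : Reachable S.toBase B) :
    ∃ σ ∈ hS.weylGroup, Base.IsTwist σ S.toBase B ∨
      ∃ k, Base.IsTwist σ (S.toBase.oddReflection k) B := by
  induction hB with
  | refl => exact ⟨1, one_mem _, Or.inl (Base.IsTwist.refl _)⟩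
  -- A translate of the standard base has only isotropic roots, so an even reflection occurs only in
  -- a translate of an odd-reflected base, at a root other than the reflected one, and multiplies σ
  -- by a generator.
  | @even B l _ hl ih =>
    obtain ⟨σ, hσ, h | ⟨k, h⟩⟩ := ih
    · exact absurd ((h.cartan_eq_zero l l).2 (hS.diag l)) hl
    · by_cases hlk : l = k
      · subst hlk
        exact absurd ((h.cartan_eq_zero l l).2 (hS.oddReflection_cartan_self l)) hl
      · exact ⟨σ * hS.pairReflection hlk, mul_mem hσ (hS.pairReflection_mem hlk), Or.inr ⟨k,
          (hS.isTwist_evenReflection_oddReflection hlk).trans (h.evenReflection l)⟩⟩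
  | @odd B l _ hl _ ih =>
    obtain ⟨σ, hσ, h | ⟨k, h⟩⟩ := ih
    · exact ⟨σ, hσ, Or.inr ⟨l, h.oddReflection l⟩⟩
    -- In an odd-reflected base only the reflected root is odd; reflecting there again leads back to
    -- the standard family.
    · have hlk : l = k := by
        by_contra hlk
        have := (h.isIsotropic hl).2
        rw [hS.oddReflection_parity hlk] at this
        exact zero_ne_one this
      subst hlk
      exact ⟨σ, hσ, Or.inl ((hS.isTwist_oddReflection_oddReflection l).trans (h.oddReflection l))⟩

/-- The simple roots of the bases obtained by reflections. -/
theorem root_of_reachable {B : Base (Fin 3) 𝔥} (hB : Reachable S.toBase B) (i : Fin 3) :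
    ∃ σ ∈ hS.weylGroup, (∃ j, B.root i = S.root j ∘ₗ σ.toLinearMap) ∨
      ∃ j k, j ≠ k ∧ B.root i = (S.root j + S.root k) ∘ₗ σ.toLinearMap := by
  obtain ⟨σ, hσ, ⟨c, hc, hr, -⟩ | ⟨k, c, hc, hr, -⟩⟩ := hS.exists_isTwist_of_reachable hB
  · refine ⟨σ⁻¹, inv_mem hσ, Or.inl ⟨i, LinearMap.ext fun h => ?_⟩⟩
    have := hr i (σ⁻¹ h)
    rwa [show σ (σ⁻¹ h) = h from σ.apply_symm_apply h] at this
  · by_cases hik : i = k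
    · subst hik
      obtain ⟨j, hij⟩ := exists_ne i
      -- The root -α_i is the image of α_j under the reflection in α_i + α_j, so it too is a
      -- translate of a positive root.
      refine ⟨hS.pairReflection hij.symm * σ⁻¹, mul_mem (hS.pairReflection_mem _) (inv_mem hσ),
        Or.inl ⟨j, LinearMap.ext fun h => ?_⟩⟩
      have := hr i (σ⁻¹ h)
      rw [show σ (σ⁻¹ h) = h from σ.apply_symm_apply h, hS.oddReflection_root_self] at this
      rw [this]
      change _ = S.root j (hS.pairReflection hij.symm (σ⁻¹ h))
      rw [pairReflection_apply, map_sub, map_smul, hS.root_right hij.symm, LinearMap.neg_apply,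
        smul_eq_mul]
      ring
    · refine ⟨σ⁻¹, inv_mem hσ, Or.inr ⟨i, k, hik, LinearMap.ext fun h => ?_⟩⟩
      have := hr i (σ⁻¹ h)
      rwa [show σ (σ⁻¹ h) = h from σ.apply_symm_apply h, hS.oddReflection_root hik] at this

/-- The isotropic simple coroots of the bases obtained by reflections. -/
theorem coroot_of_reachable {B : Base (Fin 3) 𝔥} (hB : Reachable S.toBase B) {i : Fin 3}
    (hi : B.IsIsotropic i) :
    ∃ σ ∈ hS.weylGroup, ∃ c : ℂ, c ≠ 0 ∧ B.coroot i = c • σ (S.coroot i) := by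
  obtain ⟨σ, hσ, h | ⟨k, h⟩⟩ := hS.exists_isTwist_of_reachable hB
  · obtain ⟨c, hc, -, hco, -⟩ := h
    exact ⟨σ, hσ, c i, hc i, hco i⟩
  · have hik : i = k := by
      by_contra hik
      have := (h.isIsotropic hi).2
      rw [hS.oddReflection_parity hik] at this
      exact zero_ne_one this
    subst hik
    obtain ⟨c, hc, -, hco, -⟩ := h
    exact ⟨σ, hσ, c i, hc i, by rw [hco, hS.oddReflection_coroot_self]⟩

/-- The negative of `α_i + α_j` is simple in some base obtained by reflections. -/
theorem exists_reachable_neg {i j : Fin 3} (hij : i ≠ j) :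
    ∃ B, Reachable S.toBase B ∧ -(S.root i + S.root j) = B.root i := by
  refine ⟨_, ((Reachable.refl (B₀ := S.toBase)).odd (B := S.toBase) j ⟨hS.diag j, rfl⟩ fun k hk h0 => ?_).even i
    (hS.oddReflection_cartan_ne_zero hij), ?_⟩
  · exact absurd h0 (hS.off j k hk.symm)
  · simp only [Base.evenReflection]
    rw [div_mul_cancel₀ _ (hS.oddReflection_cartan_ne_zero hij), hS.oddReflection_root hij]
    module

end IsTriangle

end OddChevalley

/-! ### Integrability and typicality for positive highest weights -/

namespace OddChevalley

variable {L : Type w} [AddCommGroup L] [Module ℂ L] [Superalgebra L] [IsLieSuperalgebra L]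
  {𝔥 : Type u} [AddCommGroup 𝔥] [Module ℂ 𝔥] {S : OddChevalley L (Fin 3) 𝔥}
  {V : Type v} [AddCommGroup V] [Module ℂ V]

namespace IsTriangle

variable (hS : S.IsTriangle)

include hS

/-- Root vectors of positive degree are locally nilpotent because degrees are bounded above, and
conjugation by exp(e) exp(-f) exp(e) transports nilpotency along the Weyl group. -/
theorem locallyNilpotent_of_root_comp {M : SuperModule L V} {lam : Module.Dual ℂ 𝔥} {m : V}
    (hirr : M.IsIrreducible) (hm : S.IsHighestVector M lam m)
    (hf : ∀ i j, i ≠ j → LocallyNilpotent (M.act (S.pairY i j))) {α : Module.Dual ℂ 𝔥} {k : ℕ}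
    (hk : k ≠ 0) (hα : α S.deg = k) {σ : 𝔥 ≃ₗ[ℂ] 𝔥} (hσ : σ ∈ hS.weylGroup) {x : L}
    (hx : ∀ h, bracket (S.H h) x = (α ∘ₗ σ.toLinearMap) h • x) : LocallyNilpotent (M.act x) := by
  have key := hS.weylGroup_stable (P := fun α => ∀ x, (∀ h, bracket (S.H h) x = α h • x) →
    LocallyNilpotent (M.act x)) ?_ hσ (μ := α) ?_
  · exact key x hx
  · intro i j hij μ hμ x hx
    exact (hS.triple hij).locallyNilpotent_reflect (hS.locallyNilpotent_XX hij)
      (hS.locallyNilpotent_pairY hij) M (hS.locallyNilpotent_act_XX hirr hm i j) (hf i j hij) hμ hx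
  · intro x hx
    exact hm.exists_pow_eq_zero hirr hk (by rw [hx, hα])

/-- Root vectors of real roots act locally nilpotently if the negative even simple ones do. -/
theorem locallyNilpotent_of_reachable {M : SuperModule L V} {lam : Module.Dual ℂ 𝔥} {m : V}
    (hirr : M.IsIrreducible) (hm : S.IsHighestVector M lam m)
    (hf : ∀ i j, i ≠ j → LocallyNilpotent (M.act (S.pairY i j))) {B : Base (Fin 3) 𝔥}
    (hB : Reachable S.toBase B) {i : Fin 3} {α : Module.Dual ℂ 𝔥}
    (hα : α = B.root i ∨ α = (2 : ℂ) • B.root i) {x : L}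
    (hx : ∀ h, bracket (S.H h) x = α h • x) : LocallyNilpotent (M.act x) := by
  -- The four cases α_j, 2α_j, α_j + α_k and its double have degrees 1, 2, 2 and 4.
  obtain ⟨σ, hσ, ⟨j, hj⟩ | ⟨j, k, -, hj⟩⟩ := hS.root_of_reachable hB i <;> rw [hj] at hα <;>
    rcases hα with rfl | rfl
  · exact hS.locallyNilpotent_of_root_comp hirr hm hf (k := 1) one_ne_zero
      (by simp [S.root_deg]) hσ hx
  · rw [← LinearMap.smul_comp] at hx
    exact hS.locallyNilpotent_of_root_comp hirr hm hf (k := 2) two_ne_zero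
      (by simp [S.root_deg]) hσ hx
  · exact hS.locallyNilpotent_of_root_comp hirr hm hf (k := 2) two_ne_zero
      (by simp [S.root_deg]; norm_num) hσ hx
  · rw [← LinearMap.smul_comp] at hx
    exact hS.locallyNilpotent_of_root_comp hirr hm hf (k := 4) four_ne_zero
      (by simp [S.root_deg]; norm_num) hσ hx

theorem root_comp_pairReflection {i j : Fin 3} (hij : i ≠ j) :
    S.root i ∘ₗ (hS.pairReflection hij).toLinearMap = -S.root j := by
  refine LinearMap.ext fun h => ?_
  change S.root i (hS.pairReflection hij h) = _
  rw [pairReflection_apply, map_sub, map_smul, hS.root_left hij, LinearMap.neg_apply, smul_eq_mul]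
  ring

theorem exists_int_root {i j : Fin 3} (hij : i ≠ j) (k : Fin 3) :
    ∃ z : ℤ, S.root k (S.pairCoroot i j) = z := by
  obtain ⟨l, hil, hjl⟩ := exists_ne_ne hij
  obtain ⟨N, hN⟩ := hS.exists_nat i j l hij hil hjl
  rcases eq_of_ne hij hil hjl k with rfl | rfl | rfl
  · exact ⟨1, by rw [hS.root_left hij]; simp⟩
  · exact ⟨1, by rw [hS.root_right hij]; simp⟩
  · exact ⟨-(N + 2), by push_cast; linear_combination hN⟩

theorem isIntegral_comp {μ : Module.Dual ℂ 𝔥} (hμ : S.IsIntegral μ) {i j : Fin 3} (hij : i ≠ j) :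
    S.IsIntegral (μ ∘ₗ (hS.pairReflection hij).toLinearMap) := by
  intro k l hkl
  obtain ⟨x, hx⟩ := hμ k l hkl
  obtain ⟨y, hy⟩ := hμ i j hij
  obtain ⟨p, hp⟩ := hS.exists_int_root hkl i
  obtain ⟨q, hq⟩ := hS.exists_int_root hkl j
  refine ⟨x - (p + q) * y, ?_⟩
  change μ (hS.pairReflection hij _) = _
  rw [pairReflection_apply, map_sub, map_smul, hx, hy, hp, hq, smul_eq_mul]
  push_cast; ring

end IsTriangle

namespace IsGenericTriangle

variable (hS : S.IsGenericTriangle)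

include hS

theorem locallyNilpotent_pairY_of_isPositive {M : SuperModule L V} {lam : Module.Dual ℂ 𝔥} {m : V}
    (hirr : M.IsIrreducible) (hm : S.IsHighestVector M lam m) (hlam : S.IsPositive lam) (i j : Fin 3)
    (hij : i ≠ j) : LocallyNilpotent (M.act (S.pairY i j)) := by
  obtain ⟨x, hx⟩ := hlam i j hij
  exact hS.toIsTriangle.locallyNilpotent_act_pairY hirr hm hij
    (hS.coroot_ne_zero_of_isPositive hlam i) hx

/-- The negative of a positive highest weight is not a weight. -/
theorem not_weight_neg {M : SuperModule L V} {lam : Module.Dual ℂ 𝔥} {m : V}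
    (hirr : M.IsIrreducible) (hm : S.IsHighestVector M lam m) (hlam : S.IsPositive lam) {u : V}
    (hu : u ≠ 0) : ¬ ∀ h, M.act (S.H h) u = (-lam) h • u := by
  intro h
  have h01 : (0 : Fin 3) ≠ 1 := by decide
  have h02 : (0 : Fin 3) ≠ 2 := by decide
  have h12 : (1 : Fin 3) ≠ 2 := by decide
  obtain ⟨x, hx⟩ := hlam 0 1 h01
  obtain ⟨y, hy⟩ := hlam 0 2 h02
  obtain ⟨z, hz⟩ := hlam 1 2 h12
  -- With `d` minus the sum of the three even coroots, each simple root has value N ≥ 0 on `d`, so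
  -- weights take values at most λ(d) there. But λ(d) < 0, while -λ would take the value -λ(d) >
  -- λ(d).
  obtain ⟨q, hq⟩ := hm.eigenvalue hirr
    (d := -(S.pairCoroot 0 1 + S.pairCoroot 0 2 + S.pairCoroot 1 2)) (fun i => by
      have h1 := hS.toIsTriangle
      obtain ⟨N0, hN0⟩ := hS.exists_nat 1 2 0 h12 h01.symm h02.symm
      obtain ⟨N1, hN1⟩ := hS.exists_nat 0 2 1 h02 h01 h12.symm
      obtain ⟨N2, hN2⟩ := hS.exists_nat 0 1 2 h01 h02 h12
      rw [map_neg, map_add, map_add]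
      rcases eq_of_ne h01 h02 h12 i with rfl | rfl | rfl
      · refine ⟨N0, ?_⟩
        rw [h1.root_left h01, h1.root_left h02]; linear_combination -hN0
      · refine ⟨N1, ?_⟩
        rw [h1.root_right h01, h1.root_left h12]; linear_combination -hN1
      · refine ⟨N2, ?_⟩
        rw [h1.root_right h02, h1.root_right h12]; linear_combination -hN2) hu (h _)
  rw [LinearMap.neg_apply, map_neg, map_add, map_add, hx, hy, hz] at hq
  have : ((2 * (x + y + z + 3) + q : ℕ) : ℂ) = 0 := by push_cast; linear_combination hq
  exact absurd (Nat.cast_eq_zero.1 this) (by omega)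

theorem apply_weylGroup_coroot_ne_zero {M : SuperModule L V} {lam : Module.Dual ℂ 𝔥} {m : V}
    (hirr : M.IsIrreducible) (hm : S.IsHighestVector M lam m) (hlam : S.IsPositive lam)
    {σ : 𝔥 ≃ₗ[ℂ] 𝔥} (hσ : σ ∈ hS.toIsTriangle.weylGroup) (i : Fin 3) :
    lam (σ (S.coroot i)) ≠ 0 := by
  intro h0
  have hT := hS.toIsTriangle
  set P : Module.Dual ℂ 𝔥 → Prop := fun μ =>
    S.IsIntegral μ ∧ ∃ u, u ≠ 0 ∧ ∀ h, M.act (S.H h) u = μ h • u with hP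
  have hs : ∀ i j (hij : i ≠ j) μ, P μ → P (μ ∘ₗ (hT.pairReflection hij).toLinearMap) := by
    rintro i j hij μ ⟨hμ, u, hu0, hu⟩
    exact ⟨hT.isIntegral_comp hμ hij, (hT.triple hij).exists_weight_reflect
      (hT.locallyNilpotent_XX hij) (hT.locallyNilpotent_pairY hij) M
      (hT.locallyNilpotent_act_XX hirr hm i j)
      (hS.locallyNilpotent_pairY_of_isPositive hirr hm hlam i j hij) hu0 hu⟩
  have h1 : P (lam ∘ₗ σ.toLinearMap) :=
    hT.weylGroup_stable hs hσ ⟨hlam.isIntegral, m, hm.ne_zero, hm.act_H⟩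
  obtain ⟨x, hx⟩ := hS.eq_smul_root h1.1 h0
  obtain ⟨j, k, hij, hik, hjk⟩ := exists_ne_ne_ne i
  -- The reflections in the pairs (i, j), (j, k), (k, i) carry α_i to -α_j, then α_k, then -α_i, so
  -- they negate xα_i.
  have h3 : P (-(lam ∘ₗ σ.toLinearMap)) := by
    have := hs k i hik.symm _ (hs j k hjk _ (hs i j hij _ h1))
    rwa [hx, LinearMap.smul_comp, LinearMap.smul_comp, LinearMap.smul_comp,
      hT.root_comp_pairReflection, LinearMap.neg_comp, hT.root_comp_pairReflection, neg_neg,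
      hT.root_comp_pairReflection, smul_neg, ← hx] at this
  obtain ⟨-, u, hu0, hu⟩ := hT.weylGroup_stable hs (inv_mem hσ) h3
  refine hS.not_weight_neg hirr hm hlam hu0 fun h => ?_
  rw [hu]
  congr 1
  change -(lam (σ (σ⁻¹ h))) = _
  rw [show σ (σ⁻¹ h) = h from σ.apply_symm_apply h]; rfl

end IsGenericTriangle

end OddChevalley

/-! ### The parameters of `Q^±(m,n,t)` -/

/-- For k ≥ 3 the number k² - 4 lies strictly between (k - 1)² and k², hence is not a square. -/
theorem not_exists_sq_eq {k q r : ℤ} (hk : 3 ≤ k) (hq : q ≠ 0) (h : r ^ 2 = (k ^ 2 - 4) * q ^ 2) :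
    False := by
  obtain ⟨s, rfl⟩ : q ∣ r := (Int.pow_dvd_pow_iff two_ne_zero).1 ⟨k ^ 2 - 4, by rw [h, mul_comm]⟩
  have h1 : s ^ 2 = k ^ 2 - 4 := by
    have : q ^ 2 * (s ^ 2 - (k ^ 2 - 4)) = 0 := by linear_combination h
    rcases mul_eq_zero.1 this with h | h
    · exact absurd (pow_eq_zero_iff two_ne_zero |>.1 h) hq
    · exact sub_eq_zero.1 h
  have h2 : |s| < k := abs_lt_of_sq_lt_sq (by omega) (by omega)
  have h3 : k - 1 < |s| := lt_of_pow_lt_pow_left₀ 2 (abs_nonneg s) (by rw [sq_abs]; nlinarith)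
  omega

namespace IsQParameters

variable {m n t : ℤ} {a b c : ℂ}

theorem rotate (h : IsQParameters m n t a b c) : IsQParameters n t m b c a :=
  ⟨h.n_le, h.t_le, h.m_le, fun h' => h.not_all ⟨h'.2.2, h'.1, h'.2.1⟩, h.b_ne, h.c_ne, h.a_ne,
    h.eq_n, h.eq_t, h.eq_m⟩

/-- Elimination of b and c from the three defining equations. The discriminant is k² - 4, where k is
the product of 1 - m, 1 - n, 1 - t minus their sum. -/
theorem quadratic (h : IsQParameters m n t a b c) :
    ((1 - n) * (1 - t) - 1 : ℂ) * a ^ 2 +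
      ((1 - m) * ((1 - n) * (1 - t) - 1) + (1 - n) - (1 - t)) * a + ((1 - m) * (1 - n) - 1) = 0 := by
  have ha := h.a_ne
  have hb := h.b_ne
  have hc := h.c_ne
  have hm : (m : ℂ) = 1 + a + 1 / b := h.eq_m.symm
  have hn : (n : ℂ) = 1 + b + 1 / c := h.eq_n.symm
  have ht : (t : ℂ) = 1 + c + 1 / a := h.eq_t.symm
  rw [hm, hn, ht]
  field_simp
  ring

theorem eq_zero_of_add_mul_eq_zero (h : IsQParameters m n t a b c) {p q : ℤ}
    (hpq : (p + q * a : ℂ) = 0) : q = 0 := by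
  by_contra hq
  have hm := h.m_le
  have hn := h.n_le
  have ht := h.t_le
  set P : ℤ := (1 - n) * (1 - t) - 1
  set Q : ℤ := (1 - m) * ((1 - n) * (1 - t) - 1) + (1 - n) - (1 - t)
  set R : ℤ := (1 - m) * (1 - n) - 1
  have h1 : P * p ^ 2 - Q * p * q + R * q ^ 2 = 0 := by
    have hp : (p : ℂ) = -(q * a) := by linear_combination hpq
    have : ((P * p ^ 2 - Q * p * q + R * q ^ 2 : ℤ) : ℂ) = 0 := by
      push_cast [P, Q, R]
      rw [hp]
      linear_combination (q : ℂ) ^ 2 * h.quadratic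
    exact_mod_cast this
  -- Completing the square in the quadratic at -p/q. If m = n = t = -1 then k = 2 and the
  -- discriminant vanishes; excluding that case is what gives k ≥ 3.
  refine not_exists_sq_eq (k := (1 - m) * (1 - n) * (1 - t) - (1 - m) - (1 - n) - (1 - t))
    (q := q) (r := 2 * P * p - Q * q) ?_ hq ?_
  · obtain ⟨x, hx⟩ := Int.eq_ofNat_of_zero_le (show 0 ≤ -1 - m by omega)
    obtain ⟨y, hy⟩ := Int.eq_ofNat_of_zero_le (show 0 ≤ -1 - n by omega)
    obtain ⟨z, hz⟩ := Int.eq_ofNat_of_zero_le (show 0 ≤ -1 - t by omega)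
    have hxyz : 0 < x + y + z := by
      by_contra h0
      exact h.not_all ⟨by omega, by omega, by omega⟩
    have e1 : 1 - m = 2 + x := by omega
    have e2 : 1 - n = 2 + y := by omega
    have e3 : 1 - t = 2 + z := by omega
    rw [e1, e2, e3]
    have h4 : (0 : ℤ) < x + y + z := by exact_mod_cast hxyz
    have h5 : (0 : ℤ) ≤ x * y + 2 * (y * z) + 2 * (x * z) + x * y + x * y * z := by positivity
    linarith
  · linear_combination 4 * P * h1

/-- If abc = -1, then 1/b = -ac and 1/c = -ab, and the first two equations combine to an integral
linear equation for a with leading coefficient n - 2. Irrationality gives n = 2, contrary to n ≤ -1.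
-/
theorem one_add_mul_ne_zero (h : IsQParameters m n t a b c) : 1 + a * b * c ≠ 0 := by
  intro h0
  have ha := h.a_ne
  have hb := h.b_ne
  have hc := h.c_ne
  have h1 : 1 / b = -(a * c) := by rw [div_eq_iff hb]; linear_combination h0
  have h2 : 1 / c = -(a * b) := by rw [div_eq_iff hc]; linear_combination h0
  have h3 := h.eq_m
  have h4 := h.eq_n
  rw [h1] at h3
  rw [h2] at h4
  have h5 : (((2 - m) + (m - 1) * (2 - n) : ℤ) + ((n - 2 : ℤ) : ℂ) * a) = 0 := by
    push_cast
    linear_combination -(a * c) * h4 + (1 - a) * h0 - (1 - n : ℂ) * h3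
  have := h.eq_zero_of_add_mul_eq_zero h5
  have := h.n_le
  omega

end IsQParameters

/-! ### The algebras `Q^±(m,n,t)` -/

section Q

variable {m n t : ℤ} {a b c : ℂ} (hQ : IsQParameters m n t a b c)
  {𝔥 : Type u} [AddCommGroup 𝔥] [Module ℂ 𝔥] (R : Realization (cartanQ a b c) 𝔥)

theorem det_cartanQ : (cartanQ a b c).det = 1 + a * b * c := by
  rw [Matrix.det_fin_three]
  simp [cartanQ]

include hQ in
-- The determinant 1 + abc is non-zero, so the rank is 3 and 𝔥 has dimension 3. Weights are
-- therefore determined by their values on the coroots.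
theorem span_coroot_cartanQ : Submodule.span ℂ (Set.range R.coroot) = ⊤ := by
  have := R.finiteDimensional
  refine R.linearIndependent_coroot.span_eq_top_of_card_eq_finrank' ?_
  have h1 := R.finrank_add_rank
  rw [Matrix.rank_of_isUnit _ ((Matrix.isUnit_iff_isUnit_det _).2 (by
    rw [det_cartanQ]; exact isUnit_iff_ne_zero.2 hQ.one_add_mul_ne_zero))] at h1
  omega

theorem exists_nat_of_le {k : ℤ} (hk : k ≤ -1) {z : ℂ} (hz : z = k) : ∃ N : ℕ, z = -(N + 1 : ℂ) := by
  obtain ⟨N, hN⟩ := Int.eq_ofNat_of_zero_le (show 0 ≤ -1 - k by omega)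
  refine ⟨N, ?_⟩
  rw [hz, show k = -((N : ℤ) + 1) by omega]
  push_cast; ring

include hQ in
-- The third root on h_ij, increased by 1, is one of m, n, t; the two off-diagonal entries of each
-- row are 1 and one of a, b, c. Rotating the parameters cyclically reduces the irrationality of b
-- and c to that of a.
theorem isGenericTriangle_chevalley : (chevalley R).IsGenericTriangle where
  diag i := by
    change R.root i (R.coroot i) = 0
    rw [R.root_coroot]
    fin_cases i <;> rfl
  off i j hij := by
    change R.root j (R.coroot i) ≠ 0
    rw [R.root_coroot]
    have := hQ.a_ne
    have := hQ.b_ne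
    have := hQ.c_ne
    fin_cases i <;> fin_cases j <;> simp_all [cartanQ]
  exists_nat i j k hij hik hjk := by
    have hm := @exists_nat_of_le _ hQ.m_le _ hQ.eq_m
    have hn := @exists_nat_of_le _ hQ.n_le _ hQ.eq_n
    have ht := @exists_nat_of_le _ hQ.t_le _ hQ.eq_t
    have h : (chevalley R).root k ((chevalley R).pairCoroot i j) + 1 =
        (cartanQ a b c i j)⁻¹ * cartanQ a b c i k + (cartanQ a b c j i)⁻¹ * cartanQ a b c j k + 1 := by
      change R.root k ((R.root j (R.coroot i))⁻¹ • R.coroot i +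
        (R.root i (R.coroot j))⁻¹ • R.coroot j) + 1 = _
      simp only [map_add, map_smul, R.root_coroot, smul_eq_mul]
    rw [h]
    have e : ∀ x y : ℂ, x = y → (∃ N : ℕ, y = -(N + 1 : ℂ)) → ∃ N : ℕ, x = -(N + 1 : ℂ) := by
      rintro x y rfl h; exact h
    fin_cases i <;> fin_cases j <;> fin_cases k <;>
      first
      | exact absurd rfl hij
      | exact absurd rfl hik
      | exact absurd rfl hjk
      | (refine e _ _ ?_ hm; simp [cartanQ]; ring1)
      | (refine e _ _ ?_ hn; simp [cartanQ]; ring1)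
      | (refine e _ _ ?_ ht; simp [cartanQ]; ring1)
  irrational i j k hij hik hjk p q h := by
    change (p : ℂ) * R.root j (R.coroot i) + q * R.root k (R.coroot i) = 0 at h
    rw [R.root_coroot, R.root_coroot] at h
    have key : ∀ {m n t : ℤ} {a b c : ℂ}, IsQParameters m n t a b c →
        ((p * 1 + q * a : ℂ) = 0 → q = 0) ∧ ((p * a + q * 1 : ℂ) = 0 → q = 0) := by
      intro m n t a b c hQ
      refine ⟨fun h => hQ.eq_zero_of_add_mul_eq_zero (p := p) (by rw [← h, mul_one]), fun h => ?_⟩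
      have hp := hQ.eq_zero_of_add_mul_eq_zero (p := q) (q := p) (by rw [← h]; ring)
      rw [hp] at h
      simpa using h
    have h1 := key hQ
    have h2 := key hQ.rotate
    have h3 := key hQ.rotate.rotate
    fin_cases i <;> fin_cases j <;> fin_cases k <;>
      first
      | exact absurd rfl hij
      | exact absurd rfl hik
      | exact absurd rfl hjk
      | exact h1.1 h
      | exact h1.2 h
      | exact h2.1 h
      | exact h2.2 h
      | exact h3.1 h
      | exact h3.2 h
  span_coroot := span_coroot_cartanQ hQ R

include hQ in
-- Here x, y, z are the values of the weight on h_12, h_23, h_13 in the numbering from 1, and the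
-- displayed matrix with its scalar inverts the linear system expressing them through λ_1, λ_2, λ_3.
theorem isPositive_iff (lam : Module.Dual ℂ 𝔥) : (chevalley R).IsPositive lam ↔
    ∃ x y z : ℤ, 0 < x ∧ 0 < y ∧ 0 < z ∧
      (fun i => lam (R.coroot i)) = (a * b * c / (1 + a * b * c)) •
        (!![1, -1 / b, 1 / (b * c);
            1 / (a * c), 1, -1 / c;
            -1 / a, 1 / (b * a), 1] *ᵥ ![(x : ℂ), (y : ℂ), (z : ℂ)]) := by
  have ha := hQ.a_ne
  have hb := hQ.b_ne
  have hc := hQ.c_ne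
  have h0 := hQ.one_add_mul_ne_zero
  have hpair : ∀ i j, lam ((chevalley R).pairCoroot i j) =
      (cartanQ a b c i j)⁻¹ * lam (R.coroot i) + (cartanQ a b c j i)⁻¹ * lam (R.coroot j) := by
    intro i j
    change lam ((R.root j (R.coroot i))⁻¹ • R.coroot i +
        (R.root i (R.coroot j))⁻¹ • R.coroot j) = _
    simp only [map_add, map_smul, R.root_coroot, smul_eq_mul]
  have h01 : lam ((chevalley R).pairCoroot 0 1) = lam (R.coroot 0) + lam (R.coroot 1) / b := by
    rw [hpair]; simp [cartanQ]; ring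
  have h12 : lam ((chevalley R).pairCoroot 1 2) = lam (R.coroot 1) + lam (R.coroot 2) / c := by
    rw [hpair]; simp [cartanQ]; ring
  have h02 : lam ((chevalley R).pairCoroot 0 2) = lam (R.coroot 0) / a + lam (R.coroot 2) := by
    rw [hpair]; simp [cartanQ]; ring
  constructor
  · intro h
    obtain ⟨x, hx⟩ := h 0 1 (by decide)
    obtain ⟨y, hy⟩ := h 1 2 (by decide)
    obtain ⟨z, hz⟩ := h 0 2 (by decide)
    refine ⟨x + 1, y + 1, z + 1, by omega, by omega, by omega, ?_⟩
    push_cast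
    rw [← hx, ← hy, ← hz, h01, h12, h02]
    funext i
    fin_cases i <;> simp <;> field_simp <;> ring
  · rintro ⟨x, y, z, hx, hy, hz, h⟩
    have e0 := congrFun h 0
    have e1 := congrFun h 1
    have e2 := congrFun h 2
    simp at e0 e1 e2
    have hx' : lam ((chevalley R).pairCoroot 0 1) = x := by
      rw [h01, e0, e1]; field_simp; ring
    have hy' : lam ((chevalley R).pairCoroot 1 2) = y := by
      rw [h12, e1, e2]; field_simp; ring
    have hz' : lam ((chevalley R).pairCoroot 0 2) = z := by
      rw [h02, e0, e2]; field_simp; ring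
    have pos : ∀ {x : ℤ}, 0 < x → ∀ {w : ℂ}, w = x → ∃ k : ℕ, w = k + 1 := by
      rintro x hx w rfl
      obtain ⟨k, hk⟩ := Int.eq_ofNat_of_zero_le (show 0 ≤ x - 1 by omega)
      refine ⟨k, ?_⟩
      rw [show x = (k : ℤ) + 1 by omega]; push_cast; rfl
    intro i j hij
    fin_cases i <;> fin_cases j <;>
      first
      | exact absurd rfl hij
      | exact pos hx hx'
      | exact pos hy hy'
      | exact pos hz hz'
      | (rw [OddChevalley.pairCoroot_comm]; exact pos hx hx')
      | (rw [OddChevalley.pairCoroot_comm]; exact pos hy hy')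
      | (rw [OddChevalley.pairCoroot_comm]; exact pos hz hz')

/-! ### Integrability and typicality for modules over `Q^±(m,n,t)`. -/

section Modules

variable {R} {V : Type v} [AddCommGroup V] [Module ℂ V]
  {M : SuperModule (Contragredient R fun _ => 1) V} {lam : Module.Dual ℂ 𝔥}

theorem exists_isHighestVector (hM : M.IsHighestWeight lam) :
    ∃ v, (chevalley R).IsHighestVector M lam v := by
  obtain ⟨v, h0, hd, hX, hH, -⟩ := hM
  exact ⟨v, h0, hd, hX, hH⟩

include hQ in
theorem isIntegrable_of_isPositive (hirr : M.IsIrreducible) (hM : M.IsHighestWeight lam)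
    (h : (chevalley R).IsPositive lam) : M.IsIntegrable ∧ ¬ M.IsTrivial := by
  have hS := isGenericTriangle_chevalley hQ R
  obtain ⟨v, hv⟩ := exists_isHighestVector hM
  refine ⟨?_, fun htriv => ?_⟩
  · rintro α ⟨-, B, hB, i, hα⟩ x hx
    exact hS.toIsTriangle.locallyNilpotent_of_reachable hirr hv
      (hS.locallyNilpotent_pairY_of_isPositive hirr hv h) hB hα hx
  · have h1 := hv.act_H (R.coroot 0)
    rw [htriv, eq_comm] at h1
    exact smul_ne_zero (hS.coroot_ne_zero_of_isPositive h 0) hv.ne_zero h1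

include hQ in
theorem isPositive_of_isIntegrable (hirr : M.IsIrreducible) (hM : M.IsHighestWeight lam)
    (hint : M.IsIntegrable) (htriv : ¬ M.IsTrivial) : (chevalley R).IsPositive lam := by
  have hS := isGenericTriangle_chevalley hQ R
  obtain ⟨v, hv⟩ := exists_isHighestVector hM
  refine hS.isPositive_of_locallyNilpotent hirr hv (fun i j hij => ?_) htriv
  have t := hS.toIsTriangle.triple hij
  have hx : (chevalley R).pairY i j ∈ rootSpace R (fun _ => 1) (-(R.root i + R.root j)) := fun h => by
    rw [LinearMap.neg_apply, neg_smul]; exact t.H_f h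
  -- Integrability concerns roots only, and being a root requires a non-zero root vector; a
  -- vanishing vector is trivially nilpotent, so its non-vanishing need not be proved.
  by_cases h0 : (chevalley R).pairY i j = 0
  · intro u
    exact ⟨1, by rw [h0, map_zero, pow_one, LinearMap.zero_apply]⟩
  · obtain ⟨B, hB, hr⟩ := hS.toIsTriangle.exists_reachable_neg hij
    refine hint _ ⟨⟨fun h => ?_, _, hx, h0⟩, B, hB, i, Or.inl hr⟩ _ hx
    have h2 := t.root_coroot
    rw [show (chevalley R).root i + (chevalley R).root j = 0 from neg_eq_zero.1 h] at h2
    exact two_ne_zero h2.symm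

include hQ in
-- Typicality is a statement about the weight alone, but the argument uses weights of a module; the
-- constructed irreducible module supplies one. Every isotropic simple coroot is a multiple of a
-- Weyl translate of a standard one.
theorem isTypical_of_isPositive (h : (chevalley R).IsPositive lam) : IsTypical R (fun _ => 1) lam := by
  have hS := isGenericTriangle_chevalley hQ R
  obtain ⟨v, hv⟩ := exists_isHighestVector (isHighestWeight_irreducibleModule (R := R) (p := fun _ => 1)
    (lam := lam))
  intro ρ hρ B hB i hi
  -- The diagonal of the Cartan matrix is zero and the coroots span, so the Weyl vector is not
  -- merely allowed to be zero but forced to be.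
  have hρ0 : ρ = 0 := hS.ext_coroot fun i => by
    refine (hρ i).trans ?_
    fin_cases i <;> simp [cartanQ]
  obtain ⟨σ, hσ, k, hk, hco⟩ := hS.toIsTriangle.coroot_of_reachable hB hi
  rw [hρ0, add_zero, hco, map_smul]
  exact smul_ne_zero hk (hS.apply_weylGroup_coroot_ne_zero
    (isIrreducible_irreducibleModule) hv h hσ i)

theorem eq_zero_of_isTrivial (hM : M.IsHighestWeight lam) (h : M.IsTrivial) : lam = 0 := by
  obtain ⟨v, hv⟩ := exists_isHighestVector hM
  refine LinearMap.ext fun x => ?_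
  have h1 := hv.act_H x
  rw [h, eq_comm, smul_eq_zero] at h1
  exact h1.resolve_right hv.ne_zero

end Modules

end Q

end SuperKM

theorem mainTheorem3 {𝔥 : Type u} [AddCommGroup 𝔥] [Module ℂ 𝔥] (m n t : ℤ) (a b c : ℂ)
    (hQ : IsQParameters m n t a b c) (R : Realization (cartanQ a b c) 𝔥)
    (Λ : Set (Module.Dual ℂ 𝔥))
    (hΛ : Λ = {lam | ∃ x y z : ℤ, 0 < x ∧ 0 < y ∧ 0 < z ∧
      (fun i => lam (R.coroot i)) = (a * b * c / (1 + a * b * c)) •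
        (!![1, -1 / b, 1 / (b * c);
            1 / (a * c), 1, -1 / c;
            -1 / a, 1 / (b * a), 1] *ᵥ ![(x : ℂ), (y : ℂ), (z : ℂ)])}) :
    -- every weight `lam` is the highest weight of an irreducible highest weight module `L(lam)`,
    -- which is unique up to isomorphism
    (∀ lam : Module.Dual ℂ 𝔥, ∃ (L : Type u) (_ : AddCommGroup L) (_ : Module ℂ L)
      (ML : SuperModule (Contragredient R parityQ) L),
      ML.IsIrreducible ∧ ML.IsHighestWeight lam ∧
      ∀ (V : Type v) [AddCommGroup V] [Module ℂ V]
        (M : SuperModule (Contragredient R parityQ) V),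
        M.IsIrreducible → M.IsHighestWeight lam → M.IsIsomorphic ML) ∧
    -- the non-trivial integrable ones are exactly those with `lam ∈ Λ`
    (∀ (V : Type v) [AddCommGroup V] [Module ℂ V]
      (M : SuperModule (Contragredient R parityQ) V) (lam : Module.Dual ℂ 𝔥),
      M.IsIrreducible → M.IsHighestWeight lam →
        ((M.IsIntegrable ∧ ¬ M.IsTrivial) ↔ lam ∈ Λ)) ∧
    -- all these weights are typical
    (∀ lam ∈ Λ, IsTypical R parityQ lam) ∧
    -- a non-typical integrable weight is zero
    (∀ (V : Type v) [AddCommGroup V] [Module ℂ V]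
      (M : SuperModule (Contragredient R parityQ) V) (lam : Module.Dual ℂ 𝔥),
      M.IsIrreducible → M.IsHighestWeight lam → M.IsIntegrable →
        ¬ IsTypical R parityQ lam → lam = 0) := by
  have hΛ' : ∀ lam, lam ∈ Λ ↔ (chevalley R).IsPositive lam := fun lam => by
    rw [hΛ, isPositive_iff hQ]; rfl
  refine ⟨fun lam => ⟨_, _, _, irreducibleModule.{u} R parityQ lam, isIrreducible_irreducibleModule,
    isHighestWeight_irreducibleModule, fun V _ _ M => isIsomorphic_irreducibleModule⟩,
    fun V _ _ M lam hirr hM => ?_, fun lam hlam => isTypical_of_isPositive hQ ((hΛ' lam).1 hlam),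
    fun V _ _ M lam hirr hM hint htyp => ?_⟩
  · rw [hΛ']
    exact ⟨fun h => isPositive_of_isIntegrable hQ hirr hM h.1 h.2,
      isIntegrable_of_isPositive hQ hirr hM⟩
  -- A non-zero highest weight makes the module non-trivial, so integrability makes the weight
  -- positive and hence typical.
  · by_contra h0
    exact htyp (isTypical_of_isPositive hQ (isPositive_of_isIntegrable hQ hirr hM hint
      fun h => h0 (eq_zero_of_isTrivial hM h)))
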